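/- Conventions. Units are such that $[\hat x,\hat p]=i$; the Hilbert space of $n$ modes is $L^2(\mathbb R^n)$. Fix $s>0$ and $\gamma\in\mathbb R$, let $|\gamma\rangle_s$ be the single-mode state with wavefunction $e^{i\gamma x^3}e^{-x^2/(2s^2)}/(\sqrt s\,\pi^{1/4})$, and let $\sigma=(|\gamma\rangle_s\langle\gamma|_s)^{\otimes M}$, $M\ge 1$, be the ideal resource state. Let $$\mathcal W=\Bigl(1+\tfrac M2\Bigr)\mathbb 1+\sum_{k=1}^{M}\sum_{a=1}^{6}\lambda_a f_a^{(k)},$$ where $f_1,\dots,f_6=\hat x^2,\ \hat x^4,\ \hat p^2,\ \hat p^3,\ (\hat x-\hat p)^3,\ (\hat x+\hat p)^3$, where $\lambda_1,\dots,\lambda_6=-\frac1{2s^2},\ -\frac{9\gamma^2s^2}2,\ -\frac{s^2}2,\ -\gamma s^2,\ -\frac{\gamma s^2}2,\ \frac{\gamma s^2}2$, and where $f_a^{(k)}$ acts on mode $k$. Protocol. Alice chooses a threshold fidelity $0<F_T<1$, a significance level $0<\beta<1$ and an estimation error $0<\eta\le(1-F_T)/2$. Bob sends $N+1$ independent identical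 copies of an $M$-mode state $\rho$ (a density operator). On each of $N$ copies Alice draws a pair $(k,a)$ with probability $|\lambda_a|/\Lambda$, where $\Lambda=M\sum_a|\lambda_a|$, and measures $f_a^{(k)}$ by homodyne detection, with result $f$; $F_{\mathrm{low}}^{\mathrm{(est)}}$ is $1+\frac M2$ plus the sample mean of $\Lambda\,\mathrm{sign}(\lambda_a)f$. She accepts if and only if $F_{\mathrm{low}}^{\mathrm{(est)}}\ge F_T+\eta$. The last copy of $\rho$ serves as resource for her computation on an $m$-mode pure input state, which consists of unitary gates on her $m$ modes and $M$ cubic phase gates of nonzero strengths $\gamma_j=r_j^3\gamma$, $r_j\in\mathbb R\setminus\{0\}$, on modes $k_j$. (In the protocol the input and Alice's gates are Gaussian; the claim holds for any input and any unitary gates.) The $j$-th cubic phase gate is done by teleportation, that is by the following steps: squeezing $S(r_j)$ of mode $k_j$, where $S(r)^\dagger\hat xS(r)=r\hat x$; the gate $e^{i\hat x\otimes\hat p}$ between mode $k_j$ and the $j$-th mode of the resource; measurement of $\hat x$ on the latter, with outcome $x_j$; the correction $e^{-i\gamma x_j^3}e^{-3i\gamma x_j\hat x(\hat x+x_j)}$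 on mode $k_j$; and $S(r_j)^\dagger$. For each outcome $(x_1,\dots,x_M)$ let $|\Psi_{\mathrm{out}}\rangle$ be the normalized output that the ideal resource $\sigma$ gives for this outcome. The output is incorrect if the measurement $\{|\Psi_{\mathrm{out}}\rangle\langle\Psi_{\mathrm{out}}|,\ \mathbb 1-|\Psi_{\mathrm{out}}\rangle\langle\Psi_{\mathrm{out}}|\}$ on the actual output gives the second result; probabilities include the randomness of $(x_1,\dots,x_M)$. Finite energy. A state $\rho$ has energy at most $E$ per mode if $\operatorname{Tr}\bigl((f_a^{(k)})^2\rho\bigr)\le E$ for all $k$ and $a$. Theorem 2. For all $s>0$, $\gamma\in\mathbb R$ and $E\in\mathbb R$ there is a constant $C>0$ such that the following holds for all $m,M,N,F_T,\beta,\eta$ and all computations as above. Suppose that $$N\ \ge\ C\,\frac{M^2}{\eta^2}\,\ln\frac8\beta ,$$ or that $N$ is such that $\Pr\bigl(|F_{\mathrm{low}}^{\mathrm{(est)}}-\operatorname{Tr}(\mathcal W\rho)|<\eta\bigr)\ge1-\beta$ for every $\rho$ of energy at most $E$ per mode. Then the assisted computation is $\varepsilon$-verifiable with $\varepsilon=1-(1-\beta)F_T$: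 we have $0\le\varepsilon\le1$, and, for every $\rho$ of energy at most $E$ per mode, the joint probability that Alice accepts and that the output is incorrect is at most $\varepsilon$. -/

import Mathlib

open MeasureTheory
open scoped ENNReal FourierTransform InnerProductSpace

noncomputable section

namespace CVVerify

/-! ### Modes, wavefunctions, tensor products -/

/-- Position configurations of `n` modes, with Lebesgue measure. -/
abbrev Config (n : ℕ) := EuclideanSpace ℝ (Fin n)

/-- The Hilbert space of `n` modes in position representation, `L²(ℝⁿ)`. -/
abbrev Wave (n : ℕ) := Lp ℂ 2 (volume : Measure (Config n))

/-- The joint Hilbert space `L²(ℝᵐ × ℝᴹ)` of Alice's `m`-mode register and the `M`-mode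
resource register. -/
abbrev Joint (m M : ℕ) := Lp ℂ 2 (volume : Measure (Config m × Config M))

instance (m M : ℕ) : (volume : Measure (Config m × Config M)).IsAddHaarMeasure :=
  inferInstanceAs
    ((volume : Measure (Config m)).prod (volume : Measure (Config M))).IsAddHaarMeasure

lemma memLp_tensor {m M : ℕ} (ψ : Wave m) (φ : Wave M) :
    MemLp (fun z : Config m × Config M => ψ z.1 * φ z.2) 2 volume := by
  have h1 := Lp.memLp ψ
  have h2 := Lp.memLp φ
  have hm : AEStronglyMeasurable (fun z : Config m × Config M => ψ z.1 * φ z.2) volume :=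
    (h1.1.comp_fst).mul (h2.1.comp_snd)
  rw [memLp_two_iff_integrable_sq_norm hm]
  have := ((memLp_two_iff_integrable_sq_norm h1.1).1 h1).mul_prod
    ((memLp_two_iff_integrable_sq_norm h2.1).1 h2)
  simp only [norm_mul, mul_pow]
  exact this

/-- The product vector `ψ ⊗ φ`. -/
def tensor {m M : ℕ} (ψ : Wave m) (φ : Wave M) : Joint m M := (memLp_tensor ψ φ).toLp _

/-! ### Elementary unitaries -/

section Elementary

variable {X : Type*} [MeasurableSpace X] {μ : Measure X}

lemma memLp_phase {θ : X → ℝ} (hθ : Measurable θ) (f : Lp ℂ 2 μ) :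
    MemLp (fun x => Complex.exp (Complex.I * θ x) * f x) 2 μ := by
  refine MemLp.of_le (Lp.memLp f) ?_ (Filter.Eventually.of_forall fun x => ?_)
  · exact (Measurable.aestronglyMeasurable (by fun_prop)).mul (Lp.memLp f).1
  · rw [norm_mul, mul_comm Complex.I, Complex.norm_exp_ofReal_mul_I, one_mul]

/-- Multiplication by the phase `exp(i θ(x))`, that is the unitary `exp(i θ(x̂))`. -/
def phase (θ : X → ℝ) (hθ : Measurable θ) (f : Lp ℂ 2 μ) : Lp ℂ 2 μ :=
  (memLp_phase hθ f).toLp _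

end Elementary

section Substitution

variable {X : Type*} [NormedAddCommGroup X] [NormedSpace ℝ X] [FiniteDimensional ℝ X]
  [MeasurableSpace X] [BorelSpace X] {μ : Measure X} [μ.IsAddHaarMeasure]

lemma memLp_substitute (T : X ≃ₗ[ℝ] X) (f : Lp ℂ 2 μ) :
    MemLp (fun x => (Real.sqrt |LinearMap.det (T : X →ₗ[ℝ] X)| : ℂ) * f (T x)) 2 μ := by
  have hdet : LinearMap.det (T : X →ₗ[ℝ] X) ≠ 0 := T.isUnit_det'.ne_zero
  have hmeas : Measurable T := T.toContinuousLinearEquiv.continuous.measurable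
  have hmap : MeasurePreserving T μ
      (ENNReal.ofReal |(LinearMap.det (T : X →ₗ[ℝ] X))⁻¹| • μ) :=
    ⟨hmeas, Measure.map_linearMap_addHaar_eq_smul_addHaar μ hdet⟩
  exact (((Lp.memLp f).smul_measure ENNReal.ofReal_ne_top).comp_measurePreserving hmap).const_mul _

/-- The unitary change of variables `f ↦ |det T|^{1/2} f ∘ T` of a linear automorphism `T`. -/
def substitute (T : X ≃ₗ[ℝ] X) (f : Lp ℂ 2 μ) : Lp ℂ 2 μ := (memLp_substitute T f).toLp _

end Substitution

/-! ### Mixed states -/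

section States

variable (H : Type*) [NormedAddCommGroup H] [InnerProductSpace ℂ H] [CompleteSpace H]

/-- The index set of a fixed orthonormal basis of `H`. -/
def basisIndex : Set H := (exists_hilbertBasis ℂ H).choose

/-- A fixed orthonormal (Hilbert) basis of `H`. -/
def basis : HilbertBasis (basisIndex H) ℂ H := (exists_hilbertBasis ℂ H).choose_spec.choose

/-- A density operator: a positive operator whose trace is `1`. -/
structure DensityOperator where
  /-- the operator -/
  op : H →L[ℂ] H
  isPositive : op.IsPositive
  trace_eq_one : HasSum (fun i => ⟪basis H i, op (basis H i)⟫_ℂ) 1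

variable {H}

/-- The vectors `√ρ eᵢ`; they satisfy `ρ = ∑ᵢ |√ρ eᵢ⟩⟨√ρ eᵢ|` (see `DensityOperator.hasSum_vec`),
so that `Tr(A ρ A†) = ∑ᵢ ‖A √ρ eᵢ‖²`. -/
def DensityOperator.vec (ρ : DensityOperator H) (i : basisIndex H) : H :=
  (CFC.sqrt ρ.op) (basis H i)

lemma DensityOperator.hasSum_vec (ρ : DensityOperator H) (f g : H) :
    HasSum (fun i => ⟪g, ρ.vec i⟫_ℂ * ⟪ρ.vec i, f⟫_ℂ) ⟪g, ρ.op f⟫_ℂ := by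
  have h0 : (0 : H →L[ℂ] H) ≤ ρ.op := (ContinuousLinearMap.nonneg_iff_isPositive _).2 ρ.isPositive
  have hsq : CFC.sqrt ρ.op * CFC.sqrt ρ.op = ρ.op := CFC.sqrt_mul_sqrt_self ρ.op h0
  have hS : (CFC.sqrt ρ.op).IsPositive :=
    (ContinuousLinearMap.nonneg_iff_isPositive _).1 (CFC.sqrt_nonneg ρ.op)
  have hsym : ∀ u v : H, ⟪(CFC.sqrt ρ.op) u, v⟫_ℂ = ⟪u, (CFC.sqrt ρ.op) v⟫_ℂ :=
    hS.isSymmetric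
  have h := (basis H).hasSum_inner_mul_inner ((CFC.sqrt ρ.op) g) ((CFC.sqrt ρ.op) f)
  have e : ⟪(CFC.sqrt ρ.op) g, (CFC.sqrt ρ.op) f⟫_ℂ = ⟪g, ρ.op f⟫_ℂ := by
    rw [hsym, ← mul_apply_eq_comp, hsq]
  rw [e] at h
  have e' : (fun i => ⟪g, ρ.vec i⟫_ℂ * ⟪ρ.vec i, f⟫_ℂ) = fun i =>
      ⟪(CFC.sqrt ρ.op) g, basis H i⟫_ℂ * ⟪basis H i, (CFC.sqrt ρ.op) f⟫_ℂ := by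
    funext i
    rw [DensityOperator.vec, hsym g, hsym (basis H i)]
  rw [e']
  exact h

end States

/-! ### Homodyne detection -/

/-- The homodyne bases: the single-mode quadratures `x̂`, `p̂`, `x̂ - p̂`, `x̂ + p̂`. -/
inductive Quadrature
  | x
  | p
  | xSubP
  | xAddP

/-- The phase `exp(i c x̂ₖ²/2)` on mode `k`; it satisfies
`exp(-i c x̂²/2) p̂ exp(i c x̂²/2) = p̂ + c x̂`. -/
def chirp {M : ℕ} (k : Fin M) (c : ℝ) (φ : Wave M) : Wave M :=
  phase (fun x => c * x k ^ 2 / 2) (by fun_prop) φ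

/-- The position density of a vector, as a measure. -/
def bornMeasure {M : ℕ} (φ : Wave M) : Measure (Config M) :=
  volume.withDensity fun x => ENNReal.ofReal (‖φ x‖ ^ 2)

/-- The law of the outcome when the quadrature `q` of mode `k` is measured in the vector `φ`
(`ħ = 1`; the momentum is `2π` times the frequency of the Fourier transform
`∫ exp(-2πi⟨x, ξ⟩) φ(x) dx`). -/
def vecHomodyne {M : ℕ} (q : Quadrature) (k : Fin M) (φ : Wave M) : Measure ℝ :=
  match q with
  | .x => (bornMeasure φ).map fun x => x k
  | .p => (bornMeasure (𝓕 φ)).map fun ξ => 2 * Real.pi * ξ k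
  | .xSubP => (bornMeasure (𝓕 (chirp k (-1) φ))).map fun ξ => -(2 * Real.pi * ξ k)
  | .xAddP => (bornMeasure (𝓕 (chirp k 1 φ))).map fun ξ => 2 * Real.pi * ξ k

/-- The law of the outcome when the quadrature `q` of mode `k` is measured in the state `ρ`. -/
def homodyne {M : ℕ} (ρ : DensityOperator (Wave M)) (q : Quadrature) (k : Fin M) : Measure ℝ :=
  Measure.sum fun i => vecHomodyne q k (ρ.vec i)

/-! ### The ideal resource state -/

/-- The wavefunction of the product of `M` finitely squeezed cubic phase states,
`∏ₖ exp(i γ xₖ³) exp(-xₖ²/(2s²)) / (√s π^{1/4})`. -/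
def cubicFun (s γ : ℝ) (M : ℕ) (x : Config M) : ℂ :=
  ∏ k, Complex.exp (Complex.I * γ * (x k : ℂ) ^ 3) * Complex.exp (-(x k : ℂ) ^ 2 / (2 * s ^ 2)) /
    ((Real.sqrt s * Real.pi ^ (1 / 4 : ℝ) : ℝ) : ℂ)

lemma memLp_cubicFun {s : ℝ} (hs : 0 < s) (γ : ℝ) (M : ℕ) :
    MemLp (cubicFun s γ M) 2 volume := by
  have hm : AEStronglyMeasurable (cubicFun s γ M) volume := by
    refine Continuous.aestronglyMeasurable ?_
    unfold cubicFun
    fun_prop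
  rw [memLp_two_iff_integrable_sq_norm hm]
  have hb : 0 < ((1 / s ^ 2 : ℝ) : ℂ).re := by
    rw [Complex.ofReal_re]; positivity
  have hg := (GaussianFourier.integrable_cexp_neg_mul_sq_norm_add (V := Config M) hb 0 0).norm
  refine (hg.const_mul ((∏ _k : Fin M, (Real.sqrt s * Real.pi ^ (1 / 4 : ℝ))⁻¹) ^ 2)).congr
    (Filter.Eventually.of_forall fun x => ?_)
  have hnorm : ∀ k : Fin M, ‖Complex.exp (Complex.I * γ * (x k : ℂ) ^ 3) *
      Complex.exp (-(x k : ℂ) ^ 2 / (2 * s ^ 2)) /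
      ((Real.sqrt s * Real.pi ^ (1 / 4 : ℝ) : ℝ) : ℂ)‖ =
      Real.exp (-(x k) ^ 2 / (2 * s ^ 2)) * (Real.sqrt s * Real.pi ^ (1 / 4 : ℝ))⁻¹ := by
    intro k
    have h1 : Complex.I * γ * (x k : ℂ) ^ 3 = ((γ * x k ^ 3 : ℝ) : ℂ) * Complex.I := by
      push_cast; ring
    have h2 : -(x k : ℂ) ^ 2 / (2 * s ^ 2) = ((-(x k) ^ 2 / (2 * s ^ 2) : ℝ) : ℂ) := by
      push_cast; ring
    have h3 : 0 ≤ Real.sqrt s * Real.pi ^ (1 / 4 : ℝ) := by positivity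
    rw [norm_div, norm_mul, h1, h2, Complex.norm_exp_ofReal_mul_I, one_mul, Complex.norm_exp,
      Complex.ofReal_re, Complex.norm_of_nonneg h3, div_eq_mul_inv]
  have hexp : ‖Complex.exp (-((1 / s ^ 2 : ℝ) : ℂ) * (‖x‖ : ℂ) ^ 2 +
      0 * ((⟪(0 : Config M), x⟫_ℝ : ℝ) : ℂ))‖ =
      (∏ k : Fin M, Real.exp (-(x k) ^ 2 / (2 * s ^ 2))) ^ 2 := by
    have h : -((1 / s ^ 2 : ℝ) : ℂ) * (‖x‖ : ℂ) ^ 2 + 0 * ((⟪(0 : Config M), x⟫_ℝ : ℝ) : ℂ) =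
        ((-(1 / s ^ 2) * ‖x‖ ^ 2 : ℝ) : ℂ) := by
      push_cast; ring
    rw [h, Complex.norm_exp, Complex.ofReal_re, ← Real.exp_sum, ← Real.exp_nat_mul,
      EuclideanSpace.norm_sq_eq]
    congr 1
    rw [Finset.mul_sum, Finset.mul_sum]
    refine Finset.sum_congr rfl fun k _ => ?_
    rw [Real.norm_eq_abs, sq_abs]
    push_cast
    field_simp
  simp only [cubicFun]
  rw [hexp, norm_prod, Finset.prod_congr rfl fun k _ => hnorm k, Finset.prod_mul_distrib]
  ring

/-- The ideal `M`-mode resource vector; its projector is the target state `σ`. -/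
def cubic (s : ℝ) (hs : 0 < s) (γ : ℝ) (M : ℕ) : Wave M := (memLp_cubicFun hs γ M).toLp _

/-! ### The fidelity witness and the verification test -/

/-- The six single-mode observables `x̂²`, `x̂⁴`, `p̂²`, `p̂³`, `(x̂ - p̂)³`, `(x̂ + p̂)³` of the
witness: the quadrature, -/
def quad : Fin 6 → Quadrature :=
  ![.x, .x, .p, .p, .xSubP, .xAddP]

/-- the power of it, -/
def deg : Fin 6 → ℕ :=
  ![2, 4, 2, 3, 3, 3]

/-- and the coefficient `λ` in the witness
`W = (1 + M/2) 1 + ∑ₖ ∑ₐ λₐ fₐ⁽ᵏ⁾`. Here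
`∑ₐ λₐ fₐ = -(x̂²/(2s²) + (s²/2)(p̂ - 3γx̂²)²) = -(V n̂ V† + 1/2)`,
where `V n̂ V†` is the number operator transported to the cubic phase state. -/
def coeff (s γ : ℝ) : Fin 6 → ℝ :=
  ![-(1 / (2 * s ^ 2)), -(9 * γ ^ 2 * s ^ 2 / 2), -(s ^ 2 / 2), -(γ * s ^ 2),
    -(γ * s ^ 2 / 2), γ * s ^ 2 / 2]

/-- `∑ |λ|` over all modes and observables. -/
def totalWeight (s γ : ℝ) (M : ℕ) : ℝ := ∑ _k : Fin M, ∑ a, |coeff s γ a|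

/-- `F_low = Tr(W ρ)`. -/
def witnessValue (s γ : ℝ) {M : ℕ} (ρ : DensityOperator (Wave M)) : ℝ :=
  1 + (M : ℝ) / 2 + ∑ k : Fin M, ∑ a, coeff s γ a * ∫ v, v ^ deg a ∂(homodyne ρ (quad a) k)

/-- The record of one test measurement: the mode and the observable that were drawn, and the
measured value of the quadrature. -/
abbrev Trial (M : ℕ) := (Fin M × Fin 6) × ℝ

/-- Importance sampling on one copy of `ρ`: draw the observable with probability proportional to
the modulus of its coefficient, then measure its quadrature. -/
def trialLaw (s γ : ℝ) {M : ℕ} (ρ : DensityOperator (Wave M)) : Measure (Trial M) :=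
  ∑ a : Fin M × Fin 6, ENNReal.ofReal (|coeff s γ a.2| / totalWeight s γ M) •
    (homodyne ρ (quad a.2) a.1).map fun v => (a, v)

/-- The law of the test records of `N` independent copies of `ρ`. -/
def testLaw (s γ : ℝ) {M : ℕ} (N : ℕ) (ρ : DensityOperator (Wave M)) :
    Measure (Fin N → Trial M) :=
  Measure.pi fun _ => trialLaw s γ ρ

/-- The estimate `F_low^(est)`: the constant `1 + M/2` plus the sample mean of
`(∑ |λ|) sign(λ) f`, where `f` is the measured value of the drawn observable. -/
def estimate (s γ : ℝ) {M N : ℕ} (t : Fin N → Trial M) : ℝ :=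
  1 + (M : ℝ) / 2 + (1 / (N : ℝ)) * ∑ j, totalWeight s γ M * SignType.sign (coeff s γ (t j).1.2) *
    (t j).2 ^ deg (t j).1.2

/-- Alice accepts. -/
def Accepts (s γ F_T η : ℝ) {M N : ℕ} (t : Fin N → Trial M) : Prop :=
  F_T + η ≤ estimate s γ t

/-- Finite energy per mode: the second moments `Tr(f² ρ)` of the measured local observables `f`
are at most `E` in every mode. -/
def FiniteEnergy (E : ℝ) {M : ℕ} (ρ : DensityOperator (Wave M)) : Prop :=
  ∀ (k : Fin M) (a : Fin 6),
    ∫⁻ v, ENNReal.ofReal ((v ^ deg a) ^ 2) ∂(homodyne ρ (quad a) k) ≤ ENNReal.ofReal E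

/-- On every state of energy at most `E` per mode, the test with `N` copies estimates `F_low` to
precision `η` with failure probability at most `β`. -/
def TestAccurate (s γ E η β : ℝ) (M N : ℕ) : Prop :=
  ∀ ρ : DensityOperator (Wave M), FiniteEnergy E ρ →
    ENNReal.ofReal (1 - β) ≤ testLaw s γ N ρ {t | |estimate s γ t - witnessValue s γ ρ| < η}

/-! ### Alice's computation -/

/-- The scaling `y_k ↦ y_k / r` of one coordinate of the register. -/
def scaleEquiv {m M : ℕ} (k : Fin m) (r : ℝˣ) :
    (Config m × Config M) ≃ₗ[ℝ] (Config m × Config M) where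
  toFun z := (z.1 + (((r⁻¹ : ℝˣ) : ℝ) * z.1 k - z.1 k) • EuclideanSpace.single k (1 : ℝ), z.2)
  invFun z := (z.1 + ((r : ℝ) * z.1 k - z.1 k) • EuclideanSpace.single k (1 : ℝ), z.2)
  map_add' z w := by
    ext l
    · by_cases h : l = k <;> (simp [h]; try ring)
    · simp
  map_smul' c z := by
    ext l
    · by_cases h : l = k <;> (simp [h]; try ring)
    · simp
  left_inv z := by
    ext l
    · by_cases h : l = k
      · subst h; simp
      · simp [h]
    · simp
  right_inv z := by
    ext l
    · by_cases h : l = k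
      · subst h; simp
      · simp [h]
    · simp

/-- The squeezing `S(r)` of register mode `k`: `(S(r) f)(y) = |r|^{-1/2} f(…, y_k / r, …)`, so that
`S(r)† x̂ S(r) = r x̂` and `S(r)† = S(r⁻¹)`. -/
def squeeze {m M : ℕ} (k : Fin m) (r : ℝˣ) (Φ : Joint m M) : Joint m M :=
  substitute (scaleEquiv k r) Φ

/-- The shear `x_j ↦ x_j + y_k`. -/
def shearEquiv {m M : ℕ} (k : Fin m) (j : Fin M) :
    (Config m × Config M) ≃ₗ[ℝ] (Config m × Config M) where
  toFun z := (z.1, z.2 + z.1 k • EuclideanSpace.single j (1 : ℝ))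
  invFun z := (z.1, z.2 - z.1 k • EuclideanSpace.single j (1 : ℝ))
  map_add' z w := by
    ext l
    · simp
    · by_cases h : l = j <;> (simp [h]; try ring)
  map_smul' c z := by
    ext l
    · simp
    · by_cases h : l = j <;> (simp [h]; try ring)
  left_inv z := by ext l <;> simp
  right_inv z := by ext l <;> simp

/-- The entangling gate `exp(i x̂_k ⊗ p̂_j)` between register mode `k` and resource mode `j`:
`Φ(y, x) ↦ Φ(y, x + y_k e_j)`. -/
def sumGate {m M : ℕ} (k : Fin m) (j : Fin M) (Φ : Joint m M) : Joint m M :=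
  substitute (shearEquiv k j) Φ

/-- The Gaussian correction `G⁻¹(x_meas) = exp(-iγ x_meas³) exp(-3iγ x_meas ŷ_k (ŷ_k + x_meas))`,
controlled by the value `x_meas = x_j` of the measured resource mode. -/
def correction {m M : ℕ} (γ : ℝ) (k : Fin m) (j : Fin M) (Φ : Joint m M) : Joint m M :=
  phase (fun z => -(γ * z.2 j ^ 3) - 3 * γ * z.2 j * z.1 k * (z.1 k + z.2 j)) (by fun_prop) Φ

/-- Teleportation of the cubic phase gate of strength `r³γ` to register mode `k` with the resource
mode `j`. The measurement of `x̂_j` is read out at the end, in `Circuit.verdictLaw`: all later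
operations commute with `x̂_j`. -/
def teleport {m M : ℕ} (γ : ℝ) (r : ℝˣ) (k : Fin m) (j : Fin M) (Φ : Joint m M) : Joint m M :=
  squeeze k r⁻¹ (correction γ k j (sumGate k j (squeeze k r Φ)))

/-- A unitary of the register and the resource modes that is of the form `V ⊗ 1`, where `V` is a
unitary of the register. -/
def IsRegisterGate {m M : ℕ} (U : Joint m M ≃ₗᵢ[ℂ] Joint m M) : Prop :=
  ∃ V : Wave m ≃ₗᵢ[ℂ] Wave m, ∀ (ψ : Wave m) (φ : Wave M), U (tensor ψ φ) = tensor (V ψ) φ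

/-- Alice's computation: a pure input state of `m` modes, and `M` cubic phase gates interleaved
with unitary gates of the `m` modes. Gate number `j` acts before the `j`-th cubic phase gate and
gate number `M` at the end; the `j`-th cubic phase gate has strength `(r j)³γ` and acts on mode
`mode j`. (Alice's input and gates are Gaussian in the protocol; any others are allowed here.) -/
structure Circuit (m M : ℕ) where
  /-- input state -/
  input : Wave m
  norm_input : ‖input‖ = 1
  /-- Alice's own gates -/
  gate : Fin (M + 1) → (Joint m M ≃ₗᵢ[ℂ] Joint m M)
  isRegisterGate : ∀ j, IsRegisterGate (gate j)
  /-- the mode on which the cubic phase gate acts -/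
  mode : Fin M → Fin m
  /-- Alice's private squeezing parameter -/
  r : Fin M → ℝˣ

namespace Circuit

variable {m M : ℕ} (A : Circuit m M)

/-- The joint vector before the measured values of the resource modes are read out, when the
resource is in the pure state `φ`. -/
def run (γ : ℝ) (φ : Wave M) : Joint m M :=
  A.gate (Fin.last M) ((List.finRange M).foldl
    (fun Φ j => teleport γ (A.r j) (A.mode j) j (A.gate j.castSucc Φ)) (tensor A.input φ))

/-- The ideal (unnormalized) output `Ψ_out` for the measured values `x`. -/
def idealOutput (s : ℝ) (hs : 0 < s) (γ : ℝ) (x : Config M) : Config m → ℂ :=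
  fun y => A.run γ (cubic s hs γ M) (y, x)

/-- The component along the ideal output, `P_correct`, of the output for the measured
values `x`. -/
def correctPart (s : ℝ) (hs : 0 < s) (γ : ℝ) (φ : Wave M) (x : Config M) : Config m → ℂ :=
  fun y => (∫ y', star (A.idealOutput s hs γ x y') * A.run γ φ (y', x)) /
    (∫ y', ‖A.idealOutput s hs γ x y'‖ ^ 2 : ℝ) * A.idealOutput s hs γ x y

/-- The component `P_incorrect = 1 - P_correct` of the output for the measured values `x`. -/
def incorrectPart (s : ℝ) (hs : 0 < s) (γ : ℝ) (φ : Wave M) (x : Config M) : Config m → ℂ :=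
  fun y => A.run γ φ (y, x) - A.correctPart s hs γ φ x y

/-- The joint law of the measured values of the resource modes and of the verdict of the
projective measurement `{P_correct, P_incorrect}` on the output (`true` for correct), when the
computation consumes the state `ρ`. -/
def verdictLaw (s : ℝ) (hs : 0 < s) (γ : ℝ) (ρ : DensityOperator (Wave M)) :
    Measure (Config M × Bool) :=
  Measure.sum fun i =>
    (volume.withDensity fun x =>
      ∫⁻ y, ENNReal.ofReal (‖A.correctPart s hs γ (ρ.vec i) x y‖ ^ 2)).map (fun x => (x, true)) +
    (volume.withDensity fun x =>
      ∫⁻ y, ENNReal.ofReal (‖A.incorrectPart s hs γ (ρ.vec i) x y‖ ^ 2)).map (fun x => (x, false))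

/-- The law of a whole run on `N + 1` independent copies of `ρ`: the records of the `N` test
copies, and the computation with the remaining copy. -/
def runLaw (s : ℝ) (hs : 0 < s) (γ : ℝ) (N : ℕ) (ρ : DensityOperator (Wave M)) :
    Measure ((Fin N → Trial M) × (Config M × Bool)) :=
  (testLaw s γ N ρ).prod (A.verdictLaw s hs γ ρ)

/-- The assisted computation is `ε`-verifiable against a server who prepares independent identical
copies of a state of energy at most `E` per mode: the joint probability that Alice accepts and
that the output is incorrect is at most `ε`. -/
def IsVerifiable (s : ℝ) (hs : 0 < s) (γ F_T η : ℝ) (N : ℕ) (E ε : ℝ) : Prop :=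
  0 ≤ ε ∧ ε ≤ 1 ∧ ∀ ρ : DensityOperator (Wave M), FiniteEnergy E ρ →
    A.runLaw s hs γ N ρ {z | Accepts s γ F_T η z.1 ∧ z.2.2 = false} ≤ ENNReal.ofReal ε

end Circuit

end CVVerify

end

noncomputable section

namespace CVVerify

open scoped ContDiff

/-! ### Square-integrable functions -/

section LTwo

variable {X : Type*} [MeasurableSpace X] {μ : Measure X}

/-! Write `Ψ` for the ideal resource vector, `F = ⟨Ψ, ρ Ψ⟩` for the fidelity and `w = Tr(W ρ)` for
the witness value. The proof bounds the probability of an incorrect output by `1 - F ≤ 1 - w` and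
multiplies it by the probability of acceptance, the test copies being independent of the copy that
is consumed.

Computation. With the readouts deferred to the end, the joint vector depends on the resource vector
`φ` through a linear isometry (`Circuit.exists_linearIsometry_run`). Split `φ = c Ψ + h` with `h ⊥
Ψ`. For every outcome, the part coming from `c Ψ` is proportional to the ideal output and is removed
by the incorrect projector, so an incorrect output has weight at most `‖h‖²`
(`Circuit.lintegral_incorrectPart_le`). Summing over the vectors `√ρ eᵢ` gives `1 - F`.

Witness. With the annihilation operators `aₖ = (s/√2)(∂ₖ + xₖ/s² - 3iγxₖ²)` of the cubic phase
state, `W = 1 - n` where `n = ∑ₖ aₖ† aₖ`; `exists_lowering_eq` proves this as an identity of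
moments, on vectors of finite energy. Then `w ≤ F` is the spectral gap `n ≥ 1 - |Ψ⟩⟨Ψ|`, which is
`HasLowering.norm_sq_sub_le`. It is proved by duality against the coherent states `g_b = exp(i b·x)
Ψ`, so that only the vectors `aₖ f` are needed and no domain of `n`. On the span of the `g_b` one
has `⟨n g, f⟩ = ∑ₖ ⟨aₖ g, aₖ f⟩` and `n² = n + ∑ aₖ† aₗ† aₖ aₗ`, hence `∑ₖ ‖aₖ g‖² ≤ ‖n g‖²`. The
vectors `n g` are dense in the complement of `Ψ`, so the part of `f` orthogonal to `Ψ` has squared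
norm at most `∑ₖ ‖aₖ f‖²`.

Test. If `w ≥ F_T`, the output is incorrect with probability at most `1 - F_T ≤ ε`. If `w < F_T`,
acceptance requires the estimate to exceed `w` by at least `F_T + η - w > η`. An accurate test
allows this with probability at most `β ≤ ε`. For large `N`, Chebyshev's inequality bounds the
probability by `η² / (F_T + η - w)²`, whose product with `1 - w` is at most `1 - F_T`
(`chebyshev_mul_infidelity_le`). -/

lemma lintegral_norm_sq_eq (f : Lp ℂ 2 μ) :
    ∫⁻ x, ENNReal.ofReal (‖f x‖ ^ 2) ∂μ = ENNReal.ofReal (‖f‖ ^ 2) := by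
  have hi : Integrable (fun x => ‖f x‖ ^ 2) μ :=
    (memLp_two_iff_integrable_sq_norm (Lp.memLp f).1).1 (Lp.memLp f)
  rw [← ofReal_integral_eq_lintegral_ofReal hi (Filter.Eventually.of_forall fun x => by positivity)]
  congr 1
  have h := L2.inner_def (𝕜 := ℂ) f f
  have h2 : ∀ x, ⟪f x, f x⟫_ℂ = ((‖f x‖ ^ 2 : ℝ) : ℂ) := fun x => by
    rw [inner_self_eq_norm_sq_to_K]; norm_cast
  simp only [h2] at h
  rw [integral_complex_ofReal, inner_self_eq_norm_sq_to_K] at h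
  exact Complex.ofReal_injective (by rw [← h]; push_cast; rfl)

lemma integral_norm_sq_eq (f : Lp ℂ 2 μ) : ∫ x, ‖f x‖ ^ 2 ∂μ = ‖f‖ ^ 2 := by
  have hi : Integrable (fun x => ‖f x‖ ^ 2) μ :=
    (memLp_two_iff_integrable_sq_norm (Lp.memLp f).1).1 (Lp.memLp f)
  rw [integral_eq_lintegral_of_nonneg_ae (Filter.Eventually.of_forall fun x => by positivity) hi.1,
    lintegral_norm_sq_eq, ENNReal.toReal_ofReal (by positivity)]

lemma coeFn_phase {θ : X → ℝ} (hθ : Measurable θ) (f : Lp ℂ 2 μ) :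
    phase θ hθ f =ᵐ[μ] fun x => Complex.exp (Complex.I * θ x) * f x :=
  (memLp_phase hθ f).coeFn_toLp

lemma norm_phase {θ : X → ℝ} (hθ : Measurable θ) (f : Lp ℂ 2 μ) : ‖phase θ hθ f‖ = ‖f‖ := by
  rw [Lp.norm_def, Lp.norm_def]
  congr 1
  refine eLpNorm_congr_norm_ae ?_
  filter_upwards [coeFn_phase hθ f] with x hx
  rw [hx, norm_mul, mul_comm Complex.I, Complex.norm_exp_ofReal_mul_I, one_mul]

/-- The map `F` is (the function underlying) a linear isometry. -/
def IsLinearIsometry {H : Type*} [NormedAddCommGroup H] [NormedSpace ℂ H] (F : H → H) : Prop :=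
  ∃ L : H →ₗᵢ[ℂ] H, ∀ f, L f = F f

lemma IsLinearIsometry.comp {H : Type*} [NormedAddCommGroup H] [NormedSpace ℂ H] {F G : H → H}
    (hF : IsLinearIsometry F) (hG : IsLinearIsometry G) : IsLinearIsometry fun f => F (G f) := by
  obtain ⟨L, hL⟩ := hF
  obtain ⟨K, hK⟩ := hG
  exact ⟨L.comp K, fun f => by simp [hL, hK]⟩

lemma isLinearIsometry_phase {θ : X → ℝ} (hθ : Measurable θ) :
    IsLinearIsometry (phase (μ := μ) θ hθ) := by
  refine ⟨⟨⟨⟨phase θ hθ, fun f g => ?_⟩, fun c f => ?_⟩, norm_phase hθ⟩, fun _ => rfl⟩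
  · refine Lp.ext ?_
    filter_upwards [coeFn_phase hθ (f + g), coeFn_phase hθ f, coeFn_phase hθ g,
      Lp.coeFn_add f g, Lp.coeFn_add (phase θ hθ f) (phase θ hθ g)] with x h1 h2 h3 h4 h5
    rw [h1, h5, Pi.add_apply, h2, h3, h4, Pi.add_apply]
    ring
  · refine Lp.ext ?_
    filter_upwards [coeFn_phase hθ (c • f), coeFn_phase hθ f,
      Lp.coeFn_smul c f, Lp.coeFn_smul c (phase θ hθ f)] with x h1 h2 h4 h5
    simp only [RingHom.id_apply]
    rw [h1, h5, Pi.smul_apply, h2, h4, Pi.smul_apply, smul_eq_mul, smul_eq_mul]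
    ring

end LTwo

/-! ### Linear changes of variables as isometries -/

section Substitution

variable {X : Type*} [NormedAddCommGroup X] [NormedSpace ℝ X] [FiniteDimensional ℝ X]
  [MeasurableSpace X] [BorelSpace X] {μ : Measure X} [μ.IsAddHaarMeasure]

lemma measurePreserving_linearEquiv (T : X ≃ₗ[ℝ] X) : MeasurePreserving T μ
    (ENNReal.ofReal |(LinearMap.det (T : X →ₗ[ℝ] X))⁻¹| • μ) :=
  ⟨T.toContinuousLinearEquiv.continuous.measurable,
    Measure.map_linearMap_addHaar_eq_smul_addHaar μ T.isUnit_det'.ne_zero⟩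

lemma quasiMeasurePreserving_linearEquiv (T : X ≃ₗ[ℝ] X) :
    Measure.QuasiMeasurePreserving T μ μ := by
  refine ⟨T.toContinuousLinearEquiv.continuous.measurable, ?_⟩
  rw [(measurePreserving_linearEquiv T).map_eq]
  exact Measure.smul_absolutelyContinuous

lemma coeFn_substitute (T : X ≃ₗ[ℝ] X) (f : Lp ℂ 2 μ) : substitute T f =ᵐ[μ] fun x =>
    (Real.sqrt |LinearMap.det (T : X →ₗ[ℝ] X)| : ℂ) * f (T x) :=
  (memLp_substitute T f).coeFn_toLp

lemma norm_substitute (T : X ≃ₗ[ℝ] X) (f : Lp ℂ 2 μ) : ‖substitute T f‖ = ‖f‖ := by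
  have hdet : LinearMap.det (T : X →ₗ[ℝ] X) ≠ 0 := T.isUnit_det'.ne_zero
  rw [← sq_eq_sq₀ (norm_nonneg _) (norm_nonneg _), ← ENNReal.ofReal_eq_ofReal_iff (by positivity)
    (by positivity), ← lintegral_norm_sq_eq, ← lintegral_norm_sq_eq]
  have h1 : ∫⁻ x, ENNReal.ofReal (‖substitute T f x‖ ^ 2) ∂μ =
      ∫⁻ x, ENNReal.ofReal |LinearMap.det (T : X →ₗ[ℝ] X)| *
        ENNReal.ofReal (‖f (T x)‖ ^ 2) ∂μ := by
    refine lintegral_congr_ae ?_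
    filter_upwards [coeFn_substitute T f] with x hx
    rw [hx, norm_mul, mul_pow, Complex.norm_real, Real.norm_eq_abs, sq_abs,
      Real.sq_sqrt (abs_nonneg _), ENNReal.ofReal_mul (abs_nonneg _)]
  have h2 : ∫⁻ x, ENNReal.ofReal (‖f (T x)‖ ^ 2) ∂μ =
      ∫⁻ x, ENNReal.ofReal (‖f x‖ ^ 2)
        ∂(ENNReal.ofReal |(LinearMap.det (T : X →ₗ[ℝ] X))⁻¹| • μ) := by
    rw [← (measurePreserving_linearEquiv (μ := μ) T).map_eq, lintegral_map']
    · rw [(measurePreserving_linearEquiv (μ := μ) T).map_eq]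
      exact ((Lp.aestronglyMeasurable f).norm.pow 2).aemeasurable.ennreal_ofReal.smul_measure _
    · exact (measurePreserving_linearEquiv (μ := μ) T).measurable.aemeasurable
  rw [h1, lintegral_const_mul' _ _ ENNReal.ofReal_ne_top, h2, lintegral_smul_measure, smul_eq_mul,
    ← mul_assoc, ← ENNReal.ofReal_mul (abs_nonneg _), ← abs_mul, mul_inv_cancel₀ hdet, abs_one,
    ENNReal.ofReal_one, one_mul]

lemma isLinearIsometry_substitute (T : X ≃ₗ[ℝ] X) :
    IsLinearIsometry (substitute (μ := μ) T) := by
  have hq := quasiMeasurePreserving_linearEquiv (μ := μ) T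
  refine ⟨⟨⟨⟨substitute T, fun f g => ?_⟩, fun c f => ?_⟩, norm_substitute T⟩, fun _ => rfl⟩
  · refine Lp.ext ?_
    filter_upwards [coeFn_substitute T (f + g), coeFn_substitute T f, coeFn_substitute T g,
      hq.ae (Lp.coeFn_add f g), Lp.coeFn_add (substitute T f) (substitute T g)] with x h1 h2 h3 h4 h5
    rw [h1, h5, Pi.add_apply, h2, h3, h4, Pi.add_apply]
    ring
  · refine Lp.ext ?_
    filter_upwards [coeFn_substitute T (c • f), coeFn_substitute T f,
      hq.ae (Lp.coeFn_smul c f), Lp.coeFn_smul c (substitute T f)] with x h1 h2 h4 h5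
    simp only [RingHom.id_apply]
    rw [h1, h5, Pi.smul_apply, h2, h4, Pi.smul_apply, smul_eq_mul, smul_eq_mul]
    ring

end Substitution

/-! ### The computation is an isometry of the resource space -/

lemma coeFn_tensor {m M : ℕ} (ψ : Wave m) (φ : Wave M) :
    tensor ψ φ =ᵐ[volume] fun z => ψ z.1 * φ z.2 :=
  (memLp_tensor ψ φ).coeFn_toLp

lemma norm_tensor {m M : ℕ} (ψ : Wave m) (φ : Wave M) : ‖tensor ψ φ‖ = ‖ψ‖ * ‖φ‖ := by
  rw [← sq_eq_sq₀ (norm_nonneg _) (by positivity), ← ENNReal.ofReal_eq_ofReal_iff (by positivity)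
    (by positivity), ← lintegral_norm_sq_eq, mul_pow, ENNReal.ofReal_mul (by positivity),
    ← lintegral_norm_sq_eq, ← lintegral_norm_sq_eq]
  have h1 : ∫⁻ z, ENNReal.ofReal (‖tensor ψ φ z‖ ^ 2) =
      ∫⁻ z : Config m × Config M, ENNReal.ofReal (‖ψ z.1‖ ^ 2) * ENNReal.ofReal (‖φ z.2‖ ^ 2) := by
    refine lintegral_congr_ae ?_
    filter_upwards [coeFn_tensor ψ φ] with z hz
    rw [hz, norm_mul, mul_pow, ENNReal.ofReal_mul (by positivity)]
  rw [h1, Measure.volume_eq_prod]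
  exact lintegral_prod_mul ((Lp.aestronglyMeasurable ψ).norm.pow 2).aemeasurable.ennreal_ofReal
    ((Lp.aestronglyMeasurable φ).norm.pow 2).aemeasurable.ennreal_ofReal

lemma tensor_add {m M : ℕ} (ψ : Wave m) (φ φ' : Wave M) :
    tensor ψ (φ + φ') = tensor ψ φ + tensor ψ φ' := by
  refine Lp.ext ?_
  filter_upwards [coeFn_tensor ψ (φ + φ'), coeFn_tensor ψ φ, coeFn_tensor ψ φ',
    Measure.quasiMeasurePreserving_snd.ae (Lp.coeFn_add φ φ'),
    Lp.coeFn_add (tensor ψ φ) (tensor ψ φ')] with x h1 h2 h3 h4 h5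
  rw [h1, h5, Pi.add_apply, h2, h3, h4, Pi.add_apply]
  ring

lemma tensor_smul {m M : ℕ} (ψ : Wave m) (c : ℂ) (φ : Wave M) :
    tensor ψ (c • φ) = c • tensor ψ φ := by
  refine Lp.ext ?_
  filter_upwards [coeFn_tensor ψ (c • φ), coeFn_tensor ψ φ,
    Measure.quasiMeasurePreserving_snd.ae (Lp.coeFn_smul c φ),
    Lp.coeFn_smul c (tensor ψ φ)] with x h1 h2 h4 h5
  rw [h1, h5, Pi.smul_apply, h2, h4, Pi.smul_apply, smul_eq_mul, smul_eq_mul]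
  ring

lemma isLinearIsometry_teleport {m M : ℕ} (γ : ℝ) (r : ℝˣ) (k : Fin m) (j : Fin M) :
    IsLinearIsometry (teleport γ r k j) :=
  (isLinearIsometry_substitute _).comp <| (isLinearIsometry_phase _).comp <|
    (isLinearIsometry_substitute _).comp (isLinearIsometry_substitute _)

namespace Circuit

variable {m M : ℕ} (A : Circuit m M)

/-- Each teleportation is a composition of phases and linear substitutions, and tensoring with the
normalized input preserves norms. Linearity is what traces an error in the output back to the
component of the resource orthogonal to the ideal vector. -/
lemma exists_linearIsometry_run (γ : ℝ) :
    ∃ L : Wave M →ₗᵢ[ℂ] Joint m M, ∀ φ, L φ = A.run γ φ := by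
  have hfold : ∀ l : List (Fin M), IsLinearIsometry fun Φ : Joint m M => l.foldl
      (fun Φ j => teleport γ (A.r j) (A.mode j) j (A.gate j.castSucc Φ)) Φ := by
    intro l
    induction l with
    | nil => exact ⟨LinearIsometry.id, fun _ => rfl⟩
    | cons j l ih =>
      exact ih.comp <| (isLinearIsometry_teleport γ (A.r j) (A.mode j) j).comp
        ⟨(A.gate j.castSucc).toLinearIsometry, fun _ => rfl⟩
  obtain ⟨L, hL⟩ := IsLinearIsometry.comp
    ⟨(A.gate (Fin.last M)).toLinearIsometry, fun _ => rfl⟩ (hfold (List.finRange M))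
  let T : Wave M →ₗ[ℂ] Joint m M :=
    { toFun := tensor A.input
      map_add' := tensor_add _
      map_smul' := fun c φ => tensor_smul _ c φ }
  refine ⟨L.comp ⟨T, fun φ => ?_⟩, fun φ => hL _⟩
  change ‖tensor A.input φ‖ = ‖φ‖
  rw [norm_tensor, A.norm_input, one_mul]

end Circuit

/-! ### The probability of an incorrect output -/

/-- Subtracting the projection onto `g` kills `c • g` and contracts `h`. For `g = 0` the quotient is
`0` by convention and nothing is subtracted. -/
lemma norm_sub_inner_div_smul_le {H : Type*} [NormedAddCommGroup H] [InnerProductSpace ℂ H]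
    (g h : H) (c : ℂ) :
    ‖(c • g + h) - (⟪g, c • g + h⟫_ℂ / (‖g‖ ^ 2 : ℝ)) • g‖ ≤ ‖h‖ := by
  by_cases hg : g = 0
  · simp [hg]
  have hg' : ((‖g‖ : ℂ)) ≠ 0 := by simpa using hg
  have e : (c • g + h) - (⟪g, c • g + h⟫_ℂ / (‖g‖ ^ 2 : ℝ)) • g =
      h - (⟪g, h⟫_ℂ / (‖g‖ ^ 2 : ℝ)) • g := by
    rw [inner_add_right, inner_smul_right, inner_self_eq_norm_sq_to_K]
    push_cast
    rw [add_div, mul_div_assoc]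
    erw [div_self (pow_ne_zero 2 hg')]
    rw [mul_one, add_smul]
    abel
  rw [e, ← sq_le_sq₀ (norm_nonneg _) (norm_nonneg _), @norm_sub_sq ℂ, norm_smul, norm_div,
    inner_smul_right]
  have h1 : ⟪h, g⟫_ℂ = star ⟪g, h⟫_ℂ := (inner_conj_symm _ _).symm
  have h2 : ⟪g, h⟫_ℂ / ((‖g‖ ^ 2 : ℝ) : ℂ) * ⟪h, g⟫_ℂ = ((‖⟪g, h⟫_ℂ‖ ^ 2 / ‖g‖ ^ 2 : ℝ) : ℂ) := by
    rw [h1, div_mul_eq_mul_div]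
    have := Complex.mul_conj ⟪g, h⟫_ℂ
    rw [Complex.star_def, this, Complex.normSq_eq_norm_sq]
    push_cast; rfl
  rw [h2]
  have hn : 0 < ‖g‖ := norm_pos_iff.2 hg
  have h3 : (‖⟪g, h⟫_ℂ‖ / ‖((‖g‖ ^ 2 : ℝ) : ℂ)‖ * ‖g‖) ^ 2 = ‖⟪g, h⟫_ℂ‖ ^ 2 / ‖g‖ ^ 2 := by
    rw [Complex.norm_real, Real.norm_of_nonneg (by positivity)]
    field_simp
  rw [h3]
  have h4 : 0 ≤ ‖⟪g, h⟫_ℂ‖ ^ 2 / ‖g‖ ^ 2 := by positivity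
  simp only [RCLike.re_to_complex, Complex.ofReal_re]
  linarith

/-- The previous contraction in terms of functions rather than classes, because it is applied to the
slices at fixed measured values. -/
lemma lintegral_sub_projection_le {X : Type*} [MeasurableSpace X] {μ : Measure X}
    {f g h : X → ℂ} (hg : MemLp g 2 μ) (hh : MemLp h 2 μ) (c : ℂ)
    (hf : ∀ᵐ x ∂μ, f x = c * g x + h x) :
    ∫⁻ x, ENNReal.ofReal (‖f x - (∫ x', star (g x') * f x' ∂μ) /
      ((∫ x', ‖g x'‖ ^ 2 ∂μ : ℝ) : ℂ) * g x‖ ^ 2) ∂μ ≤ ∫⁻ x, ENNReal.ofReal (‖h x‖ ^ 2) ∂μ := by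
  set g' := hg.toLp g
  set h' := hh.toLp h
  have eg : g' =ᵐ[μ] g := hg.coeFn_toLp
  have eh : h' =ᵐ[μ] h := hh.coeFn_toLp
  have ef : ∀ᵐ x ∂μ, (c • g' + h') x = f x := by
    filter_upwards [Lp.coeFn_add (c • g') h', Lp.coeFn_smul c g', eg, eh, hf] with x h1 h2 h3 h4 h5
    rw [h1, Pi.add_apply, h2, Pi.smul_apply, h3, h4, h5, smul_eq_mul]
  have e1 : ∫ x', ‖g x'‖ ^ 2 ∂μ = ‖g'‖ ^ 2 := by
    rw [← integral_norm_sq_eq]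
    refine integral_congr_ae ?_
    filter_upwards [eg] with x hx
    rw [hx]
  have e2 : ∫ x', star (g x') * f x' ∂μ = ⟪g', c • g' + h'⟫_ℂ := by
    rw [L2.inner_def]
    refine integral_congr_ae ?_
    filter_upwards [eg, ef] with x hx hx'
    rw [hx, hx', RCLike.inner_apply, mul_comm]
    rfl
  have e3 : ∫⁻ x, ENNReal.ofReal (‖h x‖ ^ 2) ∂μ = ENNReal.ofReal (‖h'‖ ^ 2) := by
    rw [← lintegral_norm_sq_eq]
    refine lintegral_congr_ae ?_
    filter_upwards [eh] with x hx
    rw [hx]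
  rw [e1, e2, e3]
  set a : ℂ := ⟪g', c • g' + h'⟫_ℂ / ((‖g'‖ ^ 2 : ℝ) : ℂ)
  calc ∫⁻ x, ENNReal.ofReal (‖f x - a * g x‖ ^ 2) ∂μ
      = ∫⁻ x, ENNReal.ofReal (‖((c • g' + h') - a • g') x‖ ^ 2) ∂μ := by
        refine lintegral_congr_ae ?_
        filter_upwards [eg, ef, Lp.coeFn_sub (c • g' + h') (a • g'), Lp.coeFn_smul a g']
          with x h1 h2 h3 h4
        rw [h3, Pi.sub_apply, h2, h4, Pi.smul_apply, h1, smul_eq_mul]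
    _ = ENNReal.ofReal (‖(c • g' + h') - a • g'‖ ^ 2) := lintegral_norm_sq_eq _
    _ ≤ ENNReal.ofReal (‖h'‖ ^ 2) := by
        refine ENNReal.ofReal_le_ofReal ?_
        gcongr
        exact norm_sub_inner_div_smul_le g' h' c

lemma ae_memLp_slice {m M : ℕ} (Φ : Joint m M) :
    ∀ᵐ x : Config M, MemLp (fun y : Config m => Φ (y, x)) 2 volume := by
  have h := Lp.memLp Φ
  have hi : Integrable (fun z => ‖Φ z‖ ^ 2)
    ((volume : Measure (Config m)).prod (volume : Measure (Config M))) :=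
    (memLp_two_iff_integrable_sq_norm h.1).1 h
  have hm : AEStronglyMeasurable (fun z => Φ z)
    ((volume : Measure (Config m)).prod (volume : Measure (Config M))) := h.1
  have hm' : AEStronglyMeasurable (fun z : Config M × Config m => Φ (z.2, z.1))
    ((volume : Measure (Config M)).prod volume) := hm.prod_swap
  filter_upwards [hi.prod_left_ae, hm'.prodMk_left] with x h1 h2
  exact (memLp_two_iff_integrable_sq_norm h2).2 h1

lemma lintegral_lintegral_norm_sq {m M : ℕ} (Φ : Joint m M) :
    ∫⁻ x : Config M, ∫⁻ y : Config m, ENNReal.ofReal (‖Φ (y, x)‖ ^ 2) =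
      ENNReal.ofReal (‖Φ‖ ^ 2) := by
  rw [← lintegral_norm_sq_eq]
  refine (lintegral_prod_symm (μ := (volume : Measure (Config m))) (fun z : Config m × Config M => ENNReal.ofReal (‖Φ z‖ ^ 2)) ?_).symm
  exact ((Lp.aestronglyMeasurable Φ).norm.pow 2).aemeasurable.ennreal_ofReal

/-- The right-hand side is `‖h‖²` for the component `h` of `φ` orthogonal to the ideal vector. On
each slice only the image of `h` survives the incorrect projector, and integrating over the slices
restores its norm, since the run is isometric. -/
lemma Circuit.lintegral_incorrectPart_le {m M : ℕ} (A : Circuit m M) (s : ℝ) (hs : 0 < s) (γ : ℝ)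
    (hn : ‖cubic s hs γ M‖ = 1) (φ : Wave M) :
    ∫⁻ x, ∫⁻ y, ENNReal.ofReal (‖A.incorrectPart s hs γ φ x y‖ ^ 2) ≤
      ENNReal.ofReal (‖φ‖ ^ 2 - ‖⟪cubic s hs γ M, φ⟫_ℂ‖ ^ 2) := by
  obtain ⟨L, hL⟩ := A.exists_linearIsometry_run γ
  set Ψ := cubic s hs γ M with hΨ
  set c := ⟪Ψ, φ⟫_ℂ with hc
  set h := φ - c • Ψ with hh
  have hφ : φ = c • Ψ + h := by rw [hh]; abel
  have hnorm : ‖h‖ ^ 2 = ‖φ‖ ^ 2 - ‖c‖ ^ 2 := by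
    have : ⟪c • Ψ, h⟫_ℂ = 0 := by
      rw [hh, inner_sub_right, inner_smul_left, inner_smul_left, inner_smul_right,
        inner_self_eq_norm_sq_to_K, hn, ← hc]
      simp
    have h2 := norm_add_sq_eq_norm_sq_add_norm_sq_of_inner_eq_zero (𝕜 := ℂ) (c • Ψ) h this
    rw [← hφ, norm_smul, hn] at h2
    linarith
  have hrun : A.run γ φ = c • A.run γ Ψ + L h := by
    rw [← hL, ← hL, ← map_smul, ← map_add, ← hφ]
  have hae : ∀ᵐ z : Config m × Config M, A.run γ φ z = c * A.run γ Ψ z + L h z := by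
    filter_upwards [Lp.coeFn_add (c • A.run γ Ψ) (L h), Lp.coeFn_smul c (A.run γ Ψ)] with z h1 h2
    rw [hrun, h1, Pi.add_apply, h2, Pi.smul_apply, smul_eq_mul]
  -- The decomposition holds almost everywhere on the product, hence on almost every slice.
  have hae' : ∀ᵐ x : Config M, ∀ᵐ y : Config m,
      A.run γ φ (y, x) = c * A.run γ Ψ (y, x) + L h (y, x) := by
    refine Measure.ae_ae_of_ae_prod (p := fun z : Config M × Config m =>
      A.run γ φ (z.2, z.1) = c * A.run γ Ψ (z.2, z.1) + L h (z.2, z.1)) ?_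
    exact (Measure.measurePreserving_swap (μ := (volume : Measure (Config M)))
      (ν := (volume : Measure (Config m)))).quasiMeasurePreserving.ae hae
  rw [← hnorm, ← L.norm_map, ← lintegral_lintegral_norm_sq]
  refine lintegral_mono_ae ?_
  filter_upwards [hae', ae_memLp_slice (A.run γ Ψ), ae_memLp_slice (L h)] with x h1 h2 h3
  exact lintegral_sub_projection_le h2 h3 c h1

/-! ### Weak partial derivatives -/

/-- The partial derivative of `g` in direction `k`. -/
def partialDeriv {M : ℕ} (k : Fin M) (g : Config M → ℂ) (x : Config M) : ℂ :=
  fderiv ℝ g x (EuclideanSpace.single k 1)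

section PartialDeriv

variable {M : ℕ} {k : Fin M} {f g : Config M → ℂ}

lemma contDiff_partialDeriv (hg : ContDiff ℝ ∞ g) : ContDiff ℝ ∞ (partialDeriv k g) :=
  (hg.fderiv_right (m := ∞) le_rfl).clm_apply contDiff_const

lemma hasCompactSupport_partialDeriv (hg : HasCompactSupport g) :
    HasCompactSupport (partialDeriv k g) :=
  hg.fderiv_apply ℝ _

lemma partialDeriv_mul {x : Config M} (hf : DifferentiableAt ℝ f x) (hg : DifferentiableAt ℝ g x) :
    partialDeriv k (fun x => f x * g x) x =
      partialDeriv k f x * g x + f x * partialDeriv k g x := by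
  unfold partialDeriv
  rw [fderiv_fun_mul hf hg]
  simp only [add_apply, smul_apply, smul_eq_mul]
  ring

end PartialDeriv

/-- `u` is the weak partial derivative of `f` in direction `k`. -/
structure HasWeakDeriv {M : ℕ} (k : Fin M) (f u : Config M → ℂ) : Prop where
  locallyIntegrable : LocallyIntegrable f
  locallyIntegrable_deriv : LocallyIntegrable u
  integral_eq : ∀ g : Config M → ℂ, ContDiff ℝ ∞ g → HasCompactSupport g →
    ∫ x, partialDeriv k g x * f x = -∫ x, g x * u x

section Integrability

variable {M : ℕ} {f g : Config M → ℂ}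

lemma integrable_mul_of_hasCompactSupport (hg : Continuous g) (hg' : HasCompactSupport g)
    (hf : LocallyIntegrable f) : Integrable fun x => g x * f x :=
  hf.integrable_smul_left_of_hasCompactSupport hg hg'

lemma locallyIntegrable_continuous_mul (hg : Continuous g) (hf : LocallyIntegrable f) :
    LocallyIntegrable fun x => g x * f x := by
  have := hf.locallyIntegrableOn Set.univ
  exact locallyIntegrableOn_univ.1 (this.continuousOn_smul isOpen_univ.isLocallyClosed hg.continuousOn)

lemma locallyIntegrable_wave (φ : Wave M) : LocallyIntegrable φ :=
  (Lp.memLp φ).locallyIntegrable (by norm_num)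

end Integrability

namespace HasWeakDeriv

variable {M : ℕ} {k : Fin M} {f f' u v : Config M → ℂ}

lemma congr (h : HasWeakDeriv k f u) (hf : f =ᵐ[volume] f') (hu : u =ᵐ[volume] v) :
    HasWeakDeriv k f' v where
  locallyIntegrable := h.locallyIntegrable.congr hf
  locallyIntegrable_deriv := h.locallyIntegrable_deriv.congr hu
  integral_eq g hg hg' := by
    have e1 : ∫ x, partialDeriv k g x * f' x = ∫ x, partialDeriv k g x * f x :=
      integral_congr_ae (hf.mono fun x hx => by simp only [hx])
    have e2 : ∫ x, g x * v x = ∫ x, g x * u x :=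
      integral_congr_ae (hu.mono fun x hx => by simp only [hx])
    rw [e1, e2, h.integral_eq g hg hg']

lemma add (h : HasWeakDeriv k f u) (h' : HasWeakDeriv k f' v) :
    HasWeakDeriv k (fun x => f x + f' x) (fun x => u x + v x) where
  locallyIntegrable := h.locallyIntegrable.add h'.locallyIntegrable
  locallyIntegrable_deriv := h.locallyIntegrable_deriv.add h'.locallyIntegrable_deriv
  integral_eq g hg hg' := by
    have hc := (contDiff_partialDeriv (k := k) hg).continuous
    have hs := hasCompactSupport_partialDeriv (k := k) hg'
    simp only [mul_add]
    rw [integral_add (integrable_mul_of_hasCompactSupport hc hs h.locallyIntegrable)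
        (integrable_mul_of_hasCompactSupport hc hs h'.locallyIntegrable),
      integral_add (integrable_mul_of_hasCompactSupport hg.continuous hg' h.locallyIntegrable_deriv)
        (integrable_mul_of_hasCompactSupport hg.continuous hg' h'.locallyIntegrable_deriv),
      h.integral_eq g hg hg', h'.integral_eq g hg hg']
    ring

lemma mul_left {a : Config M → ℂ} (h : HasWeakDeriv k f u) (ha : ContDiff ℝ ∞ a) :
    HasWeakDeriv k (fun x => a x * f x) (fun x => a x * u x + partialDeriv k a x * f x) where
  locallyIntegrable := locallyIntegrable_continuous_mul ha.continuous h.locallyIntegrable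
  locallyIntegrable_deriv :=
    (locallyIntegrable_continuous_mul ha.continuous h.locallyIntegrable_deriv).add
      (locallyIntegrable_continuous_mul (contDiff_partialDeriv ha).continuous h.locallyIntegrable)
  integral_eq g hg hg' := by
    have hga : ContDiff ℝ ∞ fun x => g x * a x := hg.mul ha
    have hga' : HasCompactSupport fun x => g x * a x := hg'.mul_right
    have hd := hg.differentiable (by simp)
    have hda := ha.differentiable (by simp)
    have hpa := (contDiff_partialDeriv (k := k) ha).continuous
    have e1 : ∀ x, partialDeriv k g x * (a x * f x) =
        partialDeriv k (fun x => g x * a x) x * f x - g x * (partialDeriv k a x * f x) := fun x => by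
      rw [partialDeriv_mul (hd x) (hda x)]
      ring
    have e2 : ∀ x, g x * (a x * u x + partialDeriv k a x * f x) =
        g x * a x * u x + g x * (partialDeriv k a x * f x) := fun x => by ring
    have i3 : Integrable fun x => g x * (partialDeriv k a x * f x) :=
      integrable_mul_of_hasCompactSupport hg.continuous hg'
        (locallyIntegrable_continuous_mul hpa h.locallyIntegrable)
    simp only [e1, e2]
    rw [integral_sub (integrable_mul_of_hasCompactSupport (contDiff_partialDeriv hga).continuous
        (hasCompactSupport_partialDeriv hga') h.locallyIntegrable) i3,
      integral_add (integrable_mul_of_hasCompactSupport hga.continuous hga'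
        h.locallyIntegrable_deriv) i3, h.integral_eq _ hga hga']
    ring

/-- Used to identify the derivatives of a chirped wave obtained by Fourier transform with those
given by the product rule. -/
lemma unique (h : HasWeakDeriv k f u) (h' : HasWeakDeriv k f v) : u =ᵐ[volume] v := by
  refine ae_eq_of_integral_contDiff_smul_eq h.locallyIntegrable_deriv h'.locallyIntegrable_deriv
    fun g hg hg' => ?_
  have hgc : ContDiff ℝ ∞ fun x => (g x : ℂ) := Complex.ofRealCLM.contDiff.comp hg
  have hgc' : HasCompactSupport fun x => (g x : ℂ) := hg'.comp_left Complex.ofReal_zero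
  simp only [Complex.real_smul]
  exact neg_injective ((h.integral_eq _ hgc hgc').symm.trans (h'.integral_eq _ hgc hgc'))

/-- The Fourier transform turns weak derivatives into multiplications. -/
lemma of_fourier {φ ψ : Wave M}
    (h : (𝓕 ψ : Wave M) =ᵐ[volume] fun ξ => 2 * Real.pi * Complex.I * ξ k * (𝓕 φ : Wave M) ξ) :
    HasWeakDeriv k φ ψ where
  locallyIntegrable := locallyIntegrable_wave φ
  locallyIntegrable_deriv := locallyIntegrable_wave ψ
  integral_eq g hg hg' := by
    -- Conjugating the test function turns both integrals into inner products, to which Parseval's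
    -- identity applies.
    have hgc : ContDiff ℝ ∞ fun x => star (g x) :=
      (Complex.conjCLE : ℂ ≃L[ℝ] ℂ).contDiff.comp hg
    have hgc' : HasCompactSupport fun x => star (g x) := hg'.comp_left (star_zero ℂ)
    set G := hgc'.toSchwartzMap hgc with hG
    set D := LineDeriv.lineDerivOp (EuclideanSpace.single k (1 : ℝ)) G with hD
    have eG : ∀ x, star (G x) = g x := fun x => star_star _
    have eD : ∀ x, star (D x) = partialDeriv k g x := fun x => by
      rw [hD, SchwartzMap.lineDerivOp_apply_eq_fderiv]
      have : HasFDerivAt (fun x => star (g x))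
          ((Complex.conjCLE : ℂ →L[ℝ] ℂ).comp (fderiv ℝ g x)) x :=
        (Complex.conjCLE : ℂ →L[ℝ] ℂ).hasFDerivAt.comp x (hg.differentiable (by simp) x).hasFDerivAt
      have e : fderiv ℝ G x = (Complex.conjCLE : ℂ →L[ℝ] ℂ).comp (fderiv ℝ g x) := this.fderiv
      rw [e]
      simp [partialDeriv]
    have i1 : ∫ x, partialDeriv k g x * φ x = ⟪D.toLp 2, φ⟫_ℂ := by
      rw [L2.inner_def]
      refine integral_congr_ae ?_
      filter_upwards [D.coeFn_toLp 2 volume] with x hx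
      rw [hx, RCLike.inner_apply, mul_comm, ← eD]
      rfl
    have i2 : ∫ x, g x * ψ x = ⟪G.toLp 2, ψ⟫_ℂ := by
      rw [L2.inner_def]
      refine integral_congr_ae ?_
      filter_upwards [G.coeFn_toLp 2 volume] with x hx
      rw [hx, RCLike.inner_apply, mul_comm, ← eG]
      rfl
    rw [i1, i2, ← Lp.inner_fourier_eq, ← Lp.inner_fourier_eq (G.toLp 2 volume) ψ,
      SchwartzMap.toLp_fourier_eq, SchwartzMap.toLp_fourier_eq, L2.inner_def, L2.inner_def,
      ← integral_neg]
    refine integral_congr_ae ?_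
    filter_upwards [(𝓕 D).coeFn_toLp 2 volume, (𝓕 G).coeFn_toLp 2 volume, h] with ξ h1 h2 h3
    have ht : (inner ℝ · (EuclideanSpace.single k (1 : ℝ)) : Config M → ℝ).HasTemperateGrowth :=
      ((innerSL ℝ).flip _).hasTemperateGrowth
    have hF : (𝓕 D) ξ = 2 * Real.pi * Complex.I * ξ k * (𝓕 G) ξ := by
      rw [hD, SchwartzMap.fourier_lineDerivOp_eq, smul_apply,
        SchwartzMap.smulLeftCLM_apply_apply ht]
      simp [EuclideanSpace.inner_single_right, mul_assoc]
    rw [h1, h2, h3, hF, RCLike.inner_apply, RCLike.inner_apply]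
    simp only [map_mul, Complex.conj_I, Complex.conj_ofReal, map_ofNat]
    ring

end HasWeakDeriv

/-! ### Integration by parts against square-integrable functions -/

/-- A smooth cutoff function. -/
def cutoff (M : ℕ) (x : Config M) : ℂ :=
  ((⟨1, 2, one_pos, one_lt_two⟩ : ContDiffBump (0 : Config M)) x : ℝ)

section Cutoff

variable {M : ℕ}

lemma contDiff_cutoff : ContDiff ℝ ∞ (cutoff M) :=
  Complex.ofRealCLM.contDiff.comp (ContDiffBump.contDiff _)

lemma hasCompactSupport_cutoff : HasCompactSupport (cutoff M) :=
  (ContDiffBump.hasCompactSupport _).comp_left Complex.ofReal_zero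

lemma norm_cutoff_le (x : Config M) : ‖cutoff M x‖ ≤ 1 := by
  rw [cutoff, Complex.norm_real, Real.norm_of_nonneg (ContDiffBump.nonneg _)]
  exact ContDiffBump.le_one _

lemma cutoff_eq_one {x : Config M} (hx : ‖x‖ ≤ 1) : cutoff M x = 1 := by
  rw [cutoff, ContDiffBump.one_of_mem_closedBall, Complex.ofReal_one]
  simpa using hx

lemma contDiff_cutoff_smul (c : ℝ) : ContDiff ℝ ∞ fun x : Config M => cutoff M (c • x) :=
  contDiff_cutoff.comp (contDiff_const_smul c)

lemma partialDeriv_cutoff_smul (k : Fin M) (c : ℝ) (x : Config M) :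
    partialDeriv k (fun x => cutoff M (c • x)) x = c * partialDeriv k (cutoff M) (c • x) := by
  simp [partialDeriv, fderiv_comp_smul]

lemma exists_norm_partialDeriv_cutoff_le (k : Fin M) :
    ∃ C, ∀ x : Config M, ‖partialDeriv k (cutoff M) x‖ ≤ C :=
  (contDiff_partialDeriv contDiff_cutoff).continuous.bounded_above_of_compact_support
    (hasCompactSupport_partialDeriv hasCompactSupport_cutoff)

lemma tendsto_cutoff_smul (x : Config M) :
    Filter.Tendsto (fun n : ℕ => cutoff M (((n : ℝ) + 1)⁻¹ • x)) Filter.atTop (nhds 1) := by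
  refine tendsto_const_nhds.congr' ?_
  obtain ⟨N, hN⟩ := exists_nat_ge ‖x‖
  filter_upwards [Filter.eventually_ge_atTop N] with n hn
  refine (cutoff_eq_one ?_).symm
  have h1 : ‖x‖ ≤ (n : ℝ) + 1 := by
    have : (N : ℝ) ≤ n := by exact_mod_cast hn
    linarith
  rw [norm_smul, norm_inv, Real.norm_of_nonneg (by positivity)]
  rw [inv_mul_le_iff₀ (by positivity)]
  linarith

end Cutoff

/-- Extends the class of test functions from compact support to the displaced cubic phase states.
Multiply `g` by the cutoff at scale `n + 1`: differentiating the cutoff produces a factor `1/(n +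
1)`, so that term disappears in the limit, and the others converge by dominated convergence. -/
lemma HasWeakDeriv.integral_eq_of_memLp {M : ℕ} {k : Fin M} {f u g : Config M → ℂ}
    (h : HasWeakDeriv k f u) (hf : MemLp f 2) (hu : MemLp u 2) (hg : ContDiff ℝ ∞ g)
    (hg2 : MemLp g 2) (hg2' : MemLp (partialDeriv k g) 2) :
    ∫ x, partialDeriv k g x * f x = -∫ x, g x * u x := by
  obtain ⟨C, hC⟩ := exists_norm_partialDeriv_cutoff_le (M := M) k
  set c : ℕ → ℝ := fun n => ((n : ℝ) + 1)⁻¹ with hc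
  have hc1 : ∀ n, ‖(c n : ℂ)‖ ≤ 1 := fun n => by
    rw [Complex.norm_real, Real.norm_of_nonneg (by positivity)]
    exact inv_le_one_of_one_le₀ (by linarith [n.cast_nonneg (α := ℝ)])
  have hc0 : Filter.Tendsto (fun n => (c n : ℂ)) Filter.atTop (nhds 0) := by
    have := tendsto_one_div_add_atTop_nhds_zero_nat (𝕜 := ℝ)
    simp only [one_div] at this
    have h0 := (Complex.continuous_ofReal.tendsto (0 : ℝ)).comp this
    rwa [Complex.ofReal_zero] at h0
  have i1 : Integrable fun x => partialDeriv k g x * f x := hg2'.integrable_mul hf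
  have i2 : Integrable fun x => g x * f x := hg2.integrable_mul hf
  have i3 : Integrable fun x => g x * u x := hg2.integrable_mul hu
  have cθ : ∀ n, Continuous fun x => cutoff M (c n • x) := fun n =>
    (contDiff_cutoff_smul _).continuous
  have cθ' : ∀ n, Continuous fun x => partialDeriv k (cutoff M) (c n • x) := fun n =>
    (contDiff_partialDeriv contDiff_cutoff).continuous.comp (continuous_const_smul _)
  have key : ∀ n, ∫ x, cutoff M (c n • x) * (partialDeriv k g x * f x) =
      -(∫ x, cutoff M (c n • x) * (g x * u x)) -
        c n * ∫ x, partialDeriv k (cutoff M) (c n • x) * (g x * f x) := fun n => by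
    have h1 := h.integral_eq (fun x => cutoff M (c n • x) * g x)
      ((contDiff_cutoff_smul _).mul hg)
      ((hasCompactSupport_cutoff.comp_smul (by positivity)).mul_right)
    have e : ∀ x, partialDeriv k (fun x => cutoff M (c n • x) * g x) x * f x =
        cutoff M (c n • x) * (partialDeriv k g x * f x) +
          c n * (partialDeriv k (cutoff M) (c n • x) * (g x * f x)) := fun x => by
      rw [partialDeriv_mul ((contDiff_cutoff_smul _).differentiable (by simp) x)
        (hg.differentiable (by simp) x), partialDeriv_cutoff_smul]
      ring
    simp only [e] at h1
    rw [integral_add (i1.bdd_mul (c := 1) (cθ n).aestronglyMeasurable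
        (Filter.Eventually.of_forall fun x => norm_cutoff_le _))
      ((i2.bdd_mul (c := C) (cθ' n).aestronglyMeasurable
        (Filter.Eventually.of_forall fun x => hC _)).const_mul _), integral_const_mul] at h1
    simp only [mul_assoc] at h1 ⊢
    linear_combination h1
  have t1 : Filter.Tendsto (fun n => ∫ x, cutoff M (c n • x) * (partialDeriv k g x * f x))
      Filter.atTop (nhds (∫ x, partialDeriv k g x * f x)) := by
    refine tendsto_integral_of_dominated_convergence (fun x => ‖partialDeriv k g x * f x‖)
      (fun n => (cθ n).aestronglyMeasurable.mul i1.1) i1.norm (fun n => ?_) ?_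
    · refine Filter.Eventually.of_forall fun x => ?_
      rw [norm_mul]
      exact mul_le_of_le_one_left (norm_nonneg _) (norm_cutoff_le _)
    · refine Filter.Eventually.of_forall fun x => ?_
      simpa using (tendsto_cutoff_smul x).mul_const (partialDeriv k g x * f x)
  have t2 : Filter.Tendsto (fun n => ∫ x, cutoff M (c n • x) * (g x * u x))
      Filter.atTop (nhds (∫ x, g x * u x)) := by
    refine tendsto_integral_of_dominated_convergence (fun x => ‖g x * u x‖)
      (fun n => (cθ n).aestronglyMeasurable.mul i3.1) i3.norm (fun n => ?_) ?_
    · refine Filter.Eventually.of_forall fun x => ?_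
      rw [norm_mul]
      exact mul_le_of_le_one_left (norm_nonneg _) (norm_cutoff_le _)
    · refine Filter.Eventually.of_forall fun x => ?_
      simpa using (tendsto_cutoff_smul x).mul_const (g x * u x)
  have t3 : Filter.Tendsto
      (fun n => c n * ∫ x, partialDeriv k (cutoff M) (c n • x) * (g x * f x))
      Filter.atTop (nhds 0) := by
    refine hc0.zero_mul_isBoundedUnder_le (Filter.isBoundedUnder_of
      ⟨∫ x, C * ‖g x * f x‖, fun n => ?_⟩)
    refine norm_integral_le_of_norm_le (i2.norm.const_mul C) (Filter.Eventually.of_forall fun x => ?_)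
    rw [norm_mul]
    exact mul_le_mul_of_nonneg_right (hC _) (norm_nonneg _)
  have t4 := t2.neg.sub t3
  rw [sub_zero] at t4
  exact tendsto_nhds_unique t1 (t4.congr fun n => (key n).symm)

/-! ### Modulated cubic phase states -/

/-- The coordinate functional of mode `k`. -/
def coord {M : ℕ} (k : Fin M) : Config M →L[ℝ] ℝ := EuclideanSpace.proj k

@[simp]
lemma coord_apply {M : ℕ} (k : Fin M) (x : Config M) : coord k x = x k := rfl

lemma partialDeriv_comp_coord {M : ℕ} (k l : Fin M) {q : ℝ → ℂ} {q' : ℂ} {x : Config M}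
    (hq : HasDerivAt q q' (x l)) :
    partialDeriv k (fun x => q (x l)) x = if l = k then q' else 0 := by
  have h : HasFDerivAt (fun x : Config M => q (x l)) _ x :=
    HasFDerivAt.comp (g := q) (f := fun x : Config M => x l) x hq.hasFDerivAt (coord l).hasFDerivAt
  rw [partialDeriv, h.fderiv]
  by_cases hl : l = k <;> simp [hl]

lemma partialDeriv_sum {M : ℕ} {ι : Type*} (k : Fin M) (S : Finset ι) {q : ι → Config M → ℂ}
    {x : Config M} (hq : ∀ i ∈ S, DifferentiableAt ℝ (q i) x) :
    partialDeriv k (fun x => ∑ i ∈ S, q i x) x = ∑ i ∈ S, partialDeriv k (q i) x := by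
  unfold partialDeriv
  rw [fderiv_fun_sum hq, sum_apply]

lemma partialDeriv_const_mul {M : ℕ} (k : Fin M) (c : ℂ) {f : Config M → ℂ} {x : Config M}
    (hf : DifferentiableAt ℝ f x) :
    partialDeriv k (fun x => c * f x) x = c * partialDeriv k f x := by
  unfold partialDeriv
  rw [fderiv_const_mul hf]
  rfl

lemma partialDeriv_cexp {M : ℕ} (k : Fin M) {P : Config M → ℂ} {x : Config M}
    (hP : DifferentiableAt ℝ P x) :
    partialDeriv k (fun x => Complex.exp (P x)) x = Complex.exp (P x) * partialDeriv k P x := by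
  unfold partialDeriv
  rw [hP.hasFDerivAt.cexp.fderiv]
  rfl

/-- The cubic phase state displaced in momentum by `b`. -/
def modulated (s γ : ℝ) {M : ℕ} (b x : Config M) : ℂ :=
  Complex.exp (Complex.I * ∑ k, (b k : ℂ) * x k) * cubicFun s γ M x

/-- The exponent of `modulated`. -/
def exponent (s γ : ℝ) {M : ℕ} (b x : Config M) : ℂ :=
  ∑ k, (Complex.I * b k * x k + Complex.I * γ * (x k : ℂ) ^ 3 - (x k : ℂ) ^ 2 / (2 * s ^ 2))

section Modulated

variable {s γ : ℝ} {M : ℕ}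

lemma cubicFun_eq (x : Config M) : cubicFun s γ M x =
    (((Real.sqrt s * Real.pi ^ (1 / 4 : ℝ))⁻¹ : ℝ) : ℂ) ^ M * Complex.exp (exponent s γ 0 x) := by
  simp only [cubicFun, exponent, Complex.exp_sum, div_eq_mul_inv, Finset.prod_mul_distrib,
    Finset.prod_const, Finset.card_univ, Fintype.card_fin]
  rw [mul_comm]
  congr 1
  · push_cast; ring
  · rw [← Finset.prod_mul_distrib]
    refine Finset.prod_congr rfl fun k _ => ?_
    rw [← Complex.exp_add]
    congr 1
    simp
    ring

lemma modulated_eq (b x : Config M) : modulated s γ b x =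
    (((Real.sqrt s * Real.pi ^ (1 / 4 : ℝ))⁻¹ : ℝ) : ℂ) ^ M * Complex.exp (exponent s γ b x) := by
  have : exponent s γ b x = Complex.I * ∑ k, (b k : ℂ) * x k + exponent s γ 0 x := by
    simp only [exponent, Finset.mul_sum, ← Finset.sum_add_distrib]
    refine Finset.sum_congr rfl fun k _ => ?_
    simp
    ring
  rw [modulated, cubicFun_eq, this, Complex.exp_add]
  ring

lemma contDiff_exponent (b : Config M) : ContDiff ℝ ∞ (exponent s γ b) := by
  unfold exponent
  have h : ∀ k : Fin M, ContDiff ℝ ∞ fun x : Config M => (x k : ℂ) := fun k =>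
    Complex.ofRealCLM.contDiff.comp (coord k).contDiff
  fun_prop

lemma contDiff_modulated (b : Config M) : ContDiff ℝ ∞ (modulated s γ b) := by
  have h : modulated s γ b = fun x => (((Real.sqrt s * Real.pi ^ (1 / 4 : ℝ))⁻¹ : ℝ) : ℂ) ^ M *
      Complex.exp (exponent s γ b x) := funext (modulated_eq b)
  rw [h]
  exact contDiff_const.mul (contDiff_exponent b).cexp

lemma partialDeriv_exponent (k : Fin M) (b x : Config M) : partialDeriv k (exponent s γ b) x =
    Complex.I * b k + 3 * Complex.I * γ * (x k : ℂ) ^ 2 - (x k : ℂ) / s ^ 2 := by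
  have hd : ∀ l (t : ℝ), HasDerivAt (fun t : ℝ => Complex.I * b l * (t : ℂ) +
      Complex.I * γ * (t : ℂ) ^ 3 - (t : ℂ) ^ 2 / (2 * s ^ 2))
      (Complex.I * b l + 3 * Complex.I * γ * (t : ℂ) ^ 2 - (t : ℂ) / s ^ 2) t := fun l t => by
    have h0 : HasDerivAt (fun t : ℝ => (t : ℂ)) 1 t := Complex.ofRealCLM.hasDerivAt
    have h1 := ((h0.const_mul (Complex.I * b l)).add ((h0.pow 3).const_mul (Complex.I * γ))).sub
      ((h0.pow 2).div_const (2 * (s : ℂ) ^ 2))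
    convert! h1 using 1
    by_cases hs : (s : ℂ) = 0
    · simp [hs]; ring
    · field_simp; ring
  have h := partialDeriv_sum k Finset.univ (x := x) (q := fun l (x : Config M) => Complex.I * b l * x l +
    Complex.I * γ * (x l : ℂ) ^ 3 - (x l : ℂ) ^ 2 / (2 * s ^ 2)) fun l _ =>
      (HasFDerivAt.comp (f := fun x : Config M => x l) x (hd l (x l)).hasFDerivAt
        (coord l).hasFDerivAt).differentiableAt
  have h2 : partialDeriv k (exponent s γ b) x = _ := h
  rw [h2, Finset.sum_congr rfl fun l _ => partialDeriv_comp_coord k l (hd l (x l))]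
  simp

lemma partialDeriv_modulated (k : Fin M) (b x : Config M) : partialDeriv k (modulated s γ b) x =
    (Complex.I * b k + 3 * Complex.I * γ * (x k : ℂ) ^ 2 - (x k : ℂ) / s ^ 2) *
      modulated s γ b x := by
  have h : modulated s γ b = fun x => (((Real.sqrt s * Real.pi ^ (1 / 4 : ℝ))⁻¹ : ℝ) : ℂ) ^ M *
      Complex.exp (exponent s γ b x) := funext (modulated_eq b)
  have hd := (contDiff_exponent (s := s) (γ := γ) b).differentiable (by simp) x
  rw [h, partialDeriv_const_mul _ _ hd.cexp, partialDeriv_cexp _ hd, partialDeriv_exponent]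
  ring

lemma norm_modulated (b x : Config M) : ‖modulated s γ b x‖ =
    ((Real.sqrt s * Real.pi ^ (1 / 4 : ℝ))⁻¹) ^ M * Real.exp (-(‖x‖ ^ 2 / (2 * s ^ 2))) := by
  have h0 : 0 ≤ (Real.sqrt s * Real.pi ^ (1 / 4 : ℝ))⁻¹ := by positivity
  rw [modulated_eq, norm_mul, norm_pow, Complex.norm_real, Real.norm_of_nonneg h0,
    Complex.norm_exp]
  congr 2
  rw [exponent, Complex.re_sum, EuclideanSpace.norm_sq_eq, Finset.sum_div, ← Finset.sum_neg_distrib]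
  refine Finset.sum_congr rfl fun k _ => ?_
  have e : Complex.I * b k * x k + Complex.I * γ * (x k : ℂ) ^ 3 - (x k : ℂ) ^ 2 / (2 * s ^ 2) =
      ((-(x k ^ 2 / (2 * s ^ 2)) : ℝ) : ℂ) + ((b k * x k + γ * x k ^ 3 : ℝ) : ℂ) * Complex.I := by
    push_cast; ring
  rw [e, Complex.add_re, Complex.ofReal_re, Complex.re_ofReal_mul, Complex.I_re, mul_zero, add_zero,
    Real.norm_eq_abs, sq_abs]

lemma norm_cubic (hs : 0 < s) : ‖cubic s hs γ M‖ = 1 := by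
  have hsq : ‖cubic s hs γ M‖ ^ 2 = 1 := by
    rw [← integral_norm_sq_eq]
    have e : ∫ x, ‖cubic s hs γ M x‖ ^ 2 = ∫ x : Config M,
        (((Real.sqrt s * Real.pi ^ (1 / 4 : ℝ))⁻¹) ^ M) ^ 2 *
          Real.exp (-(1 / s ^ 2) * ‖x‖ ^ 2) := by
      refine integral_congr_ae ?_
      filter_upwards [(memLp_cubicFun hs γ M).coeFn_toLp] with x hx
      have h0 : cubicFun s γ M x = modulated s γ 0 x := by simp [modulated]
      rw [cubic, hx, h0, norm_modulated, mul_pow, ← Real.exp_nat_mul]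
      congr 2
      push_cast
      field_simp
    rw [e, integral_const_mul, GaussianFourier.integral_rexp_neg_mul_sq_norm (by positivity)]
    have h1 : Real.pi / (1 / s ^ 2) = (Real.sqrt Real.pi * s) ^ 2 := by
      rw [mul_pow, Real.sq_sqrt Real.pi_pos.le]
      field_simp
    have h2 : ((Real.sqrt s * Real.pi ^ (1 / 4 : ℝ))⁻¹) ^ 2 = (Real.sqrt Real.pi * s)⁻¹ := by
      rw [inv_pow, mul_pow, Real.sq_sqrt hs.le, ← Real.rpow_natCast, ← Real.rpow_mul Real.pi_pos.le,
        Real.sqrt_eq_rpow, mul_comm]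
      norm_num
    have h3 : 0 < Real.sqrt Real.pi * s := by positivity
    rw [← pow_mul, mul_comm M 2, pow_mul, h2, h1, finrank_euclideanSpace, Fintype.card_fin,
      ← Real.rpow_natCast (Real.sqrt Real.pi * s), ← Real.rpow_mul h3.le]
    have h4 : (((2 : ℕ) : ℝ) * ((M : ℝ) / 2)) = (M : ℝ) := by push_cast; ring
    rw [h4, Real.rpow_natCast, ← mul_pow, inv_mul_cancel₀ h3.ne', one_pow]
  exact (pow_eq_one_iff_of_nonneg (norm_nonneg _) two_ne_zero).1 hsq

lemma memLp_rexp_neg_norm_sq {c : ℝ} (hc : 0 < c) :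
    MemLp (fun x : Config M => Real.exp (-(c * ‖x‖ ^ 2))) 2 := by
  rw [memLp_two_iff_integrable_sq (by fun_prop)]
  have hb : 0 < ((2 * c : ℝ) : ℂ).re := by
    rw [Complex.ofReal_re]; positivity
  refine (GaussianFourier.integrable_cexp_neg_mul_sq_norm_add (V := Config M) hb 0 0).norm.congr
    (Filter.Eventually.of_forall fun x => ?_)
  have h : -((2 * c : ℝ) : ℂ) * (‖x‖ : ℂ) ^ 2 + 0 * ((⟪(0 : Config M), x⟫_ℝ : ℝ) : ℂ) =
      ((-(2 * c) * ‖x‖ ^ 2 : ℝ) : ℂ) := by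
    push_cast; ring
  simp only
  rw [h, Complex.norm_exp, Complex.ofReal_re, ← Real.exp_nat_mul]
  congr 1
  push_cast
  ring

/-- Polynomial growth is dominated by `exp ‖x‖`, which costs only part of the Gaussian decay. -/
lemma memLp_mul_modulated (hs : 0 < s) (b : Config M) {P : Config M → ℂ}
    (hP : P.HasTemperateGrowth) : MemLp (fun x => P x * modulated s γ b x) 2 := by
  obtain ⟨n, C, hC⟩ := hP.2 0
  simp only [norm_iteratedFDeriv_zero] at hC
  have hC0 : 0 ≤ C := by simpa using (norm_nonneg _).trans (hC 0)
  set K := ((Real.sqrt s * Real.pi ^ (1 / 4 : ℝ))⁻¹) ^ M with hK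
  have hK0 : 0 ≤ K := by positivity
  refine (memLp_rexp_neg_norm_sq (M := M) (c := 1 / (4 * s ^ 2)) (by positivity)).of_le_mul
    (c := C * (n.factorial * Real.exp (1 + s ^ 2)) * K)
    (hP.1.continuous.mul (contDiff_modulated b).continuous).aestronglyMeasurable
    (Filter.Eventually.of_forall fun x => ?_)
  rw [norm_mul, norm_modulated, Real.norm_of_nonneg (Real.exp_pos _).le]
  have h1 : (1 + ‖x‖) ^ n ≤ n.factorial * Real.exp (1 + ‖x‖) := by
    have := Real.pow_div_factorial_le_exp (1 + ‖x‖) (by positivity) n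
    rwa [div_le_iff₀' (by positivity)] at this
  have h2 : Real.exp (1 + ‖x‖) * Real.exp (-(‖x‖ ^ 2 / (2 * s ^ 2))) ≤
      Real.exp (1 + s ^ 2) * Real.exp (-(1 / (4 * s ^ 2) * ‖x‖ ^ 2)) := by
    rw [← Real.exp_add, ← Real.exp_add]
    refine Real.exp_le_exp.2 ?_
    -- This square says `‖x‖ ≤ ‖x‖²/(4s²) + s²`: half of the Gaussian exponent absorbs the
    -- exponential.
    have h3 : 0 ≤ (‖x‖ / (2 * s) - s) ^ 2 := sq_nonneg _
    have h4 : (‖x‖ / (2 * s) - s) ^ 2 = ‖x‖ ^ 2 / (4 * s ^ 2) - ‖x‖ + s ^ 2 := by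
      field_simp; ring
    have h5 : ‖x‖ ^ 2 / (2 * s ^ 2) = 2 * (‖x‖ ^ 2 / (4 * s ^ 2)) := by field_simp; ring
    have h6 : 1 / (4 * s ^ 2) * ‖x‖ ^ 2 = ‖x‖ ^ 2 / (4 * s ^ 2) := by ring
    rw [h5, h6]
    linarith
  calc ‖P x‖ * (K * Real.exp (-(‖x‖ ^ 2 / (2 * s ^ 2))))
      ≤ (C * (n.factorial * Real.exp (1 + ‖x‖))) * (K * Real.exp (-(‖x‖ ^ 2 / (2 * s ^ 2)))) := by
        gcongr
        exact (hC x).trans (mul_le_mul_of_nonneg_left h1 hC0)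
    _ = C * n.factorial * K * (Real.exp (1 + ‖x‖) * Real.exp (-(‖x‖ ^ 2 / (2 * s ^ 2)))) := by ring
    _ ≤ C * n.factorial * K *
        (Real.exp (1 + s ^ 2) * Real.exp (-(1 / (4 * s ^ 2) * ‖x‖ ^ 2))) := by gcongr
    _ = _ := by ring

@[fun_prop]
lemma hasTemperateGrowth_coord (k : Fin M) :
    (fun x : Config M => (x k : ℂ)).HasTemperateGrowth :=
  (Complex.ofRealCLM.comp (coord k)).hasTemperateGrowth

lemma memLp_modulated (hs : 0 < s) (b : Config M) : MemLp (modulated s γ b) 2 := by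
  simpa using memLp_mul_modulated (γ := γ) hs b (P := fun _ => 1) (by fun_prop)

end Modulated

lemma HasWeakDeriv.of_contDiff {M : ℕ} {k : Fin M} {f : Config M → ℂ} (hf : ContDiff ℝ ∞ f) :
    HasWeakDeriv k f (partialDeriv k f) where
  locallyIntegrable := hf.continuous.locallyIntegrable
  locallyIntegrable_deriv := (contDiff_partialDeriv hf).continuous.locallyIntegrable
  integral_eq g hg hg' := by
    have hi : ∀ {a b : Config M → ℂ}, Continuous a → Continuous b → HasCompactSupport a →
        Integrable fun x => b x * a x := fun ha hb ha' =>
      (hb.mul ha).integrable_of_hasCompactSupport ha'.mul_left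
    have := integral_mul_fderiv_eq_neg_fderiv_mul_of_integrable (μ := (volume : Measure (Config M)))
      (f := f) (g := g) (v := EuclideanSpace.single k 1)
      (hi hg.continuous (contDiff_partialDeriv (k := k) hf).continuous hg')
      (hi (contDiff_partialDeriv (k := k) hg).continuous hf.continuous
        (hasCompactSupport_partialDeriv hg')) (hi hg.continuous hf.continuous hg')
      (fun x _ => hf.differentiable (by simp) x) (fun x _ => hg.differentiable (by simp) x)
    simp only [partialDeriv]
    simpa only [mul_comm] using this

/-! ### An abstract duality argument -/

section Abstract

variable {ι H K L : Type*} [NormedAddCommGroup H] [InnerProductSpace ℂ H]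
  [NormedAddCommGroup K] [InnerProductSpace ℂ K] [NormedAddCommGroup L] [InnerProductSpace ℂ L]

/-- The Gram matrix of `n` is that of `d` plus a positive one. This is `n² ≥ n` for the number
operator, read as an inequality of quadratic forms on a span. -/
lemma norm_linearCombination_le_of_inner_eq_add {n : ι → H} {d : ι → K} {t : ι → L}
    (h : ∀ i j, ⟪n i, n j⟫_ℂ = ⟪d i, d j⟫_ℂ + ⟪t i, t j⟫_ℂ) (a : ι →₀ ℂ) :
    ‖Finsupp.linearCombination ℂ d a‖ ≤ ‖Finsupp.linearCombination ℂ n a‖ := by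
  have e : ⟪Finsupp.linearCombination ℂ n a, Finsupp.linearCombination ℂ n a⟫_ℂ =
      ⟪Finsupp.linearCombination ℂ d a, Finsupp.linearCombination ℂ d a⟫_ℂ +
        ⟪Finsupp.linearCombination ℂ t a, Finsupp.linearCombination ℂ t a⟫_ℂ := by
    simp only [Finsupp.linearCombination_apply, Finsupp.sum, sum_inner, inner_sum,
      inner_smul_left, inner_smul_right, h, ← Finset.sum_add_distrib]
    refine Finset.sum_congr rfl fun i _ => ?_
    rw [← mul_add, ← Finset.sum_add_distrib]
    congr 1
    exact Finset.sum_congr rfl fun j _ => mul_add _ _ _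
  have e' := congrArg Complex.re e
  rw [Complex.add_re, inner_self_eq_norm_sq_to_K, inner_self_eq_norm_sq_to_K,
    inner_self_eq_norm_sq_to_K] at e'
  norm_cast at e'
  have e2 : ‖Finsupp.linearCombination ℂ n a‖ ^ 2 =
      ‖Finsupp.linearCombination ℂ d a‖ ^ 2 + ‖Finsupp.linearCombination ℂ t a‖ ^ 2 := e'
  rw [← sq_le_sq₀ (norm_nonneg _) (norm_nonneg _), e2]
  exact le_add_of_nonneg_right (sq_nonneg _)

/-- Cauchy–Schwarz against `Y` bounds the functional `⟪·, f⟫` by `‖Y‖` on the span, and by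
continuity on its closure, which contains `f` itself. -/
lemma norm_le_of_mem_closure_span {n : ι → H} {d : ι → K} {f : H} {Y : K}
    (hle : ∀ a : ι →₀ ℂ,
      ‖Finsupp.linearCombination ℂ d a‖ ≤ ‖Finsupp.linearCombination ℂ n a‖)
    (hinner : ∀ i, ⟪n i, f⟫_ℂ = ⟪d i, Y⟫_ℂ)
    (hf : f ∈ (Submodule.span ℂ (Set.range n)).topologicalClosure) : ‖f‖ ≤ ‖Y‖ := by
  have h1 : ∀ v ∈ Submodule.span ℂ (Set.range n), ‖⟪v, f⟫_ℂ‖ ≤ ‖v‖ * ‖Y‖ := by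
    intro v hv
    obtain ⟨a, rfl⟩ := (Finsupp.mem_span_range_iff_exists_finsupp).1 hv
    have e : ⟪a.sum fun i c => c • n i, f⟫_ℂ = ⟪Finsupp.linearCombination ℂ d a, Y⟫_ℂ := by
      simp only [Finsupp.linearCombination_apply, Finsupp.sum, sum_inner, inner_smul_left, hinner]
    rw [e]
    refine (norm_inner_le_norm _ _).trans ?_
    exact mul_le_mul_of_nonneg_right (hle a) (norm_nonneg _)
  have h2 : ∀ v ∈ (Submodule.span ℂ (Set.range n)).topologicalClosure,
      ‖⟪v, f⟫_ℂ‖ ≤ ‖v‖ * ‖Y‖ := by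
    intro v hv
    have hc : IsClosed {v : H | ‖⟪v, f⟫_ℂ‖ ≤ ‖v‖ * ‖Y‖} :=
      isClosed_le (by fun_prop) (by fun_prop)
    exact closure_minimal h1 hc hv
  have h3 := h2 f hf
  rw [inner_self_eq_norm_sq_to_K, norm_pow, RCLike.norm_ofReal, abs_norm, sq] at h3
  by_cases h0 : ‖f‖ = 0
  · rw [h0]; exact norm_nonneg _
  · exact le_of_mul_le_mul_left h3 (lt_of_le_of_ne (norm_nonneg _) (Ne.symm h0))

end Abstract

/-! ### The spectral gap of the transported number operator -/

section SpectralGap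

variable {s γ : ℝ} {M : ℕ}

/-- `modulated` as a vector. -/
def modWave (hs : 0 < s) (γ : ℝ) (b : Config M) : Wave M := (memLp_modulated (γ := γ) hs b).toLp _

/-- The action of the transported number operator on `modWave`. -/
def numFactor (s : ℝ) (b x : Config M) : ℂ :=
  ∑ k, (Complex.I * b k * x k + s ^ 2 / 2 * (b k : ℂ) ^ 2)

lemma hasTemperateGrowth_numFactor (b : Config M) : (numFactor s b).HasTemperateGrowth := by
  unfold numFactor
  refine Function.HasTemperateGrowth.sum fun k _ => ?_
  fun_prop

lemma partialDeriv_numFactor (k : Fin M) (b x : Config M) :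
    partialDeriv k (numFactor s b) x = Complex.I * b k := by
  have hd : ∀ l (t : ℝ), HasDerivAt (fun t : ℝ => Complex.I * b l * (t : ℂ) +
      s ^ 2 / 2 * (b l : ℂ) ^ 2) (Complex.I * b l) t := fun l t => by
    have h0 : HasDerivAt (fun t : ℝ => (t : ℂ)) 1 t := Complex.ofRealCLM.hasDerivAt
    simpa using (h0.const_mul (Complex.I * b l)).add_const (s ^ 2 / 2 * (b l : ℂ) ^ 2)
  have h := partialDeriv_sum k Finset.univ (x := x) (q := fun l (x : Config M) =>
    Complex.I * b l * x l + s ^ 2 / 2 * (b l : ℂ) ^ 2) fun l _ =>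
      (HasFDerivAt.comp (f := fun x : Config M => x l) x (hd l (x l)).hasFDerivAt
        (coord l).hasFDerivAt).differentiableAt
  have h2 : partialDeriv k (numFactor s b) x = _ := h
  rw [h2, Finset.sum_congr rfl fun l _ => partialDeriv_comp_coord k l (hd l (x l))]
  simp

/-- The image of `modWave` under the transported number operator. -/
def numWave (hs : 0 < s) (γ : ℝ) (b : Config M) : Wave M :=
  (memLp_mul_modulated (γ := γ) hs b (hasTemperateGrowth_numFactor (s := s) b)).toLp _

/-- `B k` is the image of `f` under the operator `∂ₖ + xₖ/s² - 3iγxₖ²`, that is, up to a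
factor, under the annihilation operator of the cubic phase state in mode `k`. -/
def HasLowering (s γ : ℝ) (f : Wave M) (B : Fin M → Wave M) : Prop :=
  ∀ k, ∃ u : Wave M, HasWeakDeriv k f u ∧ B k =ᵐ[volume] fun x =>
    u x + ((x k : ℂ) / s ^ 2 - 3 * Complex.I * γ * (x k : ℂ) ^ 2) * f x

/-- Conjugates stay in the same family, so the smoothness and integrability lemmas apply to them as
well. -/
lemma star_modulated (b x : Config M) : star (modulated s γ b x) = modulated s (-γ) (-b) x := by
  rw [modulated_eq, modulated_eq]
  simp only [Complex.star_def, map_mul, map_pow, Complex.conj_ofReal, ← Complex.exp_conj, exponent,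
    map_sum]
  congr 2
  refine Finset.sum_congr rfl fun k _ => ?_
  have h2 : (starRingEnd ℂ) 2 = 2 := Complex.conj_ofReal 2
  simp [h2]

/-- Integration by parts moves the lowering operator to the coherent state, where its adjoint `-∂ₖ +
xₖ/s² + 3iγxₖ²` acts as multiplication by `2xₖ/s² - i bₖ`. -/
lemma HasLowering.integral_star_mul {f : Wave M} {B : Fin M → Wave M} (hs : 0 < s)
    (h : HasLowering s γ f B) (b : Config M) (k : Fin M) :
    ∫ x, star (modulated s γ b x) * B k x =
      ∫ x, star (modulated s γ b x) * ((Complex.I * b k + 2 * (x k : ℂ) / s ^ 2) * f x) := by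
  obtain ⟨u, hu, hB⟩ := h k
  simp only [star_modulated]
  set g : Config M → ℂ := modulated s (-γ) (-b) with hg
  have hI : ∀ {P : Config M → ℂ}, P.HasTemperateGrowth → Integrable fun x => P x * g x * f x :=
    fun hP => MemLp.integrable_mul (memLp_mul_modulated hs _ hP) (Lp.memLp f)
  have hd : ∀ x, partialDeriv k g x =
      (Complex.I * (-b k) - 3 * Complex.I * γ * (x k : ℂ) ^ 2 - (x k : ℂ) * (s ^ 2 : ℂ)⁻¹) * g x :=
    fun x => by
      rw [hg, partialDeriv_modulated]
      simp only [PiLp.neg_apply, Complex.ofReal_neg]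
      ring
  have hg2 : MemLp g 2 := memLp_modulated hs _
  have hg2' : MemLp (partialDeriv k g) 2 := by
    rw [funext hd]
    exact memLp_mul_modulated hs _ (by fun_prop)
  have h1 := hu.integral_eq_of_memLp (Lp.memLp f) (Lp.memLp u) (contDiff_modulated _) hg2 hg2'
  have iu : Integrable fun x => g x * u x := MemLp.integrable_mul hg2 (Lp.memLp u)
  have i1 := hI (P := fun x => (x k : ℂ) * (s ^ 2 : ℂ)⁻¹ - 3 * Complex.I * γ * (x k : ℂ) ^ 2)
    (by fun_prop)
  have i2 := hI (P := fun x => Complex.I * (-b k) - 3 * Complex.I * γ * (x k : ℂ) ^ 2 -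
    (x k : ℂ) * (s ^ 2 : ℂ)⁻¹) (by fun_prop)
  have e1 : ∫ x, g x * B k x = ∫ x, (g x * u x +
      ((x k : ℂ) * (s ^ 2 : ℂ)⁻¹ - 3 * Complex.I * γ * (x k : ℂ) ^ 2) * g x * f x) := by
    refine integral_congr_ae ?_
    filter_upwards [hB] with x hx
    rw [hx]; ring
  have e2 : ∫ x, g x * u x = - ∫ x, (Complex.I * (-b k) - 3 * Complex.I * γ * (x k : ℂ) ^ 2 -
      (x k : ℂ) * (s ^ 2 : ℂ)⁻¹) * g x * f x := by
    simp only [← hd]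
    rw [← neg_eq_iff_eq_neg, ← h1]
  rw [e1, integral_add iu i1, e2, neg_add_eq_sub, ← integral_sub i1 i2]
  refine integral_congr_ae (Filter.Eventually.of_forall fun x => ?_)
  simp only
  ring

lemma coeFn_modWave (hs : 0 < s) (b : Config M) :
    modWave hs γ b =ᵐ[volume] modulated s γ b := (memLp_modulated hs b).coeFn_toLp

lemma coeFn_numWave (hs : 0 < s) (b : Config M) :
    numWave hs γ b =ᵐ[volume] fun x => numFactor s b x * modulated s γ b x :=
  (memLp_mul_modulated hs b (hasTemperateGrowth_numFactor b)).coeFn_toLp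

lemma inner_modWave (hs : 0 < s) (b : Config M) (f : Wave M) :
    ⟪modWave hs γ b, f⟫_ℂ = ∫ x, star (modulated s γ b x) * f x := by
  rw [L2.inner_def]
  refine integral_congr_ae ?_
  filter_upwards [coeFn_modWave (γ := γ) hs b] with x hx
  rw [hx, RCLike.inner_apply, mul_comm]
  rfl

/-- The identity `⟨n g, f⟩ = ∑ₖ ⟨aₖ g, aₖ f⟩` for a coherent state `g`, which is an eigenvector of
each `aₖ`. -/
lemma HasLowering.inner_numWave {f : Wave M} {B : Fin M → Wave M} (hs : 0 < s)
    (h : HasLowering s γ f B) (b : Config M) :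
    ⟪numWave hs γ b, f⟫_ℂ =
      ∑ k, (s : ℂ) ^ 2 / 2 * (-(Complex.I * b k)) * ⟪modWave hs γ b, B k⟫_ℂ := by
  have hI : ∀ {P : Config M → ℂ}, P.HasTemperateGrowth →
      Integrable fun x => P x * modulated s (-γ) (-b) x * f x :=
    fun hP => MemLp.integrable_mul (memLp_mul_modulated hs _ hP) (Lp.memLp f)
  have e1 : ⟪numWave hs γ b, f⟫_ℂ = ∫ x, ∑ k, (s ^ 2 / 2 * (b k : ℂ) ^ 2 - Complex.I * b k * x k) *
      modulated s (-γ) (-b) x * f x := by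
    rw [L2.inner_def]
    refine integral_congr_ae ?_
    filter_upwards [coeFn_numWave (γ := γ) hs b] with x hx
    rw [hx, RCLike.inner_apply, map_mul, ← star_modulated,
      ← Finset.sum_mul, ← Finset.sum_mul, mul_comm]
    congr 2
    rw [numFactor, map_sum]
    refine Finset.sum_congr rfl fun k _ => ?_
    have h2 : (starRingEnd ℂ) 2 = 2 := Complex.conj_ofReal 2
    simp [h2]
    ring
  rw [e1, integral_finsetSum _ fun k _ => hI (by fun_prop)]
  refine Finset.sum_congr rfl fun k _ => ?_
  rw [inner_modWave, h.integral_star_mul hs, ← integral_const_mul]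
  refine integral_congr_ae (Filter.Eventually.of_forall fun x => ?_)
  have hs' : (s : ℂ) ≠ 0 := by exact_mod_cast hs.ne'
  simp only [star_modulated]
  field_simp
  linear_combination ((s : ℂ) ^ 2 * b k ^ 2 * f x * modulated s (-γ) (-b) x) * Complex.I_sq

/-- Displacing the vacuum `Ψ` of the lowering operators in momentum gives a coherent state, with
eigenvalue `i bₖ`. -/
lemma hasLowering_modWave (hs : 0 < s) (b : Config M) :
    HasLowering s γ (modWave hs γ b) fun k => (Complex.I * b k) • modWave hs γ b := by
  intro k
  have hd : MemLp (partialDeriv k (modulated s γ b)) 2 := by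
    rw [funext (partialDeriv_modulated k b)]
    simp only [div_eq_mul_inv]
    exact memLp_mul_modulated hs _ (by fun_prop)
  refine ⟨hd.toLp _, (HasWeakDeriv.of_contDiff (contDiff_modulated b)).congr
    (coeFn_modWave hs b).symm hd.coeFn_toLp.symm, ?_⟩
  filter_upwards [Lp.coeFn_smul (Complex.I * b k) (modWave hs γ b), hd.coeFn_toLp,
    coeFn_modWave (γ := γ) hs b] with x h1 h2 h3
  rw [h1, h2, Pi.smul_apply, h3, partialDeriv_modulated, smul_eq_mul]
  ring

/-- The relation `aₖ n = (n + 1) aₖ` on a coherent state. -/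
lemma hasLowering_numWave (hs : 0 < s) (b : Config M) :
    HasLowering s γ (numWave hs γ b)
      fun k => (Complex.I * b k) • (numWave hs γ b + modWave hs γ b) := by
  intro k
  have hw := (HasWeakDeriv.of_contDiff (k := k) (contDiff_modulated (s := s) (γ := γ) b)).mul_left
    (hasTemperateGrowth_numFactor (s := s) b).1
  have hd : MemLp (fun x => numFactor s b x * partialDeriv k (modulated s γ b) x +
      partialDeriv k (numFactor s b) x * modulated s γ b x) 2 := by
    simp only [partialDeriv_modulated, partialDeriv_numFactor, ← mul_assoc, ← add_mul,
      div_eq_mul_inv]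
    have := hasTemperateGrowth_numFactor (s := s) b
    exact memLp_mul_modulated hs _ (by fun_prop)
  refine ⟨hd.toLp _, hw.congr (coeFn_numWave hs b).symm hd.coeFn_toLp.symm, ?_⟩
  filter_upwards [Lp.coeFn_smul (Complex.I * b k) (numWave hs γ b + modWave hs γ b),
    hd.coeFn_toLp, coeFn_modWave (γ := γ) hs b, coeFn_numWave (γ := γ) hs b,
    Lp.coeFn_add (numWave hs γ b) (modWave hs γ b)] with x h1 h2 h3 h4 h5
  rw [h1, h2, Pi.smul_apply, h5, Pi.add_apply, h3, h4, partialDeriv_modulated,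
    partialDeriv_numFactor, smul_eq_mul]
  ring

/-- The vectors of lowered states, in the sum of the copies of the Hilbert space. -/
def lowWave (hs : 0 < s) (γ : ℝ) (b : Config M) : PiLp 2 fun _ : Fin M => Wave M :=
  WithLp.toLp 2 fun k => ((s / Real.sqrt 2 : ℝ) * (Complex.I * b k)) • modWave hs γ b

/-- The vectors of twice lowered states. -/
def lowLowWave (hs : 0 < s) (γ : ℝ) (b : Config M) : PiLp 2 fun _ : Fin M × Fin M => Wave M :=
  WithLp.toLp 2 fun k => ((s ^ 2 / 2 : ℝ) * (b k.1 * b k.2 : ℝ) : ℂ) • modWave hs γ b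

lemma sq_div_sqrt_two : ((s / Real.sqrt 2 : ℝ) : ℂ) * (s / Real.sqrt 2 : ℝ) = (s : ℂ) ^ 2 / 2 := by
  rw [← Complex.ofReal_mul, div_mul_div_comm, Real.mul_self_sqrt (by norm_num)]
  push_cast
  ring

lemma HasLowering.inner_numWave_eq_inner_lowWave {f : Wave M} {B : Fin M → Wave M} (hs : 0 < s)
    (h : HasLowering s γ f B) (b : Config M) :
    ⟪numWave hs γ b, f⟫_ℂ =
      ⟪lowWave hs γ b, WithLp.toLp 2 fun k => ((s / Real.sqrt 2 : ℝ) : ℂ) • B k⟫_ℂ := by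
  rw [h.inner_numWave hs, PiLp.inner_apply]
  refine Finset.sum_congr rfl fun k _ => ?_
  simp only [lowWave, inner_smul_left, inner_smul_right, map_mul, Complex.conj_ofReal,
    Complex.conj_I, ← sq_div_sqrt_two]
  ring

/-- The normal ordering `n² = n + ∑ aₖ† aₗ† aₖ aₗ` between two coherent states. With `G` their
overlap and `β = (s²/2) ∑ bₖ cₖ`, the two terms on the right are `β G` and `β² G`. -/
lemma inner_numWave_numWave (hs : 0 < s) (b c : Config M) :
    ⟪numWave hs γ b, numWave hs γ c⟫_ℂ =
      ⟪lowWave hs γ b, lowWave hs γ c⟫_ℂ + ⟪lowLowWave hs γ b, lowLowWave hs γ c⟫_ℂ := by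
  set G := ⟪modWave hs γ b, modWave hs γ c⟫_ℂ with hG
  set β : ℂ := ∑ k, (s : ℂ) ^ 2 / 2 * (b k * c k) with hβ
  have h1 : ⟪lowWave hs γ b, lowWave hs γ c⟫_ℂ = β * G := by
    rw [PiLp.inner_apply, hβ, Finset.sum_mul]
    refine Finset.sum_congr rfl fun k _ => ?_
    simp only [lowWave, inner_smul_left, inner_smul_right, map_mul, Complex.conj_ofReal,
      Complex.conj_I, ← sq_div_sqrt_two, ← hG]
    linear_combination (-((s / Real.sqrt 2 : ℝ) : ℂ) ^ 2 * b k * c k * G) * Complex.I_sq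
  have h2 : ⟪lowLowWave hs γ b, lowLowWave hs γ c⟫_ℂ = β * β * G := by
    rw [PiLp.inner_apply, Fintype.sum_prod_type, hβ, Finset.sum_mul_sum, Finset.sum_mul]
    refine Finset.sum_congr rfl fun k _ => ?_
    rw [Finset.sum_mul]
    refine Finset.sum_congr rfl fun l _ => ?_
    simp only [lowLowWave, inner_smul_left, inner_smul_right, map_mul, Complex.conj_ofReal, ← hG]
    push_cast
    ring
  have h3 : ⟪modWave hs γ b, numWave hs γ c⟫_ℂ = β * G := by
    rw [← inner_conj_symm, (hasLowering_modWave hs b).inner_numWave hs c, map_sum, hβ,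
      Finset.sum_mul]
    refine Finset.sum_congr rfl fun k _ => ?_
    rw [inner_smul_right, map_mul, map_mul, map_mul _ _ ⟪_, _⟫_ℂ, inner_conj_symm]
    simp only [map_mul, map_neg, Complex.conj_ofReal, Complex.conj_I, ← hG, map_div₀, map_pow,
      map_ofNat]
    linear_combination (-((s : ℂ) ^ 2 / 2) * b k * c k * G) * Complex.I_sq
  rw [(hasLowering_numWave hs c).inner_numWave hs b, h1, h2,
    show β * G + β * β * G = β * (β * G + G) by ring, hβ, Finset.sum_mul]
  refine Finset.sum_congr rfl fun k _ => ?_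
  rw [inner_smul_right, inner_add_right, h3, ← hG]
  linear_combination (-((s : ℂ) ^ 2 / 2) * b k * c k * (β * G + G)) * Complex.I_sq

end SpectralGap

/-! ### Totality of the coherent states and proof of the spectral gap -/

section Totality

variable {s γ : ℝ} {M : ℕ}

/-- An integrable function with vanishing Fourier transform vanishes. -/
lemma ae_eq_zero_of_fourier_eq_zero {h : Config M → ℂ} (hi : Integrable h)
    (hF : ∀ w, 𝓕 h w = 0) : ∀ᵐ x, h x = 0 := by
  refine ae_eq_zero_of_integral_contDiff_smul_eq_zero hi.locallyIntegrable fun g hg hg' => ?_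
  have hgc : ContDiff ℝ ∞ fun x => (g x : ℂ) := Complex.ofRealCLM.contDiff.comp hg
  have hgc' : HasCompactSupport fun x => (g x : ℂ) := hg'.comp_left Complex.ofReal_zero
  set G := 𝓕⁻ (hgc'.toSchwartzMap hgc) with hG
  have hGF : ∀ x, 𝓕 (G : Config M → ℂ) x = g x := fun x => by
    have h1 : 𝓕 G = hgc'.toSchwartzMap hgc := by rw [hG, FourierTransform.fourier_fourierInv_eq]
    rw [← SchwartzMap.fourier_coe, h1]
    rfl
  -- The multiplication formula `∫ ĥ G = ∫ h Ĝ`, where `Ĝ` is the test function `g`.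
  have hflip := VectorFourier.integral_fourierIntegral_smul_eq_flip (L := innerₗ (Config M))
    (μ := volume) (ν := volume) Real.continuous_fourierChar continuous_inner hi G.integrable
  have e1 : ∀ w, VectorFourier.fourierIntegral Real.fourierChar volume (innerₗ (Config M)) h w = 0 :=
    hF
  have e2 : ∀ x, VectorFourier.fourierIntegral Real.fourierChar volume (innerₗ (Config M)).flip
      (G : Config M → ℂ) x = g x := fun x => by
    rw [flip_innerₗ]; exact hGF x
  simp only [e1, e2, smul_eq_mul, zero_mul, integral_zero] at hflip
  simp only [Complex.real_smul]
  rw [hflip]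
  simp only [mul_comm]

/-- The overlaps with all momentum displacements are the Fourier transform of the integrable
function `Ψ̄ f`, and `Ψ` has no zeros. -/
lemma eq_zero_of_forall_inner_modWave_eq_zero (hs : 0 < s) (f : Wave M)
    (h : ∀ b, ⟪modWave hs γ b, f⟫_ℂ = 0) : f = 0 := by
  have hi : Integrable fun x => star (modulated s γ 0 x) * f x := by
    simp only [star_modulated]
    exact MemLp.integrable_mul (memLp_modulated hs _) (Lp.memLp f)
  have h0 := ae_eq_zero_of_fourier_eq_zero hi fun w => by
    rw [Real.fourier_eq', ← h ((2 * Real.pi) • w), inner_modWave]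
    refine integral_congr_ae (Filter.Eventually.of_forall fun x => ?_)
    simp only [smul_eq_mul]
    rw [star_modulated, star_modulated, modulated, modulated, ← mul_assoc, ← mul_assoc,
      ← Complex.exp_add]
    congr 3
    rw [PiLp.inner_apply]
    simp only [Finset.mul_sum, ← Finset.sum_add_distrib, Finset.sum_mul, Complex.ofReal_sum]
    refine Finset.sum_congr rfl fun k _ => ?_
    simp
    ring
  refine (Lp.eq_zero_iff_ae_eq_zero).2 ?_
  filter_upwards [h0] with x hx
  refine (mul_eq_zero.1 hx).resolve_left ?_
  rw [← ne_eq, star_ne_zero, ← norm_ne_zero_iff, norm_modulated]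
  positivity

/-- The derivative of the overlap with a modulated state along a ray. -/
lemma hasDerivAt_inner_modWave (hs : 0 < s) (f : Wave M) (b : Config M) (r : ℝ) :
    HasDerivAt (fun r : ℝ => ⟪modWave hs γ (r • b), f⟫_ℂ)
      (∫ x, star (Complex.I * ∑ k, (b k : ℂ) * x k) * star (modulated s γ (r • b) x) * f x) r := by
  have hP : (fun x : Config M => ∑ k, (b k : ℂ) * x k).HasTemperateGrowth :=
    Function.HasTemperateGrowth.sum fun k _ => by fun_prop
  have hI : ∀ {P : Config M → ℂ} (c : Config M), P.HasTemperateGrowth →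
      Integrable fun x => P x * star (modulated s γ c x) * f x := fun c hP => by
    simp only [star_modulated]
    exact MemLp.integrable_mul (memLp_mul_modulated hs _ hP) (Lp.memLp f)
  -- The modulus of a displaced state does not depend on the displacement, so a single integrable
  -- bound serves all `r`.
  have hbound := (hI 0 hP).norm
  simp only [inner_modWave]
  have hstar : ∀ x : Config M, star (Complex.I * ∑ k, (b k : ℂ) * x k) =
      -Complex.I * ∑ k, (b k : ℂ) * x k := fun x => by
    simp
  simp only [hstar]
  refine (hasDerivAt_integral_of_dominated_loc_of_deriv_le (μ := volume) (𝕜 := ℝ)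
    (F := fun r x => star (modulated s γ (r • b) x) * f x)
    (F' := fun r x => -Complex.I * (∑ k, (b k : ℂ) * x k) * star (modulated s γ (r • b) x) * f x)
    (s := Set.univ) Filter.univ_mem ?_ ?_ ?_ ?_ hbound ?_).2
  · refine Filter.Eventually.of_forall fun r => ?_
    simpa using (hI (P := fun _ => 1) (r • b) (by fun_prop)).1
  · simpa using (hI (P := fun _ => 1) (r • b) (by fun_prop))
  · exact (hI (P := fun x => -Complex.I * (∑ k, (b k : ℂ) * x k)) (r • b) (by fun_prop)).1
  · refine Filter.Eventually.of_forall fun x r _ => le_of_eq ?_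
    simp only [norm_mul, norm_star, norm_modulated, norm_neg, Complex.norm_I, one_mul]
  · refine Filter.Eventually.of_forall fun x r _ => ?_
    have e : ∀ r : ℝ, star (modulated s γ (r • b) x) = Complex.exp
        (-Complex.I * (∑ k, (b k : ℂ) * x k) * r) * modulated s (-γ) 0 x := fun r => by
      rw [star_modulated, modulated, modulated]
      simp [mul_assoc, Finset.mul_sum, mul_left_comm, mul_comm]
    simp only [e]
    have h0 : HasDerivAt (fun r : ℝ => (r : ℂ)) 1 r := Complex.ofRealCLM.hasDerivAt
    have h1 := (((h0.const_mul (-Complex.I * (∑ k, (b k : ℂ) * x k))).cexp).mul_const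
      (modulated s (-γ) 0 x)).mul_const (f x)
    convert! h1 using 1
    ring

/-- Along the ray `r b`, orthogonality to the vectors `n g` is a differential equation `F' = -(β
r/2) F` for the overlap `F`, with `β = s² ∑ bₖ²`. Hence `F exp(β r²/4)` is constant, and all
overlaps are nonzero multiples of the overlap with `Ψ`; the kernel of `n` is one-dimensional. -/
lemma inner_modWave_eq_of_forall_inner_numWave_eq_zero (hs : 0 < s) (f : Wave M)
    (h : ∀ b, ⟪numWave hs γ b, f⟫_ℂ = 0) (b : Config M) :
    ∃ c : ℝ, ⟪modWave hs γ b, f⟫_ℂ * c = ⟪modWave hs γ 0, f⟫_ℂ ∧ c ≠ 0 := by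
  set β : ℝ := s ^ 2 * ∑ k, b k ^ 2 with hβ
  set F : ℝ → ℂ := fun r => ⟪modWave hs γ (r • b), f⟫_ℂ with hF
  set G : ℝ → ℂ := fun r => F r * Real.exp (β * r ^ 2 / 4) with hG
  set D : ℝ → ℂ := fun r =>
    ∫ x, star (Complex.I * ∑ k, (b k : ℂ) * x k) * star (modulated s γ (r • b) x) * f x with hD
  have hder : ∀ r, HasDerivAt F (D r) r := hasDerivAt_inner_modWave hs f b
  have hrel : ∀ r : ℝ, r * (D r + β * r / 2 * F r) = 0 := fun r => by
    rw [← h (r • b), hD, hF]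
    have hP : (fun x : Config M => star (Complex.I * ∑ k, (b k : ℂ) * x k)).HasTemperateGrowth := by
      have hstar : ∀ x : Config M, star (Complex.I * ∑ k, (b k : ℂ) * x k) =
          -Complex.I * ∑ k, (b k : ℂ) * x k := fun x => by
        simp
      simp only [hstar]
      have : (fun x : Config M => ∑ k, (b k : ℂ) * x k).HasTemperateGrowth :=
        Function.HasTemperateGrowth.sum fun k _ => by fun_prop
      fun_prop
    have hI : ∀ {P : Config M → ℂ} (c : Config M), P.HasTemperateGrowth →
        Integrable fun x => P x * star (modulated s γ c x) * f x := fun c hP => by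
      simp only [star_modulated]
      exact MemLp.integrable_mul (memLp_mul_modulated hs _ hP) (Lp.memLp f)
    have i1 := hI (r • b) hP
    have i2 := hI (P := fun _ => (β * r / 2 : ℂ)) (r • b) (by fun_prop)
    simp only [inner_modWave]
    rw [← integral_const_mul]
    simp only [← mul_assoc] at i1 i2 ⊢
    rw [← integral_add i1 i2, ← integral_const_mul, L2.inner_def]
    refine integral_congr_ae ?_
    filter_upwards [coeFn_numWave (γ := γ) hs (r • b)] with x hx
    have e : star (numFactor s (r • b) x) =
        r * (star (Complex.I * ∑ k, (b k : ℂ) * x k) + β * r / 2) := by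
      rw [hβ, numFactor]
      have h2 : (starRingEnd ℂ) 2 = 2 := Complex.conj_ofReal 2
      simp only [Complex.star_def, map_sum, map_add, map_mul, Complex.conj_ofReal, Complex.conj_I,
        PiLp.smul_apply, smul_eq_mul, Complex.ofReal_mul, map_div₀, map_pow, h2, Complex.ofReal_sum,
        Complex.ofReal_pow, Finset.sum_add_distrib, Finset.mul_sum, mul_add, Finset.sum_mul,
        Finset.sum_div]
      congr 1 <;> exact Finset.sum_congr rfl fun k _ => by ring
    rw [hx, RCLike.inner_apply, map_mul]
    have e' : (starRingEnd ℂ) (numFactor s (r • b) x) = _ := e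
    rw [e']
    simp only [Complex.star_def]
    ring
  have hG' : ∀ r : ℝ, HasDerivAt G
      ((D r + β * r / 2 * F r) * Real.exp (β * r ^ 2 / 4)) r := fun r => by
    have h1 : HasDerivAt (fun r : ℝ => Real.exp (β * r ^ 2 / 4))
        (Real.exp (β * r ^ 2 / 4) * (β * r / 2)) r := by
      have := ((((hasDerivAt_id r).pow 2).const_mul β).div_const 4).exp
      convert! this using 1
      simp
      ring
    convert! (hder r).mul h1.ofReal_comp using 1
    push_cast
    ring
  -- The relation `hrel` carries a factor `r` and says nothing at `r = 0`, which is reached by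
  -- continuity below.
  have hconst : ∀ r : ℝ, 0 < r → G r = G 1 := fun r hr => by
    refine isOpen_Ioi.is_const_of_deriv_eq_zero (isPreconnected_Ioi (a := (0 : ℝ)))
      (fun t _ => (hG' t).differentiableAt.differentiableWithinAt) (fun t ht => ?_) hr
      (Set.mem_Ioi.2 one_pos)
    have ht' : (t : ℂ) ≠ 0 := by
      have : t ≠ 0 := (Set.mem_Ioi.1 ht).ne'
      exact_mod_cast this
    rw [(hG' t).deriv, (mul_eq_zero.1 (hrel t)).resolve_left ht', zero_mul]
    rfl
  have hlim : Filter.Tendsto G (nhdsWithin 0 (Set.Ioi 0)) (nhds (G 0)) :=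
    ((hG' 0).continuousAt.tendsto).mono_left nhdsWithin_le_nhds
  have hlim' : Filter.Tendsto G (nhdsWithin 0 (Set.Ioi 0)) (nhds (G 1)) :=
    tendsto_const_nhds.congr' (eventually_nhdsWithin_of_forall fun r hr => (hconst r hr).symm)
  have := tendsto_nhds_unique hlim' hlim
  refine ⟨Real.exp (β / 4), ?_, (Real.exp_pos _).ne'⟩
  simpa [hG, hF] using this

lemma modWave_zero (hs : 0 < s) : modWave hs γ (0 : Config M) = cubic s hs γ M := by
  refine Lp.ext ?_
  filter_upwards [coeFn_modWave (γ := γ) hs (0 : Config M),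
    (memLp_cubicFun hs γ M).coeFn_toLp] with x h1 h2
  rw [h1, cubic, h2]
  simp [modulated]

/-- `Ψ` is the coherent state with `b = 0`, which every lowering operator annihilates. -/
lemma inner_numWave_cubic (hs : 0 < s) (b : Config M) :
    ⟪numWave hs γ b, cubic s hs γ M⟫_ℂ = 0 := by
  rw [← modWave_zero, (hasLowering_modWave hs 0).inner_numWave hs]
  simp

/-- The spectral gap: the number operator transported to the cubic phase state dominates the
projection onto the orthogonal complement of the state. -/
theorem HasLowering.norm_sq_sub_le {f : Wave M} {B : Fin M → Wave M} (hs : 0 < s)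
    (h : HasLowering s γ f B) :
    ‖f‖ ^ 2 - ‖⟪cubic s hs γ M, f⟫_ℂ‖ ^ 2 ≤ s ^ 2 / 2 * ∑ k, ‖B k‖ ^ 2 := by
  set Ψ := cubic s hs γ M with hΨ
  have hn : ‖Ψ‖ = 1 := norm_cubic hs
  set c := ⟪Ψ, f⟫_ℂ with hc
  set f₀ := f - c • Ψ with hf₀
  have horth : ⟪Ψ, f₀⟫_ℂ = 0 := by
    rw [hf₀, inner_sub_right, inner_smul_right, inner_self_eq_norm_sq_to_K, hn, ← hc]
    simp
  have hnorm : ‖f‖ ^ 2 - ‖c‖ ^ 2 = ‖f₀‖ ^ 2 := by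
    have h2 := norm_add_sq_eq_norm_sq_add_norm_sq_of_inner_eq_zero (𝕜 := ℂ) (c • Ψ) f₀
      (by rw [inner_smul_left, horth, mul_zero])
    rw [show c • Ψ + f₀ = f by rw [hf₀]; abel, norm_smul, hn] at h2
    linarith
  -- By the double complement it suffices that a vector `g` orthogonal to all `numWave` is a
  -- multiple of `Ψ`: after removing its `Ψ` component, all its overlaps with coherent states
  -- vanish.
  have hmem : f₀ ∈ (Submodule.span ℂ (Set.range (numWave (M := M) hs γ))).topologicalClosure := by
    rw [← Submodule.orthogonal_orthogonal_eq_closure, Submodule.mem_orthogonal]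
    intro g hg
    have hg0 : ∀ b, ⟪numWave hs γ b, g⟫_ℂ = 0 := fun b =>
      (Submodule.mem_orthogonal _ _).1 hg _ (Submodule.subset_span ⟨b, rfl⟩)
    have hg1 : g - ⟪Ψ, g⟫_ℂ • Ψ = 0 := by
      refine eq_zero_of_forall_inner_modWave_eq_zero (γ := γ) hs _ fun b => ?_
      obtain ⟨a, ha, ha'⟩ := inner_modWave_eq_of_forall_inner_numWave_eq_zero (γ := γ) hs
        (g - ⟪Ψ, g⟫_ℂ • Ψ) (fun b => by
          rw [inner_sub_right, inner_smul_right, hg0, inner_numWave_cubic hs, mul_zero, sub_zero]) b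
      have ha2 : ⟪modWave hs γ b, g - ⟪Ψ, g⟫_ℂ • Ψ⟫_ℂ * (a : ℂ) = 0 := by
        rw [ha, modWave_zero, ← hΨ, inner_sub_right, inner_smul_right, inner_self_eq_norm_sq_to_K,
          hn]
        simp
      exact (mul_eq_zero.1 ha2).resolve_right (by exact_mod_cast ha')
    rw [sub_eq_zero.1 hg1, inner_smul_left, horth, mul_zero]
  have hle := norm_le_of_mem_closure_span
    (norm_linearCombination_le_of_inner_eq_add (inner_numWave_numWave (γ := γ) hs))
    (f := f₀) (Y := WithLp.toLp 2 fun k => ((s / Real.sqrt 2 : ℝ) : ℂ) • B k) (fun b => by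
      rw [hf₀, inner_sub_right, inner_smul_right, inner_numWave_cubic hs, mul_zero, sub_zero]
      exact h.inner_numWave_eq_inner_lowWave hs b) hmem
  rw [hnorm]
  refine (pow_le_pow_left₀ (norm_nonneg _) hle 2).trans (le_of_eq ?_)
  rw [PiLp.norm_sq_eq_of_L2, Finset.mul_sum]
  refine Finset.sum_congr rfl fun k _ => ?_
  simp only [norm_smul, Complex.norm_real, Real.norm_eq_abs, mul_pow, sq_abs, div_pow]
  rw [Real.sq_sqrt (by norm_num)]

end Totality

/-! ### Moments of homodyne outcomes -/

section Born

variable {M : ℕ}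

lemma measurable_density (φ : Wave M) : Measurable fun x => ENNReal.ofReal (‖φ x‖ ^ 2) :=
  ((Lp.stronglyMeasurable φ).measurable.norm.pow_const 2).ennreal_ofReal

lemma lintegral_map_bornMeasure (φ : Wave M) {q : Config M → ℝ} (hq : Measurable q)
    {h : ℝ → ℝ≥0∞} (hh : Measurable h) :
    ∫⁻ v, h v ∂((bornMeasure φ).map q) = ∫⁻ x, ENNReal.ofReal (‖φ x‖ ^ 2) * h (q x) := by
  rw [lintegral_map hh hq, bornMeasure]
  exact lintegral_withDensity_eq_lintegral_mul _ (measurable_density φ) (hh.comp hq)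

lemma integral_map_bornMeasure (φ : Wave M) {q : Config M → ℝ} (hq : Measurable q)
    {h : ℝ → ℝ} (hh : Measurable h) :
    ∫ v, h v ∂((bornMeasure φ).map q) = ∫ x, ‖φ x‖ ^ 2 * h (q x) := by
  rw [integral_map hq.aemeasurable hh.aestronglyMeasurable, bornMeasure,
    integral_withDensity_eq_integral_toReal_smul (measurable_density φ)
      (Filter.Eventually.of_forall fun _ => ENNReal.ofReal_lt_top)]
  refine integral_congr_ae (Filter.Eventually.of_forall fun x => ?_)
  simp only [smul_eq_mul]
  rw [ENNReal.toReal_ofReal (by positivity)]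

lemma memLp_mul_of_lintegral_lt_top (φ : Wave M) {q : Config M → ℝ} (hq : Measurable q)
    (h : ∫⁻ x, ENNReal.ofReal (‖φ x‖ ^ 2) * ENNReal.ofReal (q x ^ 2) < ⊤) :
    MemLp (fun x => (q x : ℂ) * φ x) 2 := by
  have hm : AEStronglyMeasurable (fun x => (q x : ℂ) * φ x) volume :=
    (Complex.measurable_ofReal.comp hq).aestronglyMeasurable.mul (Lp.aestronglyMeasurable φ)
  rw [memLp_two_iff_integrable_sq_norm hm]
  refine ⟨hm.norm.pow 2, ?_⟩
  rw [hasFiniteIntegral_iff_ofReal (Filter.Eventually.of_forall fun x => by positivity)]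
  refine lt_of_le_of_lt (lintegral_mono fun x => ?_) h
  rw [norm_mul, mul_pow, Complex.norm_real, Real.norm_eq_abs, sq_abs, mul_comm,
    ENNReal.ofReal_mul (by positivity)]

/-- Multiplication by a lower power of a real function. -/
lemma memLp_pow_mul_of_le {φ : Wave M} {q : Config M → ℝ} (hq : Measurable q) {n j : ℕ}
    (hj : j ≤ n) (h : MemLp (fun x => ((q x : ℂ)) ^ n * φ x) 2) :
    MemLp (fun x => ((q x : ℂ)) ^ j * φ x) 2 := by
  have hm : AEStronglyMeasurable (fun x => (q x : ℂ) ^ j * φ x) volume :=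
    ((Complex.measurable_ofReal.comp hq).pow_const j).aestronglyMeasurable.mul
      (Lp.aestronglyMeasurable φ)
  refine MemLp.mono (g := fun x => ‖φ x‖ + ‖((q x : ℂ)) ^ n * φ x‖)
    ((Lp.memLp φ).norm.add h.norm) hm (Filter.Eventually.of_forall fun x => ?_)
  rw [Real.norm_of_nonneg (by positivity), norm_mul, norm_mul, norm_pow, norm_pow]
  have hle : ‖(q x : ℂ)‖ ^ j ≤ 1 + ‖(q x : ℂ)‖ ^ n := by
    rcases le_total ‖(q x : ℂ)‖ 1 with h1 | h1
    · exact (pow_le_one₀ (norm_nonneg _) h1).trans (by simp)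
    · exact (pow_le_pow_right₀ h1 hj).trans (by simp)
  calc ‖(q x : ℂ)‖ ^ j * ‖φ x‖ ≤ (1 + ‖(q x : ℂ)‖ ^ n) * ‖φ x‖ := by gcongr
    _ = _ := by ring

end Born

/-! ### Momentum moments as inner products of weak derivatives -/

section Fourier

variable {M : ℕ} {k : Fin M}

/-- If the third momentum moment operator is square integrable, the wave has two weak derivatives,
and the momentum moments are inner products of them. -/
lemma exists_hasWeakDeriv_of_fourier {ψ : Wave M}
    (h : MemLp (fun ξ => ((2 * Real.pi * ξ k : ℝ) : ℂ) ^ 3 * (𝓕 ψ : Wave M) ξ) 2) :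
    ∃ d₁ d₂ : Wave M, HasWeakDeriv k ψ d₁ ∧ HasWeakDeriv k d₁ d₂ ∧
      ∫ ξ, ‖(𝓕 ψ : Wave M) ξ‖ ^ 2 * (2 * Real.pi * ξ k) ^ 2 = ‖d₁‖ ^ 2 ∧
      ((∫ ξ, ‖(𝓕 ψ : Wave M) ξ‖ ^ 2 * (2 * Real.pi * ξ k) ^ 3 : ℝ) : ℂ) * Complex.I =
        ⟪d₁, d₂⟫_ℂ ∧ ⟪ψ, d₂⟫_ℂ = -(‖d₁‖ ^ 2 : ℝ) := by
  set F : Wave M := 𝓕 ψ with hF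
  set w : Config M → ℝ := fun ξ => 2 * Real.pi * ξ k with hw
  have hwm : Measurable w := by fun_prop
  -- In momentum space the first and second derivatives are multiplication by `i w` and `-w²`; both
  -- powers are controlled by the cube.
  have m1 : MemLp (fun ξ => Complex.I * ((w ξ : ℂ) ^ 1 * F ξ)) 2 :=
    (memLp_pow_mul_of_le hwm (by norm_num) h).const_mul _
  have m2 : MemLp (fun ξ => -1 * ((w ξ : ℂ) ^ 2 * F ξ)) 2 :=
    (memLp_pow_mul_of_le hwm (by norm_num) h).const_mul _
  have f1 : (𝓕 (𝓕⁻ (m1.toLp _) : Wave M) : Wave M) = m1.toLp _ :=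
    FourierTransform.fourier_fourierInv_eq _
  have f2 : (𝓕 (𝓕⁻ (m2.toLp _) : Wave M) : Wave M) = m2.toLp _ :=
    FourierTransform.fourier_fourierInv_eq _
  set d₁ : Wave M := 𝓕⁻ (m1.toLp _)
  set d₂ : Wave M := 𝓕⁻ (m2.toLp _)
  have g1 : (𝓕 d₁ : Wave M) =ᵐ[volume] fun ξ => Complex.I * ((w ξ : ℂ) ^ 1 * F ξ) := by
    rw [f1]; exact m1.coeFn_toLp
  have g2 : (𝓕 d₂ : Wave M) =ᵐ[volume] fun ξ => -1 * ((w ξ : ℂ) ^ 2 * F ξ) := by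
    rw [f2]; exact m2.coeFn_toLp
  have hn : ∀ z : ℂ, z * (starRingEnd ℂ) z = ((‖z‖ ^ 2 : ℝ) : ℂ) := fun z => by
    rw [Complex.mul_conj, Complex.normSq_eq_norm_sq]
  have hd1 : ∫ ξ, ‖F ξ‖ ^ 2 * (w ξ) ^ 2 = ‖d₁‖ ^ 2 := by
    rw [← Lp.norm_fourier_eq d₁, ← integral_norm_sq_eq]
    refine integral_congr_ae ?_
    filter_upwards [g1] with ξ h1
    rw [h1, norm_mul, Complex.norm_I, one_mul, norm_mul, pow_one, Complex.norm_real,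
      Real.norm_eq_abs, mul_pow |w ξ|, sq_abs, mul_comm (w ξ ^ 2)]
  refine ⟨d₁, d₂, HasWeakDeriv.of_fourier ?_, HasWeakDeriv.of_fourier ?_, hd1, ?_, ?_⟩
  · filter_upwards [g1] with ξ h1
    rw [h1, hw]
    push_cast
    ring
  · filter_upwards [g1, g2] with ξ h1 h2
    rw [h1, h2, hw]
    push_cast
    linear_combination (-(4 * Real.pi ^ 2 * (ξ k : ℂ) ^ 2 * F ξ)) * Complex.I_sq
  · rw [← Lp.inner_fourier_eq, L2.inner_def, ← integral_complex_ofReal, ← integral_mul_const]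
    refine integral_congr_ae ?_
    filter_upwards [g1, g2] with ξ h1 h2
    rw [h1, h2, RCLike.inner_apply]
    simp only [map_mul, Complex.conj_I, Complex.conj_ofReal, map_pow]
    push_cast
    rw [← Complex.ofReal_pow ‖F ξ‖, ← hn]
    simp only [hw]
    push_cast
    ring
  · rw [← Lp.inner_fourier_eq, L2.inner_def, ← hd1, ← integral_complex_ofReal, ← integral_neg]
    refine integral_congr_ae ?_
    filter_upwards [g2] with ξ h2
    rw [h2, RCLike.inner_apply]
    push_cast
    rw [← Complex.ofReal_pow ‖F ξ‖, ← hn]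
    ring

end Fourier

/-! ### The witness on a single vector -/

section Chirp

variable {M : ℕ} {k : Fin M}

/-- The function by which `chirp` multiplies. -/
def chirpFun (k : Fin M) (c : ℝ) (x : Config M) : ℂ :=
  Complex.exp (Complex.I * ((c * x k ^ 2 / 2 : ℝ) : ℂ))

lemma coeFn_chirp (k : Fin M) (c : ℝ) (φ : Wave M) :
    chirp k c φ =ᵐ[volume] fun x => chirpFun k c x * φ x := coeFn_phase _ φ

lemma contDiff_chirpFun (c : ℝ) : ContDiff ℝ ∞ (chirpFun k c) := by
  have h : ContDiff ℝ ∞ fun x : Config M => ((c * x k ^ 2 / 2 : ℝ) : ℂ) :=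
    Complex.ofRealCLM.contDiff.comp
      ((contDiff_const.mul ((coord k).contDiff.pow 2)).div_const 2)
  exact (contDiff_const.mul h).cexp

lemma partialDeriv_chirpFun (c : ℝ) (x : Config M) :
    partialDeriv k (chirpFun k c) x = chirpFun k c x * (Complex.I * c * x k) := by
  have hd : HasDerivAt (fun t : ℝ => Complex.exp (Complex.I * ((c * t ^ 2 / 2 : ℝ) : ℂ)))
      (Complex.exp (Complex.I * ((c * x k ^ 2 / 2 : ℝ) : ℂ)) * (Complex.I * c * x k)) (x k) := by
    have h0 : HasDerivAt (fun t : ℝ => c * t ^ 2 / 2) (c * x k) (x k) := by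
      have := (((hasDerivAt_id (x k)).pow 2).const_mul c).div_const 2
      convert! this using 1
      simp
      ring
    convert! (h0.ofReal_comp.const_mul Complex.I).cexp using 1
    push_cast
    ring
  have := partialDeriv_comp_coord k k hd
  rw [if_pos rfl] at this
  exact this

lemma partialDeriv_coord_mul (c : ℂ) (x : Config M) :
    partialDeriv k (fun x => c * (x k : ℂ)) x = c := by
  have h0 : HasDerivAt (fun t : ℝ => c * (t : ℂ)) (c * 1) (x k) :=
    (Complex.ofRealCLM.hasDerivAt (x := x k)).const_mul c
  simpa using partialDeriv_comp_coord k k h0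

lemma contDiff_coord_mul (c : ℂ) : ContDiff ℝ ∞ fun x : Config M => c * (x k : ℂ) :=
  contDiff_const.mul (Complex.ofRealCLM.contDiff.comp (coord k).contDiff)

/-- The weak derivatives of a chirped wave. -/
lemma ae_eq_of_hasWeakDeriv_chirp {φ d₁ d₂ e₁ e₂ : Wave M} {c : ℝ}
    (h1 : HasWeakDeriv k φ d₁) (h2 : HasWeakDeriv k d₁ d₂)
    (h1' : HasWeakDeriv k (chirp k c φ) e₁) (h2' : HasWeakDeriv k e₁ e₂) :
    (∀ᵐ x, e₁ x = chirpFun k c x * (d₁ x + Complex.I * c * (x k * φ x))) ∧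
    ∀ᵐ x, e₂ x = chirpFun k c x * (d₂ x + Complex.I * c * (2 * (x k * d₁ x) + φ x) -
      c ^ 2 * ((x k : ℂ) ^ 2 * φ x)) := by
  have a1 := (h1'.unique ((h1.mul_left (contDiff_chirpFun (k := k) c)).congr
    (coeFn_chirp k c φ).symm (Filter.EventuallyEq.refl _ _)))
  have b1 : ∀ᵐ x, e₁ x = chirpFun k c x * (d₁ x + Complex.I * c * (x k * φ x)) := by
    filter_upwards [a1] with x hx
    rw [hx, partialDeriv_chirpFun]
    ring
  refine ⟨b1, ?_⟩
  have w := ((h2.add (h1.mul_left (contDiff_coord_mul (k := k) (Complex.I * c)))).mul_left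
    (contDiff_chirpFun (k := k) c))
  have b1' : (fun x => chirpFun k c x * (d₁ x + Complex.I * c * x k * φ x)) =ᵐ[volume] e₁ := by
    filter_upwards [b1] with x hx
    rw [hx]; ring
  have a2 := h2'.unique (w.congr b1' (Filter.EventuallyEq.refl _ _))
  filter_upwards [a2] with x hx
  rw [hx, partialDeriv_chirpFun]
  simp only [partialDeriv_coord_mul]
  linear_combination (chirpFun k c x * c ^ 2 * x k ^ 2 * φ x) * Complex.I_sq

end Chirp

/-- The commutation relations behind the witness, in terms of inner products. The vectors stand
for `x f`, `x² f`, `f'`, `f''`, `x f'`, and `m c` for the third moment of `p + c x`. -/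
lemma witness_identity {H : Type*} [NormedAddCommGroup H] [InnerProductSpace ℂ H]
    {f x₁ x₂ d₁ d₂ y : H} {m : ℝ → ℝ} (s γ : ℝ) (hs : 0 < s)
    (hy : ⟪x₁, y⟫_ℂ = ⟪x₂, d₁⟫_ℂ) (hy' : ⟪f, y⟫_ℂ = ⟪x₁, d₁⟫_ℂ)
    (hx : ⟪x₁, f⟫_ℂ = ⟪f, x₁⟫_ℂ) (hx' : ⟪x₁, x₂⟫_ℂ = ⟪x₂, x₁⟫_ℂ)
    (h0 : ⟪d₁, d₂⟫_ℂ = m 0 * Complex.I)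
    (hm : ∀ c : ℝ, c = 1 ∨ c = -1 →
      ⟪d₁ + (Complex.I * c) • x₁, d₂ + (Complex.I * c) • ((2 : ℂ) • y + f) - (c ^ 2 : ℂ) • x₂⟫_ℂ =
        m c * Complex.I)
    (hp : ∀ c : ℝ, c = 1 ∨ c = -1 →
      ⟪f, d₂ + (Complex.I * c) • ((2 : ℂ) • y + f) - (c ^ 2 : ℂ) • x₂⟫_ℂ =
        -⟪d₁ + (Complex.I * c) • x₁, d₁ + (Complex.I * c) • x₁⟫_ℂ) :
    -(1 / (2 * s ^ 2)) * ‖x₁‖ ^ 2 + -(9 * γ ^ 2 * s ^ 2 / 2) * ‖x₂‖ ^ 2 +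
      -(s ^ 2 / 2) * ‖d₁‖ ^ 2 + -(γ * s ^ 2) * m 0 + -(γ * s ^ 2 / 2) * -m (-1) +
      γ * s ^ 2 / 2 * m 1 =
    -(s ^ 2 / 2 * ‖d₁ + ((s ^ 2 : ℂ)⁻¹) • x₁ - (3 * Complex.I * γ) • x₂‖ ^ 2) -
      1 / 2 * ‖f‖ ^ 2 := by
  have hconj : ∀ u v : H, ⟪u, v⟫_ℂ = (starRingEnd ℂ) ⟪v, u⟫_ℂ := fun u v =>
    (inner_conj_symm u v).symm
  have hre : ∀ u v : H, (⟪u, v⟫_ℂ).re = (⟪v, u⟫_ℂ).re := fun u v => by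
    rw [hconj u v, Complex.conj_re]
  have him : ∀ u v : H, (⟪u, v⟫_ℂ).im = -(⟪v, u⟫_ℂ).im := fun u v => by
    rw [hconj u v, Complex.conj_im]
  have hself : ∀ u : H, (⟪u, u⟫_ℂ).re = ‖u‖ ^ 2 := fun u => inner_self_eq_norm_sq (𝕜 := ℂ) u
  have hself' : ∀ u : H, (⟪u, u⟫_ℂ).im = 0 := fun u => inner_self_im (𝕜 := ℂ) u
  have hm1 := congrArg Complex.im (hm 1 (Or.inl rfl))
  have hm2 := congrArg Complex.im (hm (-1) (Or.inr rfl))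
  have hp1 := congrArg Complex.im (hp 1 (Or.inl rfl))
  have hp2 := congrArg Complex.im (hp (-1) (Or.inr rfl))
  have h0' := congrArg Complex.im h0
  have e1 := congrArg Complex.re hy
  have e2 := congrArg Complex.im hy
  have e3 := congrArg Complex.re hy'
  have e4 := congrArg Complex.im hy'
  have e5 := congrArg Complex.im hx
  have e6 := congrArg Complex.im hx'
  rw [← hself (d₁ + ((s ^ 2 : ℂ)⁻¹) • x₁ - (3 * Complex.I * γ) • x₂)]
  have hs2 : ((s : ℂ) ^ 2)⁻¹ = (((s ^ 2)⁻¹ : ℝ) : ℂ) := by push_cast; rfl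
  rw [hs2]
  simp only [inner_add_left, inner_add_right, inner_sub_left, inner_sub_right, inner_smul_left,
    inner_smul_right, map_mul, Complex.conj_I, Complex.conj_ofReal, Complex.add_re, Complex.add_im,
    Complex.sub_re, Complex.sub_im, Complex.mul_re, Complex.mul_im, Complex.I_re, Complex.I_im,
    Complex.ofReal_re, Complex.ofReal_im, Complex.neg_re, Complex.neg_im, Complex.ofReal_one,
    Complex.ofReal_neg, Complex.one_re, Complex.one_im, hself, hself', map_ofNat, Complex.re_ofNat,
    Complex.im_ofNat, neg_sq, one_pow, map_one, map_neg]
    at hm1 hm2 hp1 hp2 h0' ⊢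
  clear hm hp hconj hself hself' h0 hs2
  simp only [hre x₁ d₁, him x₁ d₁, hre x₂ d₁, him x₂ d₁, hre x₂ x₁, him x₂ x₁, hre x₁ f, him x₁ f] at *
  -- The three mixed terms in the expansion of the square. The difference of `hp` at `c = 1` and `c
  -- = -1` gives the canonical commutation relation `hw`, the source of the `1/2`. The sum of `hm`
  -- at these values cancels the terms odd in `c` and leaves `hz`, in operator terms `(x+p)³ -
  -- (x-p)³ - 2p³ = 3(x²p + px²)`.
  have h12 : (⟪x₁, x₂⟫_ℂ).im = 0 := by linarith
  have hw : (⟪d₁, x₁⟫_ℂ).re = -(‖f‖ ^ 2 / 2) := by linarith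
  have hz : (⟪d₁, x₂⟫_ℂ).im = (2 * m 0 - m 1 - m (-1)) / 6 := by linarith
  rw [h12, hw, hz]
  field_simp
  ring

/-! ### From homodyne moments to the lowering operator -/

section Witness

variable {M : ℕ} {k : Fin M}

lemma inner_chirp (c : ℝ) (φ ψ : Wave M) : ⟪chirp k c φ, chirp k c ψ⟫_ℂ = ⟪φ, ψ⟫_ℂ := by
  obtain ⟨L, hL⟩ := isLinearIsometry_phase (μ := (volume : Measure (Config M)))
    (θ := fun x => c * x k ^ 2 / 2) (by fun_prop)
  have h : ∀ f, chirp k c f = L f := fun f => (hL f).symm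
  rw [h, h, L.inner_map_map]

lemma chirp_zero (φ : Wave M) : chirp k 0 φ = φ := by
  refine Lp.ext ?_
  filter_upwards [coeFn_chirp k 0 φ] with x hx
  rw [hx, chirpFun]
  simp

lemma chirpFun_neg_mul (c : ℝ) (x : Config M) : chirpFun k (-c) x * chirpFun k c x = 1 := by
  rw [chirpFun, chirpFun, ← Complex.exp_add, ← Complex.exp_zero]
  congr 1
  push_cast
  ring

/-- The momentum density of the chirped wave, against the third power of the momentum. -/
def thirdMoment (k : Fin M) (φ : Wave M) (c : ℝ) : ℝ :=
  ∫ ξ, ‖(𝓕 (chirp k c φ) : Wave M) ξ‖ ^ 2 * (2 * Real.pi * ξ k) ^ 3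

/-- The operator identity `∑ₐ λₐ fₐ = -(a†a + 1/2)` for one mode. The chirps convert moments of `p̂
+ c x̂` into momentum moments, and `(s²/2)‖B‖²` is the expectation of `a†a`. -/
lemma exists_lowering_eq {φ : Wave M} {s : ℝ} (hs : 0 < s) (γ : ℝ)
    (hx : MemLp (fun x => ((x k : ℝ) : ℂ) ^ 2 * φ x) 2)
    (hp : ∀ c : ℝ, c = 0 ∨ c = 1 ∨ c = -1 → MemLp (fun ξ =>
      ((2 * Real.pi * ξ k : ℝ) : ℂ) ^ 3 * (𝓕 (chirp k c φ) : Wave M) ξ) 2) :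
    ∃ B : Wave M, (∃ u : Wave M, HasWeakDeriv k φ u ∧ B =ᵐ[volume] fun x =>
        u x + ((x k : ℂ) / s ^ 2 - 3 * Complex.I * γ * (x k : ℂ) ^ 2) * φ x) ∧
      -(1 / (2 * s ^ 2)) * (∫ x, ‖φ x‖ ^ 2 * x k ^ 2) +
        -(9 * γ ^ 2 * s ^ 2 / 2) * (∫ x, ‖φ x‖ ^ 2 * x k ^ 4) +
        -(s ^ 2 / 2) * (∫ ξ, ‖(𝓕 φ : Wave M) ξ‖ ^ 2 * (2 * Real.pi * ξ k) ^ 2) +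
        -(γ * s ^ 2) * thirdMoment k φ 0 + -(γ * s ^ 2 / 2) * -thirdMoment k φ (-1) +
        γ * s ^ 2 / 2 * thirdMoment k φ 1 = -(s ^ 2 / 2 * ‖B‖ ^ 2) - 1 / 2 * ‖φ‖ ^ 2 := by
  have hx1 : MemLp (fun x => ((x k : ℝ) : ℂ) ^ 1 * φ x) 2 :=
    memLp_pow_mul_of_le (by fun_prop) one_le_two hx
  set x₁ : Wave M := hx1.toLp _ with hX1
  set x₂ : Wave M := hx.toLp _ with hX2
  have a1 : x₁ =ᵐ[volume] fun x => ((x k : ℝ) : ℂ) ^ 1 * φ x := hx1.coeFn_toLp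
  have a2 : x₂ =ᵐ[volume] fun x => ((x k : ℝ) : ℂ) ^ 2 * φ x := hx.coeFn_toLp
  obtain ⟨d₁, d₂, hd1, hd2, hn, h3, -⟩ := exists_hasWeakDeriv_of_fourier (hp 0 (Or.inl rfl))
  have h3' : ⟪d₁, d₂⟫_ℂ = thirdMoment k φ 0 * Complex.I := h3.symm
  rw [chirp_zero] at hd1 hn
  -- multiplication of the derivative by the coordinate is square integrable
  have hy : ∃ y : Wave M, y =ᵐ[volume] fun x => (x k : ℂ) * d₁ x := by
    obtain ⟨e₁, e₂, he1, he2, -⟩ := exists_hasWeakDeriv_of_fourier (hp 1 (Or.inr (Or.inl rfl)))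
    have h := (ae_eq_of_hasWeakDeriv_chirp hd1 hd2 he1 he2).2
    -- Undo the chirp in the formula for the second derivative at `c = 1` and solve for `x d₁`;
    -- every other term there is square integrable.
    refine ⟨(-Complex.I / 2) • (chirp k (-1) e₂ - d₂ - Complex.I • φ + x₂), ?_⟩
    filter_upwards [h, a2, coeFn_chirp k (-1) e₂,
      Lp.coeFn_smul (-Complex.I / 2) (chirp k (-1) e₂ - d₂ - Complex.I • φ + x₂),
      Lp.coeFn_add (chirp k (-1) e₂ - d₂ - Complex.I • φ) x₂,
      Lp.coeFn_sub (chirp k (-1) e₂ - d₂) (Complex.I • φ), Lp.coeFn_sub (chirp k (-1) e₂) d₂,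
      Lp.coeFn_smul Complex.I φ] with x g1 g2 g3 g4 g5 g6 g7 g8
    rw [g4, Pi.smul_apply, g5, Pi.add_apply, g6, Pi.sub_apply, g7, Pi.sub_apply, g8, Pi.smul_apply,
      g2, g3, g1, ← mul_assoc, chirpFun_neg_mul]
    simp only [smul_eq_mul]
    push_cast
    linear_combination (-(x k : ℂ) * d₁ x) * Complex.I_sq
  obtain ⟨y, hy⟩ := hy
  have key : ∀ c : ℝ, c = 1 ∨ c = -1 →
      ⟪d₁ + (Complex.I * c) • x₁, d₂ + (Complex.I * c) • ((2 : ℂ) • y + φ) -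
        (c ^ 2 : ℂ) • x₂⟫_ℂ = thirdMoment k φ c * Complex.I ∧
      ⟪φ, d₂ + (Complex.I * c) • ((2 : ℂ) • y + φ) - (c ^ 2 : ℂ) • x₂⟫_ℂ =
        -⟪d₁ + (Complex.I * c) • x₁, d₁ + (Complex.I * c) • x₁⟫_ℂ := by
    intro c hc
    obtain ⟨e₁, e₂, he1, he2, -, t1, t2⟩ := exists_hasWeakDeriv_of_fourier (hp c (Or.inr hc))
    obtain ⟨b1, b2⟩ := ae_eq_of_hasWeakDeriv_chirp hd1 hd2 he1 he2
    have f1 : e₁ = chirp k c (d₁ + (Complex.I * c) • x₁) := by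
      refine Lp.ext ?_
      filter_upwards [b1, coeFn_chirp k c (d₁ + (Complex.I * c) • x₁), a1,
        Lp.coeFn_add d₁ ((Complex.I * c) • x₁), Lp.coeFn_smul (Complex.I * c) x₁]
        with x g1 g2 g3 g4 g5
      rw [g1, g2, g4, Pi.add_apply, g5, Pi.smul_apply, g3, pow_one, smul_eq_mul]
    have f2 : e₂ = chirp k c (d₂ + (Complex.I * c) • ((2 : ℂ) • y + φ) - (c ^ 2 : ℂ) • x₂) := by
      refine Lp.ext ?_
      filter_upwards [b2, coeFn_chirp k c
          (d₂ + (Complex.I * c) • ((2 : ℂ) • y + φ) - (c ^ 2 : ℂ) • x₂), a2, hy,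
        Lp.coeFn_sub (d₂ + (Complex.I * c) • ((2 : ℂ) • y + φ)) ((c ^ 2 : ℂ) • x₂),
        Lp.coeFn_add d₂ ((Complex.I * c) • ((2 : ℂ) • y + φ)),
        Lp.coeFn_smul (Complex.I * c) ((2 : ℂ) • y + φ), Lp.coeFn_add ((2 : ℂ) • y) φ,
        Lp.coeFn_smul (2 : ℂ) y, Lp.coeFn_smul (c ^ 2 : ℂ) x₂]
        with x g1 g2 g3 g4 g5 g6 g7 g8 g9 g10
      rw [g1, g2, g5, Pi.sub_apply, g6, Pi.add_apply, g7, Pi.smul_apply, g8, Pi.add_apply, g9,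
        Pi.smul_apply, g10, Pi.smul_apply, g3, g4, smul_eq_mul, smul_eq_mul, smul_eq_mul]
    constructor
    · rw [← inner_chirp (k := k) c, ← f1, ← f2, ← t1]
      rfl
    · rw [← inner_chirp (k := k) c, ← inner_chirp (k := k) c (d₁ + _), ← f1, ← f2, t2,
        inner_self_eq_norm_sq_to_K]
      push_cast
      rfl
  have hconj : ∀ (u v : Wave M) (p q : Config M → ℂ), u =ᵐ[volume] p → v =ᵐ[volume] q →
      ⟪u, v⟫_ℂ = ∫ x, q x * (starRingEnd ℂ) (p x) := fun u v p q hu hv => by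
    rw [L2.inner_def]
    refine integral_congr_ae ?_
    filter_upwards [hu, hv] with x g1 g2
    rw [g1, g2, RCLike.inner_apply]
  have r0 : φ =ᵐ[volume] (φ : Config M → ℂ) := Filter.EventuallyEq.refl _ _
  have r1 : d₁ =ᵐ[volume] (d₁ : Config M → ℂ) := Filter.EventuallyEq.refl _ _
  have hw := witness_identity (f := φ) (x₁ := x₁) (x₂ := x₂) (d₁ := d₁) (d₂ := d₂) (y := y)
    (m := thirdMoment k φ) s γ hs
    (by
      rw [hconj _ _ _ _ a1 hy, hconj _ _ _ _ a2 r1]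
      refine integral_congr_ae (Filter.Eventually.of_forall fun x => ?_)
      simp only [map_mul, map_pow, Complex.conj_ofReal]
      ring)
    (by
      rw [hconj _ _ _ _ r0 hy, hconj _ _ _ _ a1 r1]
      refine integral_congr_ae (Filter.Eventually.of_forall fun x => ?_)
      simp only [map_mul, map_pow, Complex.conj_ofReal]
      ring)
    (by
      rw [hconj _ _ _ _ a1 r0, hconj _ _ _ _ r0 a1]
      refine integral_congr_ae (Filter.Eventually.of_forall fun x => ?_)
      simp only [map_mul, map_pow, Complex.conj_ofReal]
      ring)
    (by
      rw [hconj _ _ _ _ a1 a2, hconj _ _ _ _ a2 a1]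
      refine integral_congr_ae (Filter.Eventually.of_forall fun x => ?_)
      simp only [map_mul, map_pow, Complex.conj_ofReal]
      ring)
    h3' (fun c hc => (key c hc).1) (fun c hc => (key c hc).2)
  refine ⟨d₁ + ((s ^ 2 : ℂ)⁻¹) • x₁ - (3 * Complex.I * γ) • x₂, ⟨d₁, hd1, ?_⟩, ?_⟩
  · filter_upwards [a1, a2, Lp.coeFn_sub (d₁ + ((s ^ 2 : ℂ)⁻¹) • x₁) ((3 * Complex.I * γ) • x₂),
      Lp.coeFn_add d₁ (((s ^ 2 : ℂ)⁻¹) • x₁), Lp.coeFn_smul ((s ^ 2 : ℂ)⁻¹) x₁,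
      Lp.coeFn_smul (3 * Complex.I * γ) x₂] with x g1 g2 g3 g4 g5 g6
    rw [g3, Pi.sub_apply, g4, Pi.add_apply, g5, Pi.smul_apply, g6, Pi.smul_apply, g1, g2,
      smul_eq_mul, smul_eq_mul]
    ring
  · rw [← hw, hn]
    have n1 : ∫ x, ‖φ x‖ ^ 2 * x k ^ 2 = ‖x₁‖ ^ 2 := by
      rw [← integral_norm_sq_eq]
      refine integral_congr_ae ?_
      filter_upwards [a1] with x g1
      rw [g1, norm_mul, norm_pow, Complex.norm_real, Real.norm_eq_abs, mul_pow, pow_one, sq_abs,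
        mul_comm]
    have n2 : ∫ x, ‖φ x‖ ^ 2 * x k ^ 4 = ‖x₂‖ ^ 2 := by
      rw [← integral_norm_sq_eq]
      refine integral_congr_ae ?_
      filter_upwards [a2] with x g1
      rw [g1, norm_mul, norm_pow, Complex.norm_real, Real.norm_eq_abs, mul_pow, sq_abs,
        mul_comm, ← pow_mul]
    rw [n1, n2]

/-- The witness on a vector of finite energy is at most the overlap with the ideal state. -/
theorem witness_le_norm_inner_sq {s : ℝ} (hs : 0 < s) (γ : ℝ) (φ : Wave M)
    (h : ∀ (k : Fin M) (a : Fin 6),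
      ∫⁻ v, ENNReal.ofReal ((v ^ deg a) ^ 2) ∂(vecHomodyne (quad a) k φ) < ⊤) :
    (1 + (M : ℝ) / 2) * ‖φ‖ ^ 2 +
      ∑ k : Fin M, ∑ a, coeff s γ a * ∫ v, v ^ deg a ∂(vecHomodyne (quad a) k φ) ≤
      ‖⟪cubic s hs γ M, φ⟫_ℂ‖ ^ 2 := by
  have hq : ∀ k : Fin M, Measurable fun ξ : Config M => 2 * Real.pi * ξ k := fun k => by fun_prop
  have hq' : ∀ k : Fin M, Measurable fun ξ : Config M => -(2 * Real.pi * ξ k) := fun k => by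
    fun_prop
  have hk : ∀ k : Fin M, Measurable fun ξ : Config M => ξ k := fun k => by fun_prop
  have hmode : ∀ k : Fin M, ∃ B : Wave M, (∃ u : Wave M, HasWeakDeriv k φ u ∧
      B =ᵐ[volume] fun x =>
        u x + ((x k : ℂ) / s ^ 2 - 3 * Complex.I * γ * (x k : ℂ) ^ 2) * φ x) ∧
      ∑ a, coeff s γ a * ∫ v, v ^ deg a ∂(vecHomodyne (quad a) k φ) =
        -(s ^ 2 / 2 * ‖B‖ ^ 2) - 1 / 2 * ‖φ‖ ^ 2 := by
    intro k
    have hx : MemLp (fun x => ((x k : ℝ) : ℂ) ^ 2 * φ x) 2 := by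
      -- The square of the observable `x̂²` is `x̂⁴`, so its second moment already puts `x² φ` in
      -- `L²`.
      have h0 := h k 0
      simp only [quad, deg, vecHomodyne, Matrix.cons_val_zero] at h0
      rw [lintegral_map_bornMeasure φ (hk k) (by fun_prop)] at h0
      have := memLp_mul_of_lintegral_lt_top φ ((hk k).pow_const 2) h0
      push_cast at this
      exact this
    have hp : ∀ c : ℝ, c = 0 ∨ c = 1 ∨ c = -1 → MemLp (fun ξ =>
        ((2 * Real.pi * ξ k : ℝ) : ℂ) ^ 3 * (𝓕 (chirp k c φ) : Wave M) ξ) 2 := by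
      have hred : ∀ ψ : Wave M, ∫⁻ ξ, ENNReal.ofReal (‖ψ ξ‖ ^ 2) *
          ENNReal.ofReal (((2 * Real.pi * ξ k) ^ 3) ^ 2) < ⊤ →
          MemLp (fun ξ => ((2 * Real.pi * ξ k : ℝ) : ℂ) ^ 3 * ψ ξ) 2 := fun ψ hψ => by
        have := memLp_mul_of_lintegral_lt_top ψ ((hq k).pow_const 3) hψ
        simp only [Complex.ofReal_pow] at this
        exact this
      -- The cubic observables number 3, 5 and 4 have as second moments the sixth moments of `p̂`,
      -- `x̂ + p̂` and `x̂ - p̂`. The last one has the opposite sign to the chirped momentum `p̂ -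
      -- x̂`, which even moments do not see.
      rintro c (rfl | rfl | rfl)
      · have h0 := h k 3
        simp only [quad, deg, vecHomodyne, Matrix.cons_val] at h0
        rw [lintegral_map_bornMeasure _ (hq k) (by fun_prop)] at h0
        rw [chirp_zero]
        exact hred _ h0
      · have h0 := h k 5
        simp only [quad, deg, vecHomodyne, Matrix.cons_val] at h0
        rw [lintegral_map_bornMeasure _ (hq k) (by fun_prop)] at h0
        exact hred _ h0
      · have h0 := h k 4
        simp only [quad, deg, vecHomodyne, Matrix.cons_val] at h0
        rw [lintegral_map_bornMeasure _ (hq' k) (by fun_prop)] at h0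
        refine hred _ (lt_of_le_of_lt (le_of_eq ?_) h0)
        refine lintegral_congr fun ξ => ?_
        congr 2
        ring
    obtain ⟨B, hB, hBeq⟩ := exists_lowering_eq hs γ hx hp
    refine ⟨B, hB, ?_⟩
    rw [← hBeq]
    simp only [Fin.sum_univ_six, coeff, quad, deg, vecHomodyne, Matrix.cons_val]
    rw [integral_map_bornMeasure _ (hk k) (by fun_prop), integral_map_bornMeasure _ (hk k) (by fun_prop),
      integral_map_bornMeasure _ (hq k) (by fun_prop), integral_map_bornMeasure _ (hq k) (by fun_prop),
      integral_map_bornMeasure _ (hq' k) (by fun_prop),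
      integral_map_bornMeasure _ (hq k) (by fun_prop)]
    simp only [thirdMoment, chirp_zero]
    have e : ∫ ξ, ‖(𝓕 (chirp k (-1) φ) : Wave M) ξ‖ ^ 2 * (-(2 * Real.pi * ξ k)) ^ 3 =
        -∫ ξ, ‖(𝓕 (chirp k (-1) φ) : Wave M) ξ‖ ^ 2 * (2 * Real.pi * ξ k) ^ 3 := by
      rw [← integral_neg]
      congr 1
      funext ξ
      ring
    rw [e]
  choose B hB hBeq using hmode
  -- The zero-point terms `1/2` of the `M` modes cancel the constant `M/2` of the witness; what
  -- remains is the gap.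
  have hgap := HasLowering.norm_sq_sub_le hs (f := φ) (B := B) hB
  simp only [hBeq, Finset.sum_sub_distrib, Finset.sum_neg_distrib, Finset.sum_const,
    Finset.card_univ, Fintype.card_fin, nsmul_eq_mul, ← Finset.mul_sum]
  linarith

end Witness

/-! ### Density operators -/

section Density

/-- Distinct basis vectors are `√2` apart and `L²` is separable. Countability makes the verdict law
s-finite, as the product of the test and verdict laws requires. -/
instance countable_basisIndex (M : ℕ) : Countable (basisIndex (Wave M)) := by
  have : Fact ((2 : ℝ≥0∞) ≠ ⊤) := ⟨by norm_num⟩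
  have : TopologicalSpace.SeparableSpace (Wave M) := inferInstance
  have ho := (basis (Wave M)).orthonormal
  refine Pairwise.countable_of_isOpen_disjoint
    (s := fun i : basisIndex (Wave M) => Metric.ball (basis (Wave M) i) (1 / 2)) ?_
    (fun i => Metric.isOpen_ball) (fun i => ⟨_, Metric.mem_ball_self one_half_pos⟩)
  intro i j hij
  refine Metric.ball_disjoint_ball ?_
  have h2 : ‖basis (Wave M) i - basis (Wave M) j‖ ^ 2 = 2 := by
    rw [@norm_sub_sq ℂ, ho.1 i, ho.1 j, ho.2 hij]
    norm_num
  rw [dist_eq_norm]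
  nlinarith [norm_nonneg (basis (Wave M) i - basis (Wave M) j)]

variable {H : Type*} [NormedAddCommGroup H] [InnerProductSpace ℂ H] [CompleteSpace H]

lemma DensityOperator.hasSum_norm_vec_sq (ρ : DensityOperator H) :
    HasSum (fun i => ‖ρ.vec i‖ ^ 2) 1 := by
  have h0 : (0 : H →L[ℂ] H) ≤ ρ.op := (ContinuousLinearMap.nonneg_iff_isPositive _).2 ρ.isPositive
  have hsq : CFC.sqrt ρ.op * CFC.sqrt ρ.op = ρ.op := CFC.sqrt_mul_sqrt_self ρ.op h0
  have hS : (CFC.sqrt ρ.op).IsPositive :=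
    (ContinuousLinearMap.nonneg_iff_isPositive _).1 (CFC.sqrt_nonneg ρ.op)
  have hsym : ∀ u v : H, ⟪(CFC.sqrt ρ.op) u, v⟫_ℂ = ⟪u, (CFC.sqrt ρ.op) v⟫_ℂ :=
    hS.isSymmetric
  have e : ∀ i, ⟪basis H i, ρ.op (basis H i)⟫_ℂ = ((‖ρ.vec i‖ ^ 2 : ℝ) : ℂ) := fun i => by
    rw [← hsq, mul_apply_eq_comp, ← hsym]
    have := inner_self_eq_norm_sq_to_K (𝕜 := ℂ) (ρ.vec i)
    rw [DensityOperator.vec] at this ⊢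
    rw [this]
    push_cast
    rfl
  have h := ρ.trace_eq_one
  simp only [e] at h
  rw [← Complex.ofReal_one] at h
  exact Complex.hasSum_ofReal.1 h

lemma DensityOperator.summable_norm_inner_vec_sq (ρ : DensityOperator H) (f : H) :
    Summable fun i => ‖⟪f, ρ.vec i⟫_ℂ‖ ^ 2 := by
  refine Summable.of_nonneg_of_le (fun i => by positivity) (fun i => ?_)
    (ρ.hasSum_norm_vec_sq.summable.mul_left (‖f‖ ^ 2))
  rw [← mul_pow]
  exact pow_le_pow_left₀ (norm_nonneg _) (norm_inner_le_norm _ _) 2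

end Density

/-! ### Homodyne laws -/

section Homodyne

variable {M : ℕ}

lemma bornMeasure_univ (φ : Wave M) : bornMeasure φ Set.univ = ENNReal.ofReal (‖φ‖ ^ 2) := by
  rw [bornMeasure, withDensity_apply _ MeasurableSet.univ, Measure.restrict_univ,
    lintegral_norm_sq_eq]

lemma vecHomodyne_univ (q : Quadrature) (k : Fin M) (φ : Wave M) :
    vecHomodyne q k φ Set.univ = ENNReal.ofReal (‖φ‖ ^ 2) := by
  cases q <;> simp only [vecHomodyne] <;>
    rw [Measure.map_apply (by fun_prop) MeasurableSet.univ, Set.preimage_univ, bornMeasure_univ] <;>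
    simp only [Lp.norm_fourier_eq, chirp, norm_phase]

instance isProbabilityMeasure_homodyne (ρ : DensityOperator (Wave M)) (q : Quadrature)
    (k : Fin M) : IsProbabilityMeasure (homodyne ρ q k) := by
  refine ⟨?_⟩
  rw [homodyne, Measure.sum_apply _ MeasurableSet.univ]
  simp only [vecHomodyne_univ]
  rw [← ENNReal.ofReal_tsum_of_nonneg (fun i => by positivity) ρ.hasSum_norm_vec_sq.summable,
    ρ.hasSum_norm_vec_sq.tsum_eq, ENNReal.ofReal_one]

variable {E : ℝ} {ρ : DensityOperator (Wave M)}

lemma FiniteEnergy.lintegral_vecHomodyne_lt_top (h : FiniteEnergy E ρ) (k : Fin M) (a : Fin 6)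
    (i : basisIndex (Wave M)) :
    ∫⁻ v, ENNReal.ofReal ((v ^ deg a) ^ 2) ∂(vecHomodyne (quad a) k (ρ.vec i)) < ⊤ := by
  refine lt_of_le_of_lt ?_ ((h k a).trans_lt ENNReal.ofReal_lt_top)
  exact lintegral_mono' (Measure.le_sum _ i) le_rfl

lemma FiniteEnergy.memLp (h : FiniteEnergy E ρ) (k : Fin M) (a : Fin 6) :
    MemLp (fun v : ℝ => v ^ deg a) 2 (homodyne ρ (quad a) k) := by
  have hm : AEStronglyMeasurable (fun v : ℝ => v ^ deg a) (homodyne ρ (quad a) k) := by fun_prop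
  rw [memLp_two_iff_integrable_sq hm]
  refine ⟨hm.pow 2, ?_⟩
  rw [hasFiniteIntegral_iff_ofReal (Filter.Eventually.of_forall fun x => by positivity)]
  exact (h k a).trans_lt ENNReal.ofReal_lt_top

lemma FiniteEnergy.integrable (h : FiniteEnergy E ρ) (k : Fin M) (a : Fin 6) :
    Integrable (fun v : ℝ => v ^ deg a) (homodyne ρ (quad a) k) :=
  (h.memLp k a).integrable (by norm_num)

/-- The witness value is additive over the vectors `√ρ eᵢ`. Finite energy makes the moments
integrable, so the integrals against the summed law may be taken term by term. -/
lemma FiniteEnergy.hasSum_witnessValue (h : FiniteEnergy E ρ) (s γ : ℝ) :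
    HasSum (fun i => (1 + (M : ℝ) / 2) * ‖ρ.vec i‖ ^ 2 + ∑ k : Fin M, ∑ a, coeff s γ a *
      ∫ v, v ^ deg a ∂(vecHomodyne (quad a) k (ρ.vec i))) (witnessValue s γ ρ) := by
  have h1 := ρ.hasSum_norm_vec_sq.mul_left (1 + (M : ℝ) / 2)
  rw [mul_one] at h1
  exact h1.add (hasSum_sum fun k _ => hasSum_sum fun a _ =>
    (hasSum_integral_measure (h.integrable k a)).mul_left _)

/-- The fidelity witness: `F_low` is a lower bound for the fidelity. -/
theorem FiniteEnergy.witnessValue_le (h : FiniteEnergy E ρ) {s : ℝ} (hs : 0 < s) (γ : ℝ) :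
    witnessValue s γ ρ ≤ ∑' i, ‖⟪cubic s hs γ M, ρ.vec i⟫_ℂ‖ ^ 2 :=
  hasSum_le (fun i => witness_le_norm_inner_sq hs γ (ρ.vec i)
    fun k a => h.lintegral_vecHomodyne_lt_top k a i) (h.hasSum_witnessValue s γ)
    (ρ.summable_norm_inner_vec_sq _).hasSum

end Homodyne

/-! ### The verdict -/

namespace Circuit

variable {m M : ℕ} (A : Circuit m M)

instance sFinite_verdictLaw (s : ℝ) (hs : 0 < s) (γ : ℝ) (ρ : DensityOperator (Wave M)) :
    SFinite (A.verdictLaw s hs γ ρ) := by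
  unfold verdictLaw
  infer_instance

/-- Adds the pure-state bounds over the vectors `√ρ eᵢ`: the squared norms sum to the trace `1`, and
the squared overlaps to the fidelity. -/
lemma verdictLaw_incorrect_le (s : ℝ) (hs : 0 < s) (γ : ℝ) (ρ : DensityOperator (Wave M)) :
    A.verdictLaw s hs γ ρ {z | z.2 = false} ≤
      ENNReal.ofReal (1 - ∑' i, ‖⟪cubic s hs γ M, ρ.vec i⟫_ℂ‖ ^ 2) := by
  have hS : MeasurableSet {z : Config M × Bool | z.2 = false} :=
    measurable_snd (measurableSet_singleton false)
  have hsum := ρ.hasSum_norm_vec_sq.sub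
    (ρ.summable_norm_inner_vec_sq (cubic s hs γ M)).hasSum
  rw [verdictLaw, Measure.sum_apply _ hS, ← hsum.tsum_eq, ENNReal.ofReal_tsum_of_nonneg _
    hsum.summable]
  · refine ENNReal.tsum_le_tsum fun i => ?_
    refine le_trans (le_of_eq ?_) (A.lintegral_incorrectPart_le s hs γ (norm_cubic hs) (ρ.vec i))
    rw [Measure.add_apply, Measure.map_apply (by fun_prop) hS, Measure.map_apply (by fun_prop) hS]
    simp [withDensity_apply _ MeasurableSet.univ]
  · intro i
    rw [sub_nonneg]
    refine pow_le_pow_left₀ (norm_nonneg _) ((norm_inner_le_norm _ _).trans ?_) 2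
    rw [norm_cubic, one_mul]

end Circuit

/-! ### The verification test -/

section Test

open ProbabilityTheory

/-- Chebyshev's inequality for the upper deviation of a sample mean. -/
lemma pi_sampleMean_ge_le {Ω : Type*} [MeasurableSpace Ω] {μ : Measure Ω} [IsProbabilityMeasure μ]
    {X : Ω → ℝ} (hX : MemLp X 2 μ) {V : ℝ} (hV : ∫ t, X t ^ 2 ∂μ ≤ V) {N : ℕ} (hN : 0 < N)
    {D : ℝ} (hD : 0 < D) :
    Measure.pi (fun _ : Fin N => μ) {t | ∫ v, X v ∂μ + D ≤ (1 / (N : ℝ)) * ∑ j, X (t j)} ≤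
      ENNReal.ofReal (V / (N * D ^ 2)) := by
  have hN' : (0 : ℝ) < N := Nat.cast_pos.2 hN
  have hc : ∀ j : Fin N, MemLp (fun t : Fin N → Ω => X (t j)) 2 (Measure.pi fun _ => μ) := fun j =>
    hX.comp_measurePreserving (measurePreserving_eval (fun _ => μ) j)
  have hS : MemLp (∑ j : Fin N, fun t : Fin N → Ω => X (t j)) 2 (Measure.pi fun _ => μ) :=
    memLp_finsetSum' _ fun j _ => hc j
  have hmean : ∫ t, (∑ j : Fin N, fun t : Fin N → Ω => X (t j)) t ∂(Measure.pi fun _ => μ) =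
      N * ∫ v, X v ∂μ := by
    simp only [Finset.sum_apply]
    rw [integral_finsetSum _ fun j _ => (hc j).integrable (by norm_num)]
    have he : ∀ j : Fin N, ∫ t : Fin N → Ω, X (t j) ∂(Measure.pi fun _ => μ) = ∫ v, X v ∂μ :=
      fun j => integral_comp_eval (μ := fun _ : Fin N => μ) (i := j) hX.1
    simp [he]
  have hvar : Var[∑ j : Fin N, fun t : Fin N → Ω => X (t j); Measure.pi fun _ => μ] ≤ N * V := by
    rw [variance_sum_pi (X := fun _ => X) fun _ => hX]
    simp only [Finset.sum_const, Finset.card_univ, Fintype.card_fin, nsmul_eq_mul]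
    exact mul_le_mul_of_nonneg_left ((variance_le_expectation_sq hX.1).trans hV) hN'.le
  refine (measure_mono ?_).trans ((meas_ge_le_variance_div_sq hS (mul_pos hN' hD)).trans
    (ENNReal.ofReal_le_ofReal ?_))
  · intro t ht
    simp only [Set.mem_ofPred_eq] at ht ⊢
    rw [hmean, Finset.sum_apply]
    refine le_trans ?_ (le_abs_self _)
    rw [one_div, inv_mul_eq_div, le_div_iff₀ hN'] at ht
    linarith
  · rw [div_le_div_iff₀ (by positivity) (by positivity)]
    calc _ ≤ N * V * (N * D ^ 2) := mul_le_mul_of_nonneg_right hvar (by positivity)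
      _ = _ := by ring

variable {s γ : ℝ} {M : ℕ}

lemma sum_abs_coeff_pos (hs : 0 < s) (γ : ℝ) : 0 < ∑ a, |coeff s γ a| := by
  refine Finset.sum_pos' (fun a _ => abs_nonneg _) ⟨0, Finset.mem_univ _, ?_⟩
  rw [abs_pos]
  simp [coeff, hs.ne']

lemma totalWeight_eq (s γ : ℝ) (M : ℕ) : totalWeight s γ M = M * ∑ a, |coeff s γ a| := by
  simp [totalWeight]

lemma totalWeight_pos (hs : 0 < s) (γ : ℝ) (hM : 0 < M) : 0 < totalWeight s γ M := by
  rw [totalWeight_eq]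
  exact mul_pos (Nat.cast_pos.2 hM) (sum_abs_coeff_pos hs γ)

lemma sum_abs_coeff_div_totalWeight (hs : 0 < s) (γ : ℝ) (hM : 0 < M) :
    ∑ a : Fin M × Fin 6, |coeff s γ a.2| / totalWeight s γ M = 1 := by
  rw [← Finset.sum_div, Fintype.sum_prod_type]
  exact div_self (totalWeight_pos hs γ hM).ne'

lemma isProbabilityMeasure_trialLaw (hs : 0 < s) (γ : ℝ) (hM : 0 < M)
    (ρ : DensityOperator (Wave M)) : IsProbabilityMeasure (trialLaw s γ ρ) := by
  refine ⟨?_⟩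
  have h : ∀ a : Fin M × Fin 6, (homodyne ρ (quad a.2) a.1).map (fun v => (a, v)) Set.univ = 1 :=
    fun a => by
      rw [Measure.map_apply (by fun_prop) MeasurableSet.univ, Set.preimage_univ, measure_univ]
  rw [trialLaw, Measure.finsetSum_apply]
  simp only [Measure.smul_apply, h, smul_eq_mul, mul_one]
  rw [← ENNReal.ofReal_sum_of_nonneg fun a _ =>
    div_nonneg (abs_nonneg _) (totalWeight_pos hs γ hM).le,
    sum_abs_coeff_div_totalWeight hs γ hM, ENNReal.ofReal_one]

/-- The contribution of one trial to the estimate of `F_low`. -/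
def trialValue (s γ : ℝ) {M : ℕ} (t : Trial M) : ℝ :=
  totalWeight s γ M * SignType.sign (coeff s γ t.1.2) * t.2 ^ deg t.1.2

lemma measurable_trialValue (s γ : ℝ) (M : ℕ) :
    Measurable (trialValue s γ : Trial M → ℝ) := by
  refine measurable_from_prod_countable_right fun a => ?_
  simp only [trialValue]
  fun_prop

lemma measurable_estimate (s γ : ℝ) (M N : ℕ) :
    Measurable (estimate s γ : (Fin N → Trial M) → ℝ) := by
  have h := measurable_trialValue s γ M
  change Measurable fun t : Fin N → Trial M =>
    1 + (M : ℝ) / 2 + (1 / (N : ℝ)) * ∑ j, trialValue s γ (t j)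
  fun_prop

lemma sign_sq_le_one (x : ℝ) : ((SignType.sign x : ℝ)) ^ 2 ≤ 1 := by
  rcases lt_trichotomy x 0 with h | h | h <;> simp [h]

variable {E : ℝ} {ρ : DensityOperator (Wave M)}

/-- Each trial value is a measured observable times `±Λ` (or `0`), so averaging over the drawn
observables keeps the bound `Λ² |E|`. As `Λ` is proportional to `M`, this is the origin of `M²` in
the sample size. -/
lemma FiniteEnergy.lintegral_trialValue_sq_le (h : FiniteEnergy E ρ) (hs : 0 < s) (γ : ℝ)
    (hM : 0 < M) : ∫⁻ t, ENNReal.ofReal (trialValue s γ t ^ 2) ∂(trialLaw s γ ρ) ≤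
      ENNReal.ofReal (totalWeight s γ M ^ 2 * |E|) := by
  have hmeas : Measurable fun t : Trial M => ENNReal.ofReal (trialValue s γ t ^ 2) :=
    ((measurable_trialValue s γ M).pow_const 2).ennreal_ofReal
  have hL := totalWeight_pos hs γ hM
  have hw : ∀ a : Fin M × Fin 6, 0 ≤ |coeff s γ a.2| / totalWeight s γ M := fun a =>
    div_nonneg (abs_nonneg _) hL.le
  rw [trialLaw, lintegral_finsetSum_measure]
  have hb : ∀ a : Fin M × Fin 6, ∫⁻ t, ENNReal.ofReal (trialValue s γ t ^ 2)
      ∂((homodyne ρ (quad a.2) a.1).map fun v => (a, v)) ≤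
      ENNReal.ofReal (totalWeight s γ M ^ 2 * |E|) := by
    intro a
    rw [lintegral_map hmeas (by fun_prop), ENNReal.ofReal_mul (sq_nonneg _)]
    calc _ ≤ ∫⁻ v, ENNReal.ofReal (totalWeight s γ M ^ 2) * ENNReal.ofReal ((v ^ deg a.2) ^ 2)
          ∂(homodyne ρ (quad a.2) a.1) := by
          refine lintegral_mono fun v => ?_
          rw [← ENNReal.ofReal_mul (sq_nonneg _)]
          refine ENNReal.ofReal_le_ofReal ?_
          rw [trialValue, mul_pow, mul_pow]
          exact mul_le_mul_of_nonneg_right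
            (mul_le_of_le_one_right (sq_nonneg _) (sign_sq_le_one _)) (sq_nonneg _)
      _ ≤ _ := by
          rw [lintegral_const_mul _ (by fun_prop)]
          gcongr
          exact (h a.1 a.2).trans (ENNReal.ofReal_le_ofReal (le_abs_self E))
  calc _ ≤ ∑ a : Fin M × Fin 6, ENNReal.ofReal (|coeff s γ a.2| / totalWeight s γ M) *
        ENNReal.ofReal (totalWeight s γ M ^ 2 * |E|) := by
        refine Finset.sum_le_sum fun a _ => ?_
        rw [lintegral_smul_measure, smul_eq_mul]
        gcongr
        exact hb a
    _ = _ := by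
        rw [← Finset.sum_mul, ← ENNReal.ofReal_sum_of_nonneg fun a _ => hw a,
          sum_abs_coeff_div_totalWeight hs γ hM, ENNReal.ofReal_one, one_mul]

lemma FiniteEnergy.memLp_trialValue (h : FiniteEnergy E ρ) (hs : 0 < s) (γ : ℝ) (hM : 0 < M) :
    MemLp (trialValue s γ) 2 (trialLaw s γ ρ) := by
  have hm := (measurable_trialValue s γ M).aestronglyMeasurable (μ := trialLaw s γ ρ)
  rw [memLp_two_iff_integrable_sq hm]
  refine ⟨hm.pow 2, ?_⟩
  rw [hasFiniteIntegral_iff_ofReal (Filter.Eventually.of_forall fun x => by positivity)]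
  exact (h.lintegral_trialValue_sq_le hs γ hM).trans_lt ENNReal.ofReal_lt_top

lemma FiniteEnergy.integral_trialValue_sq_le (h : FiniteEnergy E ρ) (hs : 0 < s) (γ : ℝ)
    (hM : 0 < M) : ∫ t, trialValue s γ t ^ 2 ∂(trialLaw s γ ρ) ≤ totalWeight s γ M ^ 2 * |E| := by
  rw [integral_eq_lintegral_of_nonneg_ae (Filter.Eventually.of_forall fun x => sq_nonneg _)
    ((measurable_trialValue s γ M).aestronglyMeasurable.pow 2)]
  exact ENNReal.toReal_le_of_le_ofReal (by positivity) (h.lintegral_trialValue_sq_le hs γ hM)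

/-- Importance sampling is unbiased: probability `|λ|/Λ` times value `Λ sign(λ)` is `λ`. -/
lemma FiniteEnergy.witnessValue_eq (h : FiniteEnergy E ρ) (hs : 0 < s) (γ : ℝ) (hM : 0 < M) :
    witnessValue s γ ρ = 1 + (M : ℝ) / 2 + ∫ t, trialValue s γ t ∂(trialLaw s γ ρ) := by
  have hL := totalWeight_pos hs γ hM
  have hmeas := measurable_trialValue s γ M
  have hmap : ∀ a : Fin M × Fin 6, Integrable (trialValue s γ)
      ((homodyne ρ (quad a.2) a.1).map fun v => (a, v)) := fun a => by
    rw [integrable_map_measure hmeas.aestronglyMeasurable (by fun_prop)]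
    have hc := (h.integrable a.1 a.2).const_mul
      (totalWeight s γ M * SignType.sign (coeff s γ a.2) : ℝ)
    exact hc.congr (Filter.Eventually.of_forall fun v => by rw [Function.comp_apply, trialValue])
  have hval : ∀ a : Fin M × Fin 6, ∫ t, trialValue s γ t
      ∂(ENNReal.ofReal (|coeff s γ a.2| / totalWeight s γ M) •
        (homodyne ρ (quad a.2) a.1).map fun v => (a, v)) =
      coeff s γ a.2 * ∫ v, v ^ deg a.2 ∂(homodyne ρ (quad a.2) a.1) := fun a => by
    rw [integral_smul_measure, integral_map (by fun_prop) hmeas.aestronglyMeasurable,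
      ENNReal.toReal_ofReal (div_nonneg (abs_nonneg _) hL.le)]
    simp only [trialValue]
    rw [integral_const_mul, smul_eq_mul, ← mul_assoc]
    congr 1
    conv_rhs => rw [← abs_mul_sign (coeff s γ a.2)]
    field_simp
  have hsum : ∫ t, trialValue s γ t ∂(trialLaw s γ ρ) =
      ∑ a : Fin M × Fin 6, coeff s γ a.2 * ∫ v, v ^ deg a.2 ∂(homodyne ρ (quad a.2) a.1) := by
    rw [trialLaw, integral_finsetSum_measure fun a _ =>
      (hmap a).smul_measure ENNReal.ofReal_ne_top]
    exact Finset.sum_congr rfl fun a _ => hval a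
  rw [hsum, Fintype.sum_prod_type, witnessValue]

lemma isProbabilityMeasure_testLaw (hs : 0 < s) (γ : ℝ) (hM : 0 < M) (N : ℕ)
    (ρ : DensityOperator (Wave M)) : IsProbabilityMeasure (testLaw s γ N ρ) := by
  have := isProbabilityMeasure_trialLaw hs γ hM ρ
  unfold testLaw
  infer_instance

/-- The probability that a state with small `F_low` passes the test. -/
lemma FiniteEnergy.testLaw_accepts_le (h : FiniteEnergy E ρ) (hs : 0 < s) (γ : ℝ) (hM : 0 < M)
    {N : ℕ} (hN : 0 < N) {F_T η : ℝ} (hD : 0 < F_T + η - witnessValue s γ ρ) :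
    testLaw s γ N ρ {t | Accepts s γ F_T η t} ≤ ENNReal.ofReal
      (totalWeight s γ M ^ 2 * |E| / (N * (F_T + η - witnessValue s γ ρ) ^ 2)) := by
  have := isProbabilityMeasure_trialLaw hs γ hM ρ
  refine (measure_mono fun t ht => ?_).trans (pi_sampleMean_ge_le
    (h.memLp_trialValue hs γ hM) (h.integral_trialValue_sq_le hs γ hM) hN hD)
  have ht' : F_T + η ≤ 1 + (M : ℝ) / 2 + (1 / (N : ℝ)) * ∑ j, trialValue s γ (t j) := ht
  have hw := h.witnessValue_eq hs γ hM
  simp only [Set.mem_ofPred_eq]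
  linarith

/-- Accepting a state with `w ≤ F_T` forces an estimation error of at least `η`. -/
lemma TestAccurate.testLaw_accepts_le {η β : ℝ} {N : ℕ} (hT : TestAccurate s γ E η β M N)
    (h : FiniteEnergy E ρ) (hs : 0 < s) (hM : 0 < M) (hβ1 : β ≤ 1)
    {F_T : ℝ} (hw : witnessValue s γ ρ ≤ F_T) :
    testLaw s γ N ρ {t | Accepts s γ F_T η t} ≤ ENNReal.ofReal β := by
  have := isProbabilityMeasure_testLaw hs γ hM N ρ
  have hm : MeasurableSet {t : Fin N → Trial M | |estimate s γ t - witnessValue s γ ρ| < η} :=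
    measurableSet_lt (((measurable_estimate s γ M N).sub_const _).abs) measurable_const
  calc _ ≤ testLaw s γ N ρ {t | |estimate s γ t - witnessValue s γ ρ| < η}ᶜ := by
        refine measure_mono fun t ht => ?_
        simp only [Set.mem_ofPred_eq, Accepts, Set.mem_compl_iff, not_lt] at ht ⊢
        exact le_trans (by linarith) (le_abs_self _)
    _ = 1 - testLaw s γ N ρ {t | |estimate s γ t - witnessValue s γ ρ| < η} := prob_compl_eq_one_sub hm
    _ ≤ 1 - ENNReal.ofReal (1 - β) := tsub_le_tsub_left (hT ρ h) _
    _ = _ := by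
        rw [← ENNReal.ofReal_one, ← ENNReal.ofReal_sub _ (by linarith), sub_sub_cancel]

end Test

/-! ### The joint probability of acceptance and error -/

namespace Circuit

/-- Independence makes the event a rectangle for a product measure. The minimum with `1` serves the
case in which `w` may be very negative. -/
lemma runLaw_le {m M : ℕ} (A : Circuit m M) {s : ℝ} (hs : 0 < s) {γ E : ℝ} (F_T η : ℝ) (N : ℕ)
    {ρ : DensityOperator (Wave M)} (h : FiniteEnergy E ρ) :
    A.runLaw s hs γ N ρ {z | Accepts s γ F_T η z.1 ∧ z.2.2 = false} ≤
      testLaw s γ N ρ {t | Accepts s γ F_T η t} *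
        ENNReal.ofReal (min 1 (1 - witnessValue s γ ρ)) := by
  have hset : {z : (Fin N → Trial M) × (Config M × Bool) |
      Accepts s γ F_T η z.1 ∧ z.2.2 = false} =
      {t | Accepts s γ F_T η t} ×ˢ {z | z.2 = false} := rfl
  rw [runLaw, hset, Measure.prod_prod]
  gcongr
  refine (A.verdictLaw_incorrect_le s hs γ ρ).trans (ENNReal.ofReal_le_ofReal (le_min ?_ ?_))
  · have : 0 ≤ ∑' i, ‖⟪cubic s hs γ M, ρ.vec i⟫_ℂ‖ ^ 2 := tsum_nonneg fun i => by positivity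
    linarith
  · linarith [h.witnessValue_le hs γ]

end Circuit

/-- The largest value of `(1 - w) η² / (F_T + η - w)²` over `w ≤ F_T` is at most `1 - F_T`. -/
lemma chebyshev_mul_infidelity_le {F_T η w v : ℝ} (hη : 0 < η) (hηF : η ≤ (1 - F_T) / 2)
    (hw : w < F_T) (hv : v ≤ η ^ 2) :
    v / (F_T + η - w) ^ 2 * (1 - w) ≤ 1 - F_T := by
  have hD : 0 < F_T + η - w := by linarith
  have hδ : 0 < 1 - w := by linarith
  rw [div_mul_eq_mul_div, div_le_iff₀ (by positivity)]
  -- With `u = F_T - w` and `τ = 1 - F_T` the claim reduces to `η² (τ + u) ≤ τ (η + u)²`, that is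
  -- `η² u ≤ 2τηu + τu²`, which follows from `2η ≤ τ`.
  obtain ⟨u, hu⟩ : ∃ u, u = F_T - w := ⟨_, rfl⟩
  obtain ⟨τ, hτ⟩ : ∃ τ, τ = 1 - F_T := ⟨_, rfl⟩
  have hu0 : 0 < u := by linarith
  have hτη : 2 * η ≤ τ := by linarith
  have e1 : F_T + η - w = η + u := by linarith
  have e2 : 1 - w = τ + u := by linarith
  rw [e1, e2, ← hτ]
  have h1 : v * (τ + u) ≤ η ^ 2 * (τ + u) := mul_le_mul_of_nonneg_right hv (by linarith)
  have h2 : 2 * η * (η * u) ≤ τ * (η * u) := mul_le_mul_of_nonneg_right hτη (by positivity)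
  have h3 : 0 ≤ τ * u ^ 2 := mul_nonneg (by linarith) (sq_nonneg _)
  nlinarith [mul_pos (mul_pos hη hη) hu0]

end CVVerify

end

/-! ### Choice of the constant and the case distinction on the witness value -/

theorem theorem2 (s : ℝ) (hs : 0 < s) (γ : ℝ) (E : ℝ) :
    ∃ C : ℝ, 0 < C ∧ ∀ (m M N : ℕ) (A : CVVerify.Circuit m M) (F_T η β : ℝ),
      0 < M → 0 < F_T → F_T < 1 → 0 < β → β < 1 → 0 < η → η ≤ (1 - F_T) / 2 →
      (C * ((M : ℝ) ^ 2 / η ^ 2) * Real.log (8 / β) ≤ (N : ℝ) ∨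
        CVVerify.TestAccurate s γ E η β M N) →
      A.IsVerifiable s hs γ F_T η N E (1 - (1 - β) * F_T) := by
  -- The product is the second-moment bound of a trial divided by `M²`; the summand `1` keeps the
  -- constant, and with it `N`, positive.
  refine ⟨(∑ a, |CVVerify.coeff s γ a|) ^ 2 * |E| + 1, by positivity, ?_⟩
  intro m M N A F_T η β hM hF0 hF1 hβ0 hβ1 hη hηF hN
  have hp : 0 ≤ (1 - β) * F_T := mul_nonneg (by linarith) hF0.le
  have hq : (1 - β) * F_T ≤ F_T := mul_le_of_le_one_left hF0.le (by linarith)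
  have hq' : (1 - β) * F_T ≤ 1 - β := mul_le_of_le_one_right (by linarith) hF1.le
  refine ⟨by linarith, by linarith, fun ρ h => (A.runLaw_le hs F_T η N h).trans ?_⟩
  have := CVVerify.isProbabilityMeasure_testLaw hs γ hM N ρ
  -- A large witness value makes the output reliable whatever the test says; otherwise the test has
  -- to contribute.
  rcases le_or_gt F_T (CVVerify.witnessValue s γ ρ) with hw | hw
  · refine (mul_le_of_le_one_left zero_le prob_le_one).trans (ENNReal.ofReal_le_ofReal ?_)
    exact (min_le_right _ _).trans (by linarith)
  rcases hN with hN | hT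
  · have hM' : (0 : ℝ) < M := Nat.cast_pos.2 hM
    -- The logarithm enters only through `8/β > e`: Chebyshev at the scale `η` already suffices,
    -- because the infidelity factor gives a bound `1 - F_T ≤ ε` independent of `β`.
    have hlog : 1 ≤ Real.log (8 / β) := by
      rw [Real.le_log_iff_exp_le (by positivity), le_div_iff₀ hβ0]
      nlinarith [Real.exp_one_lt_d9, Real.exp_pos 1]
    have hN0 : ((∑ a, |CVVerify.coeff s γ a|) ^ 2 * |E| + 1) * ((M : ℝ) ^ 2 / η ^ 2) ≤ N :=
      (le_mul_of_one_le_right (by positivity) hlog).trans hN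
    have hN' : (0 : ℝ) < N := lt_of_lt_of_le (by positivity) hN0
    have hV : CVVerify.totalWeight s γ M ^ 2 * |E| / N ≤ η ^ 2 := by
      rw [div_le_iff₀ hN', CVVerify.totalWeight_eq, mul_pow]
      calc _ ≤ η ^ 2 * (((∑ a, |CVVerify.coeff s γ a|) ^ 2 * |E| + 1) *
            ((M : ℝ) ^ 2 / η ^ 2)) := by
            field_simp
            linarith
        _ ≤ _ := mul_le_mul_of_nonneg_left hN0 (sq_nonneg _)
    have hb := CVVerify.chebyshev_mul_infidelity_le hη hηF hw hV
    calc _ ≤ ENNReal.ofReal (CVVerify.totalWeight s γ M ^ 2 * |E| /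
          (N * (F_T + η - CVVerify.witnessValue s γ ρ) ^ 2)) *
          ENNReal.ofReal (1 - CVVerify.witnessValue s γ ρ) :=
          mul_le_mul' (h.testLaw_accepts_le hs γ hM (Nat.cast_pos.1 hN') (by linarith))
            (ENNReal.ofReal_le_ofReal (min_le_right _ _))
      _ ≤ _ := by
          rw [← ENNReal.ofReal_mul (by positivity), ← div_div]
          exact ENNReal.ofReal_le_ofReal (hb.trans (by linarith))
  -- Here the infidelity is bounded trivially by `1`, and `β ≤ ε` because `(1 - β) F_T ≤ 1 - β`.
  · calc _ ≤ ENNReal.ofReal β * 1 := mul_le_mul'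
          (hT.testLaw_accepts_le h hs hM hβ1.le hw.le)
          (ENNReal.ofReal_le_one.2 (min_le_left _ _))
      _ ≤ _ := by
          rw [mul_one]
          exact ENNReal.ofReal_le_ofReal (by linarith)
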